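/- Let $(y_{m,n})_{n\in\mathbb Z}$, $m\ge 1$, be mutually independent, stationary, zero-mean, circularly symmetric complex Gaussian time series with autocovariances $r_m(k)=\mathbb E[y_{m,n+k}\overline{y_{m,n}}]=\int_0^1\mathcal S_m(\nu)e^{2\pi i\nu k}\,d\nu$, whose spectral densities satisfy $\sup_m\sup_{\nu\in[0,1]}\mathcal S_m(\nu)<\infty$ and $\inf_m\inf_{\nu\in[0,1]}\mathcal S_m(\nu)>0$, and such that $\sup_m\sum_{k\in\mathbb Z}(1+|k|)^{\gamma_0}|r_m(k)|<\infty$ for some $\gamma_0>0$. Let $M=M(N)$ and $L=L(N)$ be such that, as $N\to\infty$, $M\to\infty$, $ML/N\to c_\star\in(0,\infty)$ and $L=O(N^\beta)$ for some $\beta\in(0,1)$. Let $\mathbf y_n^L\in\mathbb C^{ML}$ be the vector obtained by stacking, for $m=1,\dots,M$, the vectors $(y_{m,n},\dots,y_{m,n+L-1})^T$. Put $\widehat{\mathcal R}_L=\frac1N\sum_{n=1}^N\mathbf y_n^L(\mathbf y_n^L)^H$ and let $\mathcal B_L$ be the block-diagonal matrix formed by the $M$ diagonal blocks, of size $L\times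 L$, of $\mathbb E[\mathbf y_n^L(\mathbf y_n^L)^H]$. Put $\overline{\mathcal R}_N=\mathcal B_L^{-1/2}\widehat{\mathcal R}_L\mathcal B_L^{-1/2}$, with eigenvalues $\overline\lambda_{1,N},\dots,\overline\lambda_{ML,N}$, and for $\phi:\mathbb R\to\mathbb R$ let $$\overline\phi_N=\frac1{ML}\sum_{k=1}^{ML}\phi(\overline\lambda_{k,N}).$$ Call $\alpha_0>0$ a concentration level if for each $\alpha\ge\alpha_0$ there are $\epsilon>0$ and $N_0$ such that $\mathbb P(\|\overline{\mathcal R}_N\|>\alpha)\le\exp(-N^{\epsilon})$ for all $N\ge N_0$, where $\|\cdot\|$ is the spectral norm. Then concentration levels exist. Moreover, let $\alpha_0>0$ be any concentration level and let $\phi$ be a Borel measurable function that is $C^\infty$ on an open neighbourhood of $[0,\alpha_0]$ and satisfies $\mathbb E\big[\frac1{ML}\sum_{k}|\phi(\overline\lambda_{k,N})|\big]<\infty$ for all large $N$ (so that $\mathbb E\,\overline\phi_N$ is well defined). Then $$\left|\overline\phi_N-\mathbb E\,\overline\phi_N\right|\prec\frac1{M\sqrt L},$$ that is, for every $\epsilon>0$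 there are $\gamma>0$ and $N_0$ such that, for all $N\ge N_0$, $$\mathbb P\left(\left|\overline\phi_N-\mathbb E\,\overline\phi_N\right|>\frac{N^\epsilon}{M\sqrt L}\right)\le\exp(-N^\gamma).$$ -/

import Mathlib

open MeasureTheory ProbabilityTheory Filter Topology
open scoped NNReal ComplexConjugate

noncomputable section

namespace BlockCorr

variable {Ω : Type*} [MeasurableSpace Ω]

/-- `z` follows a circularly symmetric complex Gaussian law `N_ℂ(0, δ²)`: its real and imaginary
parts are independent and both `N(0, δ²/2)` (here `v = δ²/2`; `v = 0` is the law of `0`). -/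
def IsCircularGaussian (P : Measure Ω) (z : Ω → ℂ) : Prop :=
  ∃ v : ℝ≥0, IndepFun (fun ω => (z ω).re) (fun ω => (z ω).im) P ∧
    P.map (fun ω => (z ω).re) = gaussianReal 0 v ∧
    P.map (fun ω => (z ω).im) = gaussianReal 0 v

/-- The autocovariance `r_m(k) = E[y_{m,k} conj(y_{m,0})]` of the `m`-th series. -/
def autocov (P : Measure Ω) (y : ℕ → ℤ → Ω → ℂ) (m : ℕ) (k : ℤ) : ℂ :=
  ∫ ω, y m k ω * conj (y m 0 ω) ∂P

/-- The complex time series `(y_{m,n})_{n ∈ ℤ}`, `m ∈ ℕ`, are mutually independent, zero mean,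
stationary and circularly symmetric Gaussian (every finite linear combination of the variables of
a series is `N_ℂ(0, δ²)`). For such series stationarity amounts to `E[y_{m,n+k} conj(y_{m,n})]`
not depending on `n`. -/
structure IsIndepGaussianSeries (P : Measure Ω) (y : ℕ → ℤ → Ω → ℂ) : Prop where
  measurable : ∀ m n, Measurable (y m n)
  indep : iIndepFun (fun (m : ℕ) (ω : Ω) (n : ℤ) => y m n ω) P
  gaussian : ∀ (m : ℕ) (s : Finset ℤ) (a : ℤ → ℂ),
    IsCircularGaussian P (fun ω => ∑ n ∈ s, a n * y m n ω)
  stationary : ∀ (m : ℕ) (n k : ℤ),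
    ∫ ω, y m (n + k) ω * conj (y m n ω) ∂P = autocov P y m k

/-- `S m` is a spectral density of the `m`-th series:
`r_m(k) = ∫₀¹ S_m(ν) exp(2πiνk) dν` for every `k ∈ ℤ`. -/
def IsSpectralDensity (P : Measure Ω) (y : ℕ → ℤ → Ω → ℂ) (S : ℕ → ℝ → ℝ) : Prop :=
  ∀ m, IntervalIntegrable (S m) volume 0 1 ∧
    ∀ k : ℤ, autocov P y m k =
      ∫ ν in (0 : ℝ)..1, (S m ν : ℂ) * Complex.exp (2 * Real.pi * Complex.I * ν * k)

/-- The spectral densities are bounded above, and bounded below away from zero, on `[0, 1]`,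
uniformly in `m`. -/
def UniformlyBoundedDensities (S : ℕ → ℝ → ℝ) : Prop :=
  (∃ smax : ℝ, ∀ m, ∀ ν ∈ Set.Icc (0 : ℝ) 1, S m ν ≤ smax) ∧
    ∃ smin : ℝ, 0 < smin ∧ ∀ m, ∀ ν ∈ Set.Icc (0 : ℝ) 1, smin ≤ S m ν

/-- `sup_m ∑_{k ∈ ℤ} (1 + |k|)^γ₀ |r_m(k)| < ∞`. -/
def UniformlyWeightedSummable (P : Measure Ω) (y : ℕ → ℤ → Ω → ℂ) (γ₀ : ℝ) : Prop :=
  (∀ m, Summable fun k : ℤ => (1 + |(k : ℝ)|) ^ γ₀ * ‖autocov P y m k‖) ∧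
    ∃ C : ℝ, ∀ m, ∑' k : ℤ, (1 + |(k : ℝ)|) ^ γ₀ * ‖autocov P y m k‖ ≤ C

/-- The asymptotic regime: `M = M(N) → ∞`, `M L / N → c` as `N → ∞`, and `L = L(N) = O(N^β)`. -/
structure IsAsymptoticRegime (M L : ℕ → ℕ) (c β : ℝ) : Prop where
  tendsto_M : Tendsto M atTop atTop
  tendsto_ratio : Tendsto (fun N : ℕ => ((M N : ℝ) * (L N : ℝ)) / (N : ℝ)) atTop (𝓝 c)
  isBigO_L : (fun N : ℕ => (L N : ℝ)) =O[atTop] fun N : ℕ => (N : ℝ) ^ β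

/-- The `ML`-dimensional vector `y_n^L`: its entry `(m, l)`, `0 ≤ m < M`, `0 ≤ l < L`, is
`y_{m, n + l}`. -/
def lagVector (y : ℕ → ℤ → Ω → ℂ) (M L : ℕ) (n : ℤ) (ω : Ω) : Fin M × Fin L → ℂ :=
  fun p => y p.1 (n + ((p.2 : ℕ) : ℤ)) ω

/-- The spatio-temporal covariance matrix `R_L = E[y_n^L (y_n^L)^H]` (at `n = 1`; by stationarity
it does not depend on `n`). -/
def covMatrix (P : Measure Ω) (y : ℕ → ℤ → Ω → ℂ) (M L : ℕ) :
    Matrix (Fin M × Fin L) (Fin M × Fin L) ℂ :=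
  Matrix.of fun p q => ∫ ω, lagVector y M L 1 ω p * conj (lagVector y M L 1 ω q) ∂P

/-- `Bdiag(A)`: the block diagonal matrix with the `L × L` diagonal blocks of `A`. -/
def bdiag {M L : ℕ} (A : Matrix (Fin M × Fin L) (Fin M × Fin L) ℂ) :
    Matrix (Fin M × Fin L) (Fin M × Fin L) ℂ :=
  Matrix.of fun p q => if p.1 = q.1 then A p q else 0

/-- The sample estimate `R̂_L = (1/N) ∑_{n=1}^N y_n^L (y_n^L)^H`. -/
def sampleCov (y : ℕ → ℤ → Ω → ℂ) (M L N : ℕ) (ω : Ω) :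
    Matrix (Fin M × Fin L) (Fin M × Fin L) ℂ :=
  (N : ℂ)⁻¹ • ∑ n ∈ Finset.Icc 1 N,
    Matrix.vecMulVec (lagVector y M L n ω) (star (lagVector y M L n ω))

/-- `A^{-1/2}` for a positive definite matrix `A`, by the functional calculus. -/
def invSqrt {ι : Type*} [Fintype ι] [DecidableEq ι] (A : Matrix ι ι ℂ) : Matrix ι ι ℂ :=
  cfc (fun t : ℝ => (Real.sqrt t)⁻¹) A

/-- The matrix `B_L^{-1/2} R̂_L B_L^{-1/2}`, where `B_L = Bdiag(R_L)`. -/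
def barCorr (P : Measure Ω) (y : ℕ → ℤ → Ω → ℂ) (M L N : ℕ) (ω : Ω) :
    Matrix (Fin M × Fin L) (Fin M × Fin L) ℂ :=
  invSqrt (bdiag (covMatrix P y M L)) * sampleCov y M L N ω *
    invSqrt (bdiag (covMatrix P y M L))

theorem isHermitian_invSqrt {ι : Type*} [Fintype ι] [DecidableEq ι] (A : Matrix ι ι ℂ) :
    (invSqrt A).IsHermitian :=
  cfc_predicate (R := ℝ) (p := IsSelfAdjoint) (fun t : ℝ => (Real.sqrt t)⁻¹) A

theorem isHermitian_sampleCov {Ω' : Type*} (y : ℕ → ℤ → Ω' → ℂ) (M L N : ℕ) (ω : Ω') :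
    (sampleCov y M L N ω).IsHermitian := by
  simp [Matrix.IsHermitian, sampleCov, Matrix.conjTranspose_sum, Matrix.conjTranspose_smul]

theorem isHermitian_barCorr (P : Measure Ω) (y : ℕ → ℤ → Ω → ℂ) (M L N : ℕ) (ω : Ω) :
    (barCorr P y M L N ω).IsHermitian := by
  have h1 := isHermitian_invSqrt (bdiag (covMatrix P y M L))
  have h2 := isHermitian_sampleCov y M L N ω
  simp only [Matrix.IsHermitian, barCorr, Matrix.conjTranspose_mul, Matrix.mul_assoc] at *
  rw [h1, h2]

/-- The linear statistic `(1/(ML)) ∑_k φ(λ_k)` of the eigenvalues `λ_k` of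
`B_L^{-1/2} R̂_L B_L^{-1/2}`. -/
def barPhi (P : Measure Ω) (y : ℕ → ℤ → Ω → ℂ) (M L N : ℕ) (φ : ℝ → ℝ) (ω : Ω) : ℝ :=
  ((M : ℝ) * (L : ℝ))⁻¹ *
    ∑ k : Fin M × Fin L, φ ((isHermitian_barCorr P y M L N ω).eigenvalues k)

open scoped Matrix.Norms.L2Operator in
/-- The spectral norm of a matrix. -/
def specNorm {ι : Type*} [Fintype ι] [DecidableEq ι] (A : Matrix ι ι ℂ) : ℝ := ‖A‖

/-- `α₀` is a level above which the spectral norm of `B_L^{-1/2} R̂_L B_L^{-1/2}` lies only with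
exponentially small probability: for each `α ≥ α₀` there are `ε > 0` and `N₀` with
`P(‖B_L^{-1/2} R̂_L B_L^{-1/2}‖ > α) ≤ exp(-N^ε)` for all `N ≥ N₀`. -/
def IsConcentrationLevel (P : Measure Ω) (y : ℕ → ℤ → Ω → ℂ) (M L : ℕ → ℕ) (α₀ : ℝ) : Prop :=
  ∀ α : ℝ, α₀ ≤ α → ∃ ε : ℝ, 0 < ε ∧ ∃ N₀ : ℕ, ∀ N : ℕ, N₀ ≤ N →
    P.real {ω | α < specNorm (barCorr P y (M N) (L N) N ω)} ≤ Real.exp (-((N : ℝ) ^ ε))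

/-- Stochastic domination `X ≺ Y` of families indexed by `N ∈ ℕ` and `u ∈ U N`: for all `ε > 0`
there is `γ > 0` with `sup_u P(X_N(u) > N^ε Y_N(u)) ≤ exp(-N^γ)` for all large `N`. -/
def StochDominated (P : Measure Ω) {U : ℕ → Type*} (X Y : ∀ N, U N → Ω → ℝ) : Prop :=
  ∀ ε : ℝ, 0 < ε → ∃ γ : ℝ, 0 < γ ∧ ∃ N₀ : ℕ, ∀ N : ℕ, N₀ ≤ N → ∀ u : U N,
    P.real {ω | (N : ℝ) ^ ε * Y N u ω < X N u ω} ≤ Real.exp (-((N : ℝ) ^ γ))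

end BlockCorr

end

/-!
The observations are a linear image of a standard Gaussian vector `g` of dimension `O(N²)`, by a map
whose norm is bounded through the spectral densities (`exists_map_seriesVector_eq`). The correlation
matrix is `W Wᴴ` for a matrix `W` that is linear in `g`, with squared Frobenius norm
`O(L / N) ‖g‖²`: every observation occurs at most `L` times in a block Hankel matrix, and the
whitening is bounded (`exists_linear_gaussian_model`).

*The rate.* Where `‖W Wᴴ‖ ≤ α`, the statistic `(1/ML) ∑ φ(λ_k)` of a function that is Lipschitz on
`[0, α]` is Lipschitz in `g` with constant of order `(ML)^(-1/2) (L/N)^(1/2) = (M N)^(-1/2)`, since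
linear statistics of eigenvalues are Lipschitz for the Frobenius norm (`abs_sum_eigenvalues_sub_le`).
As `ML / N` converges, this is of the order of `1 / (M √L)`. It coincides there with a bounded
Lipschitz function on the whole space (`exists_concentrated_eq_linStat`), to which Gaussian
concentration applies (`measure_abs_sub_integral_gt_le`); the latter is proved by the rotation argument
of Maurey and Pisier, after a mollification.

*Concentration levels.* The bilinear form of a block Hankel matrix is an average over the `2 L`-th
roots of unity of bilinear forms of `M × Q` matrices, `Q` of order `N / L`, made of discrete Fourier
transforms over disjoint windows (`norm_sum_hankel_le`). These have Gaussian bilinear forms with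
variance `O(L)`, so that a union bound over nets gives a probability `exp (-κ x N / L)` for the norm to
exceed `x`, for every `x` above a constant (`exists_measure_specNorm_gt_le`).

*The mean.* On the exceptional event where the norm exceeds `α` nothing is known of `φ` except that the
statistic of `|φ|` is integrable, whereas the mean of the statistic has to be compared with that of
its bounded version. Eigenvalues are homogeneous of degree two in `g`. Averaging over the dilations
`g ↦ t g`, `t ∈ [1 - 1/n, 1]`, in dimension `n`, therefore replaces `φ` by an integral
`∫ |φ(s²)| exp (-C s²) ds` at a polynomial price (`lintegral_sum_indicator_le`), and that integral
is finite, again by dilations, as soon as the statistic of `|φ|` is integrable for one choice of the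
dimensions (`exists_lintegral_weight_ne_top`). What is left is of the order of the square root of the
probability of the exceptional event.
-/


/-! ### Gaussian concentration of Lipschitz functions -/

namespace BlockCorr

section Concentration

open scoped ENNReal RealInnerProductSpace

variable {E : Type*} [NormedAddCommGroup E] [InnerProductSpace ℝ E]

/-- The difference of a `C¹` function at two points, as the integral of its derivative along the
quarter circle joining them. Jensen's inequality then moves the exponential inside. -/
theorem exp_sub_le_lintegral_rotation {F : E → ℝ} (hF : ContDiff ℝ 1 F) (p : E × E) :
    ENNReal.ofReal (Real.exp (F p.2 - F p.1)) ≤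
      ENNReal.ofReal (2 / Real.pi) * ∫⁻ θ in Set.Ioc 0 (Real.pi / 2),
        ENNReal.ofReal (Real.exp (Real.pi / 2 *
          fderiv ℝ F (ContinuousLinearMap.rotation θ p).1
            (ContinuousLinearMap.rotation θ p).2)) := by
  have hpi : (0 : ℝ) < Real.pi / 2 := by positivity
  set g : ℝ → ℝ := fun θ => fderiv ℝ F (ContinuousLinearMap.rotation θ p).1
            (ContinuousLinearMap.rotation θ p).2 with hg
  have hc1 : ∀ θ : ℝ, HasDerivAt (fun θ : ℝ => (ContinuousLinearMap.rotation θ p).1)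
      (ContinuousLinearMap.rotation θ p).2 θ := by
    intro θ
    simp only [ContinuousLinearMap.rotation_apply]
    exact ((Real.hasDerivAt_cos θ).smul_const p.1).add ((Real.hasDerivAt_sin θ).smul_const p.2)
  have hcont1 : Continuous (fun θ : ℝ => (ContinuousLinearMap.rotation θ p).1) := by
    simp only [ContinuousLinearMap.rotation_apply]; fun_prop
  have hcont2 : Continuous (fun θ : ℝ => (ContinuousLinearMap.rotation θ p).2) := by
    simp only [ContinuousLinearMap.rotation_apply]; fun_prop
  have hgc : Continuous g :=
    ((hF.continuous_fderiv one_ne_zero).comp hcont1).clm_apply hcont2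
  have hder : ∀ θ ∈ Set.uIcc 0 (Real.pi / 2),
      HasDerivAt (fun θ : ℝ => F (ContinuousLinearMap.rotation θ p).1) (g θ) θ := fun θ _ =>
    (((hF.differentiable one_ne_zero) _).hasFDerivAt).comp_hasDerivAt θ (hc1 θ)
  have hint := intervalIntegral.integral_eq_sub_of_hasDerivAt hder
    (hgc.intervalIntegrable _ _)
  simp only [ContinuousLinearMap.rotation_apply, Real.cos_pi_div_two, Real.sin_pi_div_two,
    Real.cos_zero, Real.sin_zero, zero_smul, one_smul, zero_add, add_zero] at hint
  rw [← hint, intervalIntegral.integral_of_le hpi.le]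
  set ν := (volume : Measure ℝ).restrict (Set.Ioc 0 (Real.pi / 2)) with hν
  have hνu : ν.real Set.univ = Real.pi / 2 := by
    simp [hν, Measure.real, hpi.le]
  have : NeZero ν := ⟨by
    intro h
    rw [h] at hνu
    simp only [measureReal_zero, Pi.zero_apply] at hνu
    exact hpi.ne hνu⟩
  have hi1 : Integrable (fun θ => Real.pi / 2 * g θ) ν :=
    ((hgc.const_mul _).integrableOn_Ioc)
  have hi2 : Integrable (fun θ => Real.exp (Real.pi / 2 * g θ)) ν :=
    ((Real.continuous_exp.comp (hgc.const_mul _)).integrableOn_Ioc)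
  have hJ := convexOn_exp.map_average_le (μ := ν) (f := fun θ => Real.pi / 2 * g θ)
    Real.continuous_exp.continuousOn isClosed_univ (by simp) hi1 hi2
  rw [average_eq, average_eq, hνu, integral_const_mul] at hJ
  simp only [smul_eq_mul] at hJ
  rw [← mul_assoc, inv_mul_cancel₀ hpi.ne', one_mul, inv_div] at hJ
  refine (ENNReal.ofReal_le_ofReal hJ).trans ?_
  rw [ENNReal.ofReal_mul (by positivity),
    ofReal_integral_eq_lintegral_ofReal hi2 (ae_of_all _ fun _ => (Real.exp_pos _).le)]

variable [FiniteDimensional ℝ E] [MeasurableSpace E] [BorelSpace E]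

theorem stdGaussian_map_dual (L : E →L[ℝ] ℝ) :
    (stdGaussian E).map L = gaussianReal 0 (‖L‖ ^ 2).toNNReal := by
  rw [IsGaussian.map_eq_gaussianReal, integral_strongDual_stdGaussian, variance_dual_stdGaussian]

theorem lintegral_exp_gaussianReal (v : ℝ≥0) (t : ℝ) :
    ∫⁻ x, ENNReal.ofReal (Real.exp (t * x)) ∂(gaussianReal 0 v)
      = ENNReal.ofReal (Real.exp (v * t ^ 2 / 2)) := by
  rw [← ofReal_integral_eq_lintegral_ofReal]
  · have := congrFun (mgf_id_gaussianReal (μ := 0) (v := v)) t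
    simp only [mgf, id, zero_mul, zero_add] at this
    rw [this]
  · exact integrable_exp_mul_gaussianReal t
  · exact ae_of_all _ fun x => (Real.exp_pos _).le

theorem lintegral_exp_dual_stdGaussian (L : E →L[ℝ] ℝ) :
    ∫⁻ y, ENNReal.ofReal (Real.exp (L y)) ∂(stdGaussian E)
      = ENNReal.ofReal (Real.exp (‖L‖ ^ 2 / 2)) := by
  have h := lintegral_exp_gaussianReal (‖L‖ ^ 2).toNNReal 1
  rw [← stdGaussian_map_dual, lintegral_map (by fun_prop) (by fun_prop)] at h
  simpa [Real.coe_toNNReal _ (sq_nonneg ‖L‖)] using h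

theorem measurePreserving_rotation_stdGaussian (θ : ℝ) :
    MeasurePreserving (ContinuousLinearMap.rotation θ : E × E →L[ℝ] E × E)
      ((stdGaussian E).prod (stdGaussian E)) ((stdGaussian E).prod (stdGaussian E)) :=
  ⟨by fun_prop, IsGaussian.map_rotation_eq_self (by simp) θ⟩

/-- Integrating the bound along the quarter circle: the rotations preserve the law of two
independent standard Gaussian vectors, and given the first of them the derivative is a centred
Gaussian variable with standard deviation at most `K`. -/
theorem lintegral_exp_sub_le {F : E → ℝ} (hF : ContDiff ℝ 1 F) {K : ℝ}
    (hK : ∀ x, ‖fderiv ℝ F x‖ ≤ K) :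
    ∫⁻ x, ∫⁻ y, ENNReal.ofReal (Real.exp (F x - F y)) ∂(stdGaussian E) ∂(stdGaussian E)
      ≤ ENNReal.ofReal (Real.exp (Real.pi ^ 2 * K ^ 2 / 8)) := by
  set γ := stdGaussian E
  have hFc := hF.continuous
  have hF' := hF.continuous_fderiv one_ne_zero
  set G : E × E → ℝ≥0∞ := fun q => ENNReal.ofReal (Real.exp (Real.pi / 2 * fderiv ℝ F q.1 q.2))
    with hG
  have hGc : Continuous G := by
    apply ENNReal.continuous_ofReal.comp
    apply Real.continuous_exp.comp
    exact continuous_const.mul ((hF'.comp continuous_fst).clm_apply continuous_snd)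
  have hGint : ∫⁻ q, G q ∂(γ.prod γ) ≤ ENNReal.ofReal (Real.exp (Real.pi ^ 2 * K ^ 2 / 8)) := by
    rw [lintegral_prod _ hGc.measurable.aemeasurable]
    calc ∫⁻ x, ∫⁻ y, G (x, y) ∂γ ∂γ
        ≤ ∫⁻ x, ENNReal.ofReal (Real.exp (Real.pi ^ 2 * K ^ 2 / 8)) ∂γ := by
          refine lintegral_mono fun x => ?_
          have := lintegral_exp_dual_stdGaussian ((Real.pi / 2) • fderiv ℝ F x)
          simp only [hG, smul_apply, smul_eq_mul] at this ⊢
          rw [this]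
          apply ENNReal.ofReal_le_ofReal
          apply Real.exp_le_exp.2
          rw [norm_smul, mul_pow, Real.norm_eq_abs, sq_abs]
          have := pow_le_pow_left₀ (norm_nonneg _) (hK x) 2
          nlinarith [Real.pi_pos, sq_nonneg Real.pi, mul_le_mul_of_nonneg_left this (sq_nonneg Real.pi)]
      _ = _ := by simp
  have hjoint : Measurable (fun q : (E × E) × ℝ => G (ContinuousLinearMap.rotation q.2 q.1)) := by
    apply (hGc.comp _).measurable
    simp only [ContinuousLinearMap.rotation_apply]
    fun_prop
  calc ∫⁻ x, ∫⁻ y, ENNReal.ofReal (Real.exp (F x - F y)) ∂γ ∂γ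
      = ∫⁻ q : E × E, ENNReal.ofReal (Real.exp (F q.2 - F q.1)) ∂(γ.prod γ) := by
        rw [lintegral_prod_symm _ (by fun_prop)]
    _ ≤ ∫⁻ q : E × E, ENNReal.ofReal (2 / Real.pi) * (∫⁻ θ in Set.Ioc 0 (Real.pi / 2),
          G (ContinuousLinearMap.rotation θ q)) ∂(γ.prod γ) :=
        lintegral_mono fun q => exp_sub_le_lintegral_rotation hF q
    _ = ENNReal.ofReal (2 / Real.pi) * ∫⁻ θ in Set.Ioc 0 (Real.pi / 2), ∫⁻ q : E × E,
          G (ContinuousLinearMap.rotation θ q) ∂(γ.prod γ) := by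
        rw [lintegral_const_mul' _ _ (by simp), lintegral_lintegral_swap]
        exact hjoint.aemeasurable
    _ = ENNReal.ofReal (2 / Real.pi) * ∫⁻ θ in Set.Ioc 0 (Real.pi / 2), ∫⁻ q : E × E,
          G q ∂(γ.prod γ) := by
        congr 1
        refine lintegral_congr fun θ => ?_
        exact (measurePreserving_rotation_stdGaussian (E := E) θ).lintegral_comp hGc.measurable
    _ = ∫⁻ q : E × E, G q ∂(γ.prod γ) := by
        rw [setLIntegral_const, Real.volume_Ioc, sub_zero, mul_comm, mul_assoc,
          ← ENNReal.ofReal_mul (by positivity)]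
        have : Real.pi / 2 * (2 / Real.pi) = 1 := by field_simp
        rw [this]; simp
    _ ≤ _ := hGint

theorem integrable_of_lipschitzWith_stdGaussian {F : E → ℝ} {K : ℝ≥0} (hF : LipschitzWith K F) :
    Integrable F (stdGaussian E) := by
  have hid : Integrable (fun x : E => x) (stdGaussian E) := IsGaussian.integrable_id
  refine Integrable.mono' ((hid.norm.const_mul K).add (integrable_const ‖F 0‖))
    hF.continuous.aestronglyMeasurable (ae_of_all _ fun x => ?_)
  have h := hF.dist_le_mul x 0
  rw [dist_zero_right, Real.dist_eq] at h
  simp only [Pi.add_apply, Real.norm_eq_abs]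
  have := abs_add_le (F x - F 0) (F 0)
  simp only [sub_add_cancel] at this
  linarith

/-- The upper tail, by the exponential Markov inequality. By Jensen, subtracting the mean of `F`
costs no more than subtracting an independent copy of `F`. -/
theorem measure_sub_integral_gt_le_of_contDiff {F : E → ℝ} (hF : ContDiff ℝ 1 F) {K : ℝ≥0}
    (hK0 : 0 < K) (hK : LipschitzWith K F) {t : ℝ} (ht : 0 ≤ t) :
    (stdGaussian E).real {x | t < F x - ∫ y, F y ∂(stdGaussian E)}
      ≤ Real.exp (-(2 * t ^ 2 / (Real.pi ^ 2 * K ^ 2))) := by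
  set γ := stdGaussian E
  set m := ∫ y, F y ∂γ with hm
  have hint : Integrable F γ := integrable_of_lipschitzWith_stdGaussian hK
  have hK0' : (0 : ℝ) < K := hK0
  -- the value of the Laplace parameter minimizing `s ^ 2 π ^ 2 K ^ 2 / 8 - s t`
  set s : ℝ := 4 * t / (Real.pi ^ 2 * K ^ 2) with hs
  have hs0 : 0 ≤ s := by positivity
  have hjen : ∀ x, ENNReal.ofReal (Real.exp (s * (F x - m)))
      ≤ ∫⁻ y, ENNReal.ofReal (Real.exp (s * F x - s * F y)) ∂γ := by
    intro x
    by_cases htop : ∫⁻ y, ENNReal.ofReal (Real.exp (s * F x - s * F y)) ∂γ = ∞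
    · rw [htop]; exact le_top
    have hFc := hF.continuous
    have hi : Integrable (fun y => Real.exp (s * F x - s * F y)) γ := by
      refine ⟨by fun_prop, ?_⟩
      rw [hasFiniteIntegral_iff_ofReal (ae_of_all _ fun _ => (Real.exp_pos _).le)]
      exact lt_top_iff_ne_top.2 htop
    have hi1 : Integrable (fun y => s * F x - s * F y) γ :=
      (integrable_const _).sub (hint.const_mul s)
    have hJ := convexOn_exp.map_integral_le (μ := γ) (f := fun y => s * F x - s * F y)
      Real.continuous_exp.continuousOn isClosed_univ (by simp) hi1 hi
    rw [integral_sub (integrable_const _) (hint.const_mul s)] at hJ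
    simp only [integral_const_mul, integral_const, probReal_univ, one_smul, ← hm] at hJ
    rw [← ofReal_integral_eq_lintegral_ofReal hi (ae_of_all _ fun _ => (Real.exp_pos _).le),
      mul_sub]
    exact ENNReal.ofReal_le_ofReal hJ
  have hsF : ContDiff ℝ 1 (fun x => s * F x) := contDiff_const.mul hF
  have hsK : ∀ x, ‖fderiv ℝ (fun x => s * F x) x‖ ≤ s * K := by
    intro x
    rw [fderiv_const_mul ((hF.differentiable one_ne_zero) x), norm_smul, Real.norm_eq_abs,
      abs_of_nonneg hs0]
    exact mul_le_mul_of_nonneg_left (norm_fderiv_le_of_lipschitz ℝ hK) hs0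
  have hbd := (lintegral_mono hjen).trans (lintegral_exp_sub_le hsF hsK)
  have hmark : γ {x | t < F x - m} ≤
      ENNReal.ofReal (Real.exp (-(s * t))) * ∫⁻ x, ENNReal.ofReal (Real.exp (s * (F x - m))) ∂γ := by
    rw [← lintegral_const_mul' _ _ (by simp)]
    have hFc := hF.continuous
    rw [← lintegral_indicator_one (measurableSet_lt measurable_const
      (by fun_prop : Measurable fun x => F x - m))]
    refine lintegral_mono fun x => ?_
    by_cases hx : t < F x - m
    · rw [Set.indicator_of_mem (by exact hx), ← ENNReal.ofReal_mul (Real.exp_pos _).le,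
        ← Real.exp_add, Pi.one_apply, ← ENNReal.ofReal_one]
      apply ENNReal.ofReal_le_ofReal
      rw [Real.one_le_exp_iff]
      nlinarith
    · rw [Set.indicator_of_notMem (by exact hx)]; exact zero_le
  have h2 := hmark.trans (mul_le_mul_right hbd _)
  rw [← ENNReal.ofReal_mul (Real.exp_pos _).le, ← Real.exp_add] at h2
  have h3 := ENNReal.toReal_mono (by simp) h2
  rw [ENNReal.toReal_ofReal (Real.exp_pos _).le] at h3
  refine h3.trans (Real.exp_le_exp.2 (le_of_eq ?_))
  rw [hs]
  field_simp
  ring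

/-- A Lipschitz function lies within its Lipschitz constant of a `C¹` function with the same
Lipschitz constant, namely its convolution with a bump function supported in the unit ball. -/
theorem exists_contDiff_lipschitzWith_dist_le {F : E → ℝ} {K : ℝ≥0} (hF : LipschitzWith K F) :
    ∃ G : E → ℝ, ContDiff ℝ 1 G ∧ LipschitzWith K G ∧ ∀ x, |G x - F x| ≤ K := by
  let b : ContDiffBump (0 : E) := ⟨1 / 2, 1, by norm_num, by norm_num⟩
  have hloc : LocallyIntegrable F volume := hF.continuous.locallyIntegrable
  refine ⟨MeasureTheory.convolution (b.normed volume) F (ContinuousLinearMap.lsmul ℝ ℝ) volume,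
    ?_, ?_, ?_⟩
  · exact (b.hasCompactSupport_normed).contDiff_convolution_left _
      (b.contDiff_normed (n := 1)) hloc
  · have hce : ConvolutionExists (b.normed volume) F (ContinuousLinearMap.lsmul ℝ ℝ) volume :=
      (b.hasCompactSupport_normed).convolutionExists_left _ b.continuous_normed hloc
    refine LipschitzWith.of_dist_le_mul fun x y => ?_
    rw [Real.dist_eq, convolution_def, convolution_def,
      ← integral_sub (hce x) (hce y)]
    have hb1 : ∫ t, b.normed volume t * (K * dist x y) = K * dist x y := by
      rw [integral_mul_const, b.integral_normed, one_mul]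
    rw [← hb1, ← Real.norm_eq_abs]
    refine norm_integral_le_of_norm_le ?_ (ae_of_all _ fun t => ?_)
    · exact (b.integrable_normed).mul_const _
    · simp only [ContinuousLinearMap.lsmul_apply, smul_eq_mul]
      rw [← mul_sub, norm_mul, Real.norm_of_nonneg (b.nonneg_normed t)]
      refine mul_le_mul_of_nonneg_left ?_ (b.nonneg_normed t)
      have := hF.dist_le_mul (x - t) (y - t)
      rwa [dist_sub_right, Real.dist_eq] at this
  · intro x
    have h := b.dist_normed_convolution_le (μ := volume) (g := F) (x₀ := x) (ε := K)
      hF.continuous.aestronglyMeasurable (fun y hy => by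
        refine (hF.dist_le_mul y x).trans ?_
        have hy' : dist y x < 1 := hy
        nlinarith [K.2, dist_nonneg (x := y) (y := x)])
    rwa [Real.dist_eq] at h

/-- Two-sided Gaussian concentration. The function is replaced by a `C¹` one within `K`, and half of
the threshold pays for the replacement, of the function and of its mean. -/
theorem measure_abs_sub_integral_gt_le {F : E → ℝ} {K : ℝ≥0} (hK0 : 0 < K)
    (hF : LipschitzWith K F) {t : ℝ} (ht : 4 * K ≤ t) :
    (stdGaussian E).real {x | t < |F x - ∫ y, F y ∂(stdGaussian E)|}
      ≤ 2 * Real.exp (-(t ^ 2 / (2 * Real.pi ^ 2 * K ^ 2))) := by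
  obtain ⟨G, hG1, hG2, hG3⟩ := exists_contDiff_lipschitzWith_dist_le hF
  have hK0' : (0 : ℝ) < K := hK0
  set γ := stdGaussian E
  have hiF : Integrable F γ := integrable_of_lipschitzWith_stdGaussian hF
  have hiG : Integrable G γ := integrable_of_lipschitzWith_stdGaussian hG2
  have hm : |∫ y, G y ∂γ - ∫ y, F y ∂γ| ≤ K := by
    rw [← integral_sub hiG hiF, ← Real.norm_eq_abs]
    have := norm_integral_le_of_norm_le_const (μ := γ) (f := fun y => G y - F y) (C := K)
      (ae_of_all _ fun x => by rw [Real.norm_eq_abs]; exact hG3 x)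
    simpa using this
  have ht0 : 0 ≤ t / 2 := by linarith
  have h1 := measure_sub_integral_gt_le_of_contDiff hG1 hK0 hG2 ht0
  have h2 := measure_sub_integral_gt_le_of_contDiff (hG1.neg) hK0
    (hG2.neg : LipschitzWith K fun x => -G x) ht0
  rw [integral_neg] at h2
  have hsub : {x | t < |F x - ∫ y, F y ∂γ|} ⊆ {x | t / 2 < G x - ∫ y, G y ∂γ} ∪
      {x | t / 2 < -G x - -∫ y, G y ∂γ} := by
    intro x hx
    simp only [Set.mem_ofPred_eq, Set.mem_union] at hx ⊢
    have h3 := abs_le.1 (hG3 x)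
    have h4 := abs_le.1 hm
    rcases lt_abs.1 hx with h | h
    · left; linarith [h3.1, h4.2]
    · right; linarith [h3.2, h4.1]
  refine (measureReal_mono hsub).trans ((measureReal_union_le _ _).trans ?_)
  have he : 2 * (t / 2) ^ 2 / (Real.pi ^ 2 * (K : ℝ) ^ 2) = t ^ 2 / (2 * Real.pi ^ 2 * K ^ 2) := by
    field_simp
  rw [he] at h1 h2
  linarith

end Concentration

end BlockCorr

/-! ### Eigenvalues of Hermitian matrices and the Frobenius norm -/

namespace BlockCorr

section Eigenvalues

open scoped Matrix Matrix.Norms.L2Operator ComplexOrder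

variable {I J K : Type*} [Fintype I] [Fintype J] [Fintype K]

/-- The squared Frobenius norm `∑ |A i j|²`. -/
noncomputable def frobSq (A : Matrix I J ℂ) : ℝ := ∑ i, ∑ j, ‖A i j‖ ^ 2

theorem frobSq_nonneg (A : Matrix I J ℂ) : 0 ≤ frobSq A := by
  unfold frobSq; positivity

theorem frobSq_eq_trace (A : Matrix I J ℂ) : (frobSq A : ℂ) = (A * Aᴴ).trace := by
  simp only [frobSq, Matrix.trace, Matrix.diag_apply, Matrix.mul_apply,
    Matrix.conjTranspose_apply, Complex.ofReal_sum]
  refine Finset.sum_congr rfl fun i _ => Finset.sum_congr rfl fun j _ => ?_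
  rw [RCLike.star_def, Complex.mul_conj, Complex.normSq_eq_norm_sq]

theorem frobSq_conjTranspose (A : Matrix I J ℂ) : frobSq Aᴴ = frobSq A := by
  simp only [frobSq, Matrix.conjTranspose_apply, norm_star]
  exact Finset.sum_comm

theorem frobSq_mul_le [DecidableEq I] [DecidableEq J] (A : Matrix I J ℂ) (B : Matrix J K ℂ) :
    frobSq (A * B) ≤ ‖A‖ ^ 2 * frobSq B := by
  have hcol : ∀ k, ∑ i, ‖(A * B) i k‖ ^ 2 ≤ ‖A‖ ^ 2 * ∑ j, ‖B j k‖ ^ 2 := by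
    intro k
    have h := Matrix.l2_opNorm_mulVec A (WithLp.toLp 2 (fun j => B j k))
    have h2 := pow_le_pow_left₀ (norm_nonneg _) h 2
    rw [mul_pow, EuclideanSpace.norm_sq_eq, EuclideanSpace.norm_sq_eq] at h2
    exact h2
  unfold frobSq
  rw [Finset.sum_comm, Finset.sum_comm (γ := J), Finset.mul_sum]
  exact Finset.sum_le_sum fun k _ => hcol k

theorem frobSq_unitary_mul_mul [DecidableEq I] (U V : Matrix.unitaryGroup I ℂ)
    (A : Matrix I I ℂ) : frobSq ((U : Matrix I I ℂ) * A * (V : Matrix I I ℂ)) = frobSq A := by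
  have hV : (V : Matrix I I ℂ) * (V : Matrix I I ℂ)ᴴ = 1 := Unitary.coe_mul_star_self V
  have hU : (U : Matrix I I ℂ)ᴴ * (U : Matrix I I ℂ) = 1 := Unitary.coe_star_mul_self U
  have : (frobSq ((U : Matrix I I ℂ) * A * (V : Matrix I I ℂ)) : ℂ) = frobSq A := by
    rw [frobSq_eq_trace, frobSq_eq_trace, Matrix.conjTranspose_mul, Matrix.conjTranspose_mul]
    calc _ = ((U : Matrix I I ℂ) * (A * ((V : Matrix I I ℂ) * (V : Matrix I I ℂ)ᴴ) * Aᴴ)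
          * (U : Matrix I I ℂ)ᴴ).trace := by simp only [Matrix.mul_assoc]
      _ = _ := by rw [hV, mul_one, Matrix.trace_mul_comm, ← Matrix.mul_assoc, hU, one_mul]
  exact_mod_cast this

/-- Linear statistics of eigenvalues are Lipschitz for the Frobenius norm. The squared moduli
`|⟨u_i, v_j⟩|²` of the inner products of the eigenvectors form a doubly stochastic matrix, so that
the difference of the statistics is the average of `φ(a_i) - φ(b_j)` against it, whereas
`∑ (a_i - b_j)² |⟨u_i, v_j⟩|²` is the squared Frobenius norm of `A - B`. -/
theorem abs_sum_eigenvalues_sub_le [DecidableEq I] {A B : Matrix I I ℂ} (hA : A.IsHermitian)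
    (hB : B.IsHermitian) {φ : ℝ → ℝ} {s : Set ℝ} {C : ℝ} (hC : 0 ≤ C)
    (hφ : ∀ x ∈ s, ∀ y ∈ s, |φ x - φ y| ≤ C * |x - y|)
    (hAs : ∀ i, hA.eigenvalues i ∈ s) (hBs : ∀ i, hB.eigenvalues i ∈ s) :
    |∑ i, φ (hA.eigenvalues i) - ∑ i, φ (hB.eigenvalues i)|
      ≤ C * √(Fintype.card I) * √(frobSq (A - B)) := by
  set U := hA.eigenvectorUnitary with hU
  set V := hB.eigenvectorUnitary with hV
  set a := hA.eigenvalues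
  set b := hB.eigenvalues
  set Q : Matrix.unitaryGroup I ℂ := star U * V with hQ
  set p : I → I → ℝ := fun i j => ‖(Q : Matrix I I ℂ) i j‖ ^ 2 with hp
  have hrow : ∀ i, ∑ j, p i j = 1 := by
    intro i
    have h : ((Q : Matrix I I ℂ) * (Q : Matrix I I ℂ)ᴴ) i i = 1 := by
      have h0 : (Q : Matrix I I ℂ) * (Q : Matrix I I ℂ)ᴴ = 1 := Unitary.coe_mul_star_self Q
      rw [h0, Matrix.one_apply_eq]
    simp only [Matrix.mul_apply, Matrix.conjTranspose_apply, RCLike.star_def, Complex.mul_conj,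
      Complex.normSq_eq_norm_sq] at h
    exact_mod_cast h
  have hcol : ∀ j, ∑ i, p i j = 1 := by
    intro j
    have h : ((Q : Matrix I I ℂ)ᴴ * (Q : Matrix I I ℂ)) j j = 1 := by
      have h0 : (Q : Matrix I I ℂ)ᴴ * (Q : Matrix I I ℂ) = 1 := Unitary.coe_star_mul_self Q
      rw [h0, Matrix.one_apply_eq]
    simp only [Matrix.mul_apply, Matrix.conjTranspose_apply, RCLike.star_def,
      Complex.conj_mul'] at h
    exact_mod_cast h
  have hent : ∀ i j, (((star U : Matrix.unitaryGroup I ℂ) : Matrix I I ℂ) * (A - B) * (V : Matrix I I ℂ)) i j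
      = ((a i - b j : ℝ) : ℂ) * (Q : Matrix I I ℂ) i j := by
    intro i j
    have h1 : ((star U : Matrix.unitaryGroup I ℂ) : Matrix I I ℂ) * A
        = Matrix.diagonal (RCLike.ofReal ∘ a) * ((star U : Matrix.unitaryGroup I ℂ) : Matrix I I ℂ) := by
      have h := hA.conjStarAlgAut_star_eigenvectorUnitary
      rw [Unitary.conjStarAlgAut_star_apply] at h
      rw [← h, Matrix.mul_assoc, ← Unitary.coe_star, Unitary.coe_mul_star_self, mul_one]
    have h2 : B * (V : Matrix I I ℂ) = (V : Matrix I I ℂ) * Matrix.diagonal (RCLike.ofReal ∘ b) := by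
      have h := hB.conjStarAlgAut_star_eigenvectorUnitary
      rw [Unitary.conjStarAlgAut_star_apply] at h
      rw [← h, ← Matrix.mul_assoc, ← Matrix.mul_assoc, ← Unitary.coe_star,
        Unitary.coe_mul_star_self, one_mul]
    have h3 : ((star U : Matrix.unitaryGroup I ℂ) : Matrix I I ℂ) * (A - B) * (V : Matrix I I ℂ)
        = Matrix.diagonal (RCLike.ofReal ∘ a) * (Q : Matrix I I ℂ)
          - (Q : Matrix I I ℂ) * Matrix.diagonal (RCLike.ofReal ∘ b) := by
      rw [mul_sub, sub_mul, h1, Matrix.mul_assoc _ B, h2, hQ]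
      simp only [Submonoid.coe_mul, Matrix.mul_assoc]
    rw [h3]
    simp only [Matrix.sub_apply, Matrix.diagonal_mul, Matrix.mul_diagonal, Function.comp_apply,
      Complex.ofReal_sub]
    change (a i : ℂ) * _ - _ * (b j : ℂ) = _
    ring
  have hfro : ∑ i, ∑ j, p i j * (a i - b j) ^ 2 = frobSq (A - B) := by
    rw [← frobSq_unitary_mul_mul (star U) V (A - B)]
    unfold frobSq
    refine Finset.sum_congr rfl fun i _ => Finset.sum_congr rfl fun j _ => ?_
    rw [hent, norm_mul, mul_pow, Complex.norm_real, Real.norm_eq_abs, sq_abs, mul_comm]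
  have hdiff : ∑ i, φ (a i) - ∑ i, φ (b i) = ∑ i, ∑ j, p i j * (φ (a i) - φ (b j)) := by
    simp only [mul_sub, Finset.sum_sub_distrib]
    rw [Finset.sum_comm (f := fun i j => p i j * φ (b j))]
    simp only [← Finset.sum_mul, hrow, hcol, one_mul]
  have hp0 : ∀ i j, 0 ≤ p i j := fun i j => sq_nonneg _
  have hCS : ∑ i, ∑ j, p i j * |a i - b j| ≤ √(Fintype.card I) * √(frobSq (A - B)) := by
    have h := Finset.sum_mul_sq_le_sq_mul_sq (Finset.univ : Finset (I × I))
      (fun q => √(p q.1 q.2)) (fun q => √(p q.1 q.2) * |a q.1 - b q.2|)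
    simp only [mul_pow, sq_abs, ← mul_assoc, Real.sq_sqrt (hp0 _ _),
      Real.mul_self_sqrt (hp0 _ _)] at h
    rw [Fintype.sum_prod_type, Fintype.sum_prod_type, Fintype.sum_prod_type, hfro] at h
    simp only [hrow, Finset.sum_const, Finset.card_univ, nsmul_eq_mul, mul_one] at h
    rw [← Real.sqrt_mul (Nat.cast_nonneg _)]
    exact Real.le_sqrt_of_sq_le h
  rw [hdiff]
  calc |∑ i, ∑ j, p i j * (φ (a i) - φ (b j))|
      ≤ ∑ i, ∑ j, p i j * (C * |a i - b j|) := by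
        refine (Finset.abs_sum_le_sum_abs _ _).trans (Finset.sum_le_sum fun i _ => ?_)
        refine (Finset.abs_sum_le_sum_abs _ _).trans (Finset.sum_le_sum fun j _ => ?_)
        rw [abs_mul, abs_of_nonneg (hp0 i j)]
        exact mul_le_mul_of_nonneg_left (hφ _ (hAs i) _ (hBs j)) (hp0 i j)
    _ = C * ∑ i, ∑ j, p i j * |a i - b j| := by
        simp only [Finset.mul_sum]
        refine Finset.sum_congr rfl fun i _ => Finset.sum_congr rfl fun j _ => by ring
    _ ≤ _ := by
        rw [mul_assoc]; exact mul_le_mul_of_nonneg_left hCS hC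

theorem continuous_sum_eigenvalues_of_lipschitz [DecidableEq I] {φ : ℝ → ℝ} {C : ℝ} (hC : 0 ≤ C)
    (hφ : ∀ x y, |φ x - φ y| ≤ C * |x - y|) :
    Continuous fun B : {B : I → I → ℂ // (Matrix.of B).IsHermitian} =>
      ∑ i, φ (B.2.eigenvalues i) := by
  rw [continuous_iff_continuousAt]
  intro B
  rw [ContinuousAt, tendsto_iff_dist_tendsto_zero]
  have hb : ∀ B' : {B : I → I → ℂ // (Matrix.of B).IsHermitian},
      dist (∑ i, φ (B'.2.eigenvalues i)) (∑ i, φ (B.2.eigenvalues i))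
      ≤ C * √(Fintype.card I) * √(∑ i, ∑ j, ‖B'.1 i j - B.1 i j‖ ^ 2) := by
    intro B'
    exact abs_sum_eigenvalues_sub_le B'.2 B.2 (s := Set.univ) hC (fun x _ y _ => hφ x y)
      (fun _ => trivial) (fun _ => trivial)
  refine squeeze_zero (fun _ => dist_nonneg) hb ?_
  have hij : ∀ i j, Continuous fun B' : {B : I → I → ℂ // (Matrix.of B).IsHermitian} =>
      B'.1 i j := fun i j =>
    (continuous_apply j).comp ((continuous_apply i).comp continuous_subtype_val)
  have hcont : Continuous fun B' : {B : I → I → ℂ // (Matrix.of B).IsHermitian} =>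
      C * √(Fintype.card I) * √(∑ i, ∑ j, ‖B'.1 i j - B.1 i j‖ ^ 2) := by
    refine continuous_const.mul (Real.continuous_sqrt.comp ?_)
    refine continuous_finsetSum _ fun i _ => continuous_finsetSum _ fun j _ => ?_
    exact (((hij i j).sub continuous_const).norm).pow 2
  have := hcont.tendsto B
  simpa using this

theorem measurable_sum_eigenvalues_of_lipschitz [DecidableEq I] {Z : Type*} [MeasurableSpace Z]
    {A : Z → Matrix I I ℂ} (hA : ∀ z, (A z).IsHermitian) (hm : ∀ i j, Measurable fun z => A z i j)
    {φ : ℝ → ℝ} {C : ℝ} (hC : 0 ≤ C) (hφ : ∀ x y, |φ x - φ y| ≤ C * |x - y|) :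
    Measurable fun z => ∑ i, φ ((hA z).eigenvalues i) := by
  obtain ⟨T, hTdef, hT⟩ : ∃ T : {B : I → I → ℂ // (Matrix.of B).IsHermitian} → ℝ,
      (∀ B, T B = ∑ i, φ (B.2.eigenvalues i)) ∧ Measurable T :=
    ⟨_, fun _ => rfl, (continuous_sum_eigenvalues_of_lipschitz (I := I) hC hφ).measurable⟩
  have hAm : Measurable fun z => (⟨fun i j => A z i j, hA z⟩ :
      {B : I → I → ℂ // (Matrix.of B).IsHermitian}) :=
    Measurable.subtype_mk (measurable_pi_lambda _ fun i => measurable_pi_lambda _ fun j => hm i j)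
  have heq : (fun z => ∑ i, φ ((hA z).eigenvalues i)) = fun z => T ⟨fun i j => A z i j, hA z⟩ := by
    funext z
    rw [hTdef]
    rfl
  rw [heq]
  exact hT.comp hAm

/-- The ordered eigenvalues are measurable functions of a Hermitian matrix: the number of
eigenvalues below a level is a limit of Lipschitz linear statistics. -/
theorem measurable_eigenvalues [DecidableEq I] {Z : Type*} [MeasurableSpace Z]
    {A : Z → Matrix I I ℂ} (hA : ∀ z, (A z).IsHermitian) (hm : ∀ i j, Measurable fun z => A z i j)
    (k : I) : Measurable fun z => (hA z).eigenvalues k := by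
  have hcount : ∀ a : ℝ, Measurable fun z =>
      ∑ i, (if (hA z).eigenvalues i ≤ a then (1 : ℝ) else 0) := by
    intro a
    -- piecewise linear functions decreasing to the indicator of `(-∞, a]`
    let φ : ℕ → ℝ → ℝ := fun j x => max 0 (1 - j * max 0 (x - a))
    have hlim : ∀ x, Tendsto (fun j => φ j x) atTop (𝓝 (if x ≤ a then (1 : ℝ) else 0)) := by
      intro x
      split_ifs with h
      · have : ∀ j, φ j x = 1 := fun j => by
          simp [φ, max_eq_left (sub_nonpos.2 h)]
        simp [this]
      · push Not at h
        obtain ⟨j0, hj0⟩ := exists_nat_gt (1 / (x - a))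
        refine tendsto_const_nhds.congr' ?_
        filter_upwards [eventually_ge_atTop j0] with j hj
        have hx : 0 < x - a := sub_pos.2 h
        have h1 : 1 < (j : ℝ) * (x - a) := by
          have : (j0 : ℝ) ≤ j := by exact_mod_cast hj
          rw [div_lt_iff₀ hx] at hj0
          nlinarith
        simp only [φ, max_eq_right hx.le]
        rw [max_eq_left]; linarith
    refine measurable_of_tendsto_metrizable (f := fun (j : ℕ) z => ∑ i, φ j ((hA z).eigenvalues i))
      (fun j => ?_) ?_
    · refine measurable_sum_eigenvalues_of_lipschitz hA hm (C := j) (Nat.cast_nonneg _) fun x y => ?_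
      calc |φ j x - φ j y| ≤ |(1 - j * max 0 (x - a)) - (1 - j * max 0 (y - a))| := by
            have := abs_max_sub_max_le_max 0 (1 - j * max 0 (x - a)) 0 (1 - j * max 0 (y - a))
            simpa using this
        _ = j * |max 0 (x - a) - max 0 (y - a)| := by
            rw [sub_sub_sub_cancel_left, ← mul_sub, abs_mul, Nat.abs_cast, abs_sub_comm]
        _ ≤ j * |x - y| := by
            refine mul_le_mul_of_nonneg_left ?_ (Nat.cast_nonneg _)
            have := abs_max_sub_max_le_max 0 (x - a) 0 (y - a)
            simpa using this
    · rw [tendsto_pi_nhds]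
      intro z
      exact tendsto_finsetSum _ fun i _ => hlim _
  refine measurable_of_Iic fun a => ?_
  set e := (Fintype.equivOfCardEq (Fintype.card_fin (Fintype.card I)) :
    Fin (Fintype.card I) ≃ I) with he
  -- the eigenvalues are in decreasing order, so that the one of rank `i` among `n` is at most `a`
  -- exactly when at least `n - i` of them are
  have hset : (fun z => (hA z).eigenvalues k) ⁻¹' Set.Iic a =
      {z | ((Fintype.card I - (e.symm k : ℕ) : ℕ) : ℝ)
        ≤ ∑ i, (if (hA z).eigenvalues i ≤ a then (1 : ℝ) else 0)} := by
    ext z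
    simp only [Set.mem_preimage, Set.mem_Iic, Set.mem_ofPred_eq]
    have hs : ∑ i, (if (hA z).eigenvalues i ≤ a then (1 : ℝ) else 0)
        = ((Finset.univ.filter fun i => (hA z).eigenvalues₀ i ≤ a).card : ℝ) := by
      rw [← e.sum_comp, Finset.sum_boole]
      simp only [Matrix.IsHermitian.eigenvalues, he, Equiv.symm_apply_apply]
    rw [hs, Nat.cast_le]
    have hk : (hA z).eigenvalues k = (hA z).eigenvalues₀ (e.symm k) := rfl
    rw [hk]
    constructor
    · intro h
      have : Finset.Ici (e.symm k) ⊆ Finset.univ.filter fun i => (hA z).eigenvalues₀ i ≤ a := by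
        intro i hi
        simp only [Finset.mem_filter, Finset.mem_univ, true_and]
        exact ((hA z).eigenvalues₀_antitone (Finset.mem_Ici.1 hi)).trans h
      simpa using Finset.card_le_card this
    · intro h
      by_contra hc
      push Not at hc
      have : Finset.univ.filter (fun i => (hA z).eigenvalues₀ i ≤ a) ⊆ Finset.Ioi (e.symm k) := by
        intro i hi
        simp only [Finset.mem_filter, Finset.mem_univ, true_and] at hi
        rw [Finset.mem_Ioi]
        by_contra hik
        exact absurd ((hA z).eigenvalues₀_antitone (not_lt.1 hik)) (by linarith)
      have hc2 := (h.trans (Finset.card_le_card this))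
      rw [Fin.card_Ioi] at hc2
      have := (e.symm k).2
      omega
  rw [hset]
  exact measurableSet_le measurable_const (hcount a)

/-- The eigenvalues, with multiplicity, can be read off any unitary diagonalization, since they are
the roots of the characteristic polynomial. -/
theorem sum_eigenvalues_eq_of_unitary_diagonal [DecidableEq I] {A : Matrix I I ℂ}
    (hA : A.IsHermitian) (U : Matrix.unitaryGroup I ℂ) (d : I → ℝ)
    (hd : A = U * Matrix.diagonal (fun i => (d i : ℂ)) * (star U : Matrix.unitaryGroup I ℂ))
    {R : Type*} [AddCommMonoid R] (h : ℝ → R) :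
    ∑ i, h (hA.eigenvalues i) = ∑ i, h (d i) := by
  have h1 := hA.roots_charpoly_eq_eigenvalues
  have h2 : A.charpoly.roots = Multiset.map (fun i => (d i : ℂ)) Finset.univ.val := by
    rw [hd, Matrix.charpoly_mul_comm, ← Matrix.mul_assoc]
    rw [Unitary.coe_star, Unitary.coe_star_mul_self, one_mul, Matrix.charpoly_diagonal,
      Polynomial.roots_prod]
    · simp
    · simp [Finset.prod_ne_zero_iff, Polynomial.X_sub_C_ne_zero]
  rw [h1] at h2
  have h3 := congrArg (fun m => (Multiset.map (fun z : ℂ => h z.re) m).sum) h2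
  simpa [Multiset.map_map] using h3

theorem sum_eigenvalues_smul [DecidableEq I] {A B : Matrix I I ℂ} (hA : A.IsHermitian)
    (hB : B.IsHermitian) {c : ℝ} (hBA : B = (c : ℂ) • A) {R : Type*} [AddCommMonoid R]
    (h : ℝ → R) : ∑ i, h (hB.eigenvalues i) = ∑ i, h (c * hA.eigenvalues i) := by
  refine sum_eigenvalues_eq_of_unitary_diagonal hB hA.eigenvectorUnitary _ ?_ h
  conv_lhs => rw [hBA, hA.spectral_theorem, Unitary.conjStarAlgAut_apply]
  rw [← Matrix.smul_mul, ← Matrix.mul_smul, ← Matrix.diagonal_smul]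
  congr 3
  ext i
  simp

theorem abs_eigenvalues_le_norm [DecidableEq I] {A : Matrix I I ℂ} (hA : A.IsHermitian) (i : I) :
    |hA.eigenvalues i| ≤ ‖A‖ := by
  have h := Matrix.l2_opNorm_mulVec A (hA.eigenvectorBasis i)
  rw [hA.mulVec_eigenvectorBasis i, hA.eigenvectorBasis.orthonormal.1 i, mul_one] at h
  refine le_trans (le_of_eq ?_) h
  have h2 : (EuclideanSpace.equiv I ℂ).symm (hA.eigenvalues i • ⇑(hA.eigenvectorBasis i))
      = hA.eigenvalues i • hA.eigenvectorBasis i := rfl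
  rw [h2, norm_smul, hA.eigenvectorBasis.orthonormal.1 i, mul_one, Real.norm_eq_abs]

theorem eigenvalues_mul_conjTranspose_nonneg [DecidableEq I] {W : Matrix I J ℂ}
    (h : (W * Wᴴ).IsHermitian) (i : I) : 0 ≤ h.eigenvalues i :=
  (Matrix.posSemidef_self_mul_conjTranspose W).eigenvalues_nonneg i

end Eigenvalues

end BlockCorr

/-! ### Dilations of the standard Gaussian measure -/

namespace BlockCorr

section Dilation

open scoped ENNReal RealInnerProductSpace

variable {V : Type*} [NormedAddCommGroup V] [InnerProductSpace ℝ V] [FiniteDimensional ℝ V]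
  [MeasurableSpace V] [BorelSpace V]

theorem stdGaussian_eq_withDensity : stdGaussian V = (volume : Measure V).withDensity
    (fun x => ENNReal.ofReal (((2 * Real.pi) ^ (Module.finrank ℝ V / 2 : ℝ))⁻¹
      * Real.exp (-(1 / 2) * ‖x‖ ^ 2))) := by
  set Z : ℝ := (2 * Real.pi) ^ (Module.finrank ℝ V / 2 : ℝ) with hZ
  have hZ0 : 0 < Z := by positivity
  have hpos : ∀ x : V, 0 ≤ Z⁻¹ * Real.exp (-(1 / 2) * ‖x‖ ^ 2) := fun x => by positivity
  have hint : Integrable (fun x : V => Z⁻¹ * Real.exp (-(1 / 2) * ‖x‖ ^ 2)) := by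
    have h := GaussianFourier.integrable_cexp_neg_mul_sq_norm_add (V := V) (b := (1 / 2 : ℂ))
      (by norm_num) 0 0
    have h2 := h.re.const_mul Z⁻¹
    refine h2.congr (ae_of_all _ fun x => ?_)
    simp only [zero_mul, add_zero]
    congr 1
    rw [show (-(1 / 2 : ℂ) * (‖x‖ : ℂ) ^ 2) = ((-(1 / 2) * ‖x‖ ^ 2 : ℝ) : ℂ) by push_cast; ring,
      ← Complex.ofReal_exp]
    exact Complex.ofReal_re _
  have : IsFiniteMeasure ((volume : Measure V).withDensity
      (fun x => ENNReal.ofReal (Z⁻¹ * Real.exp (-(1 / 2) * ‖x‖ ^ 2)))) :=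
    isFiniteMeasure_withDensity_ofReal hint.2
  refine Measure.ext_of_charFun ?_
  ext t
  rw [charFun_stdGaussian, charFun_apply, integral_withDensity_eq_integral_toReal_smul
    (by fun_prop) (ae_of_all _ fun x => ENNReal.ofReal_lt_top)]
  have h := GaussianFourier.integral_cexp_neg_mul_sq_norm_add (V := V) (b := (1 / 2 : ℂ))
      (by norm_num) Complex.I t
  have hZc : ((Real.pi : ℂ) / (1 / 2)) ^ (Module.finrank ℝ V / 2 : ℂ) = (Z : ℂ) := by
    rw [hZ, Complex.ofReal_cpow (by positivity)]
    push_cast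
    congr 1
    ring
  rw [hZc] at h
  have hcongr : ∀ x : V, (ENNReal.ofReal (Z⁻¹ * Real.exp (-(1 / 2) * ‖x‖ ^ 2))).toReal •
      Complex.exp (⟪x, t⟫ * Complex.I)
      = (Z : ℂ)⁻¹ * Complex.exp (-(1 / 2) * ‖x‖ ^ 2 + Complex.I * ⟪t, x⟫) := by
    intro x
    rw [ENNReal.toReal_ofReal (hpos x), Complex.real_smul, Complex.exp_add, real_inner_comm]
    push_cast
    rw [mul_comm Complex.I, mul_assoc]
  simp only [hcongr]
  rw [integral_const_mul, h, ← mul_assoc,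
    inv_mul_cancel₀ (by exact_mod_cast hZ0.ne'), one_mul]
  congr 1
  rw [Complex.I_sq]
  ring

/-- Change of variables `x ↦ t x` in a Gaussian integral. The weight is bounded by
`exp (‖x‖² / n)` uniformly over `t ∈ [1 - 1/n, 1]`, in dimension `n`. -/
theorem lintegral_stdGaussian_eq_lintegral_smul {H : V → ℝ≥0∞} (hH : Measurable H) {t : ℝ}
    (ht : 0 < t) :
    ∫⁻ x, H x ∂(stdGaussian V) = ∫⁻ x, H (t • x) *
      ENNReal.ofReal (t ^ (Module.finrank ℝ V) * Real.exp (-((t ^ 2 - 1) * ‖x‖ ^ 2 / 2)))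
      ∂(stdGaussian V) := by
  set n := Module.finrank ℝ V
  set Z : ℝ := (2 * Real.pi) ^ (n / 2 : ℝ) with hZ
  set ρ : V → ℝ≥0∞ := fun x => ENNReal.ofReal (Z⁻¹ * Real.exp (-(1 / 2) * ‖x‖ ^ 2)) with hρ
  have hρm : Measurable ρ := by fun_prop
  have hd : stdGaussian V = (volume : Measure V).withDensity ρ := stdGaussian_eq_withDensity
  have hmap := Measure.map_addHaar_smul (volume : Measure V) ht.ne'
  have hvol : ∀ f : V → ℝ≥0∞, Measurable f →
      ∫⁻ x, f x = ENNReal.ofReal (t ^ n) * ∫⁻ x, f (t • x) := by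
    intro f hf
    have h1 : ∫⁻ x, f (t • x) = ∫⁻ x, f x ∂(Measure.map (t • ·) (volume : Measure V)) :=
      (lintegral_map hf (by fun_prop)).symm
    rw [h1, hmap, lintegral_smul_measure, smul_eq_mul, ← mul_assoc,
      ← ENNReal.ofReal_mul (by positivity), abs_of_pos (by positivity),
      mul_inv_cancel₀ (by positivity)]
    simp
  rw [hd, lintegral_withDensity_eq_lintegral_mul _ hρm hH,
    lintegral_withDensity_eq_lintegral_mul _ hρm (by fun_prop)]
  rw [hvol _ (by fun_prop), ← lintegral_const_mul' _ _ ENNReal.ofReal_ne_top]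
  refine lintegral_congr fun x => ?_
  simp only [Pi.mul_apply]
  have hρt : ENNReal.ofReal (t ^ n) * ρ (t • x) = ρ x *
      ENNReal.ofReal (t ^ n * Real.exp (-((t ^ 2 - 1) * ‖x‖ ^ 2 / 2))) := by
    simp only [hρ]
    rw [← ENNReal.ofReal_mul (by positivity), ← ENNReal.ofReal_mul (by positivity)]
    congr 1
    have he : Real.exp (-(1 / 2) * ‖t • x‖ ^ 2)
        = Real.exp (-(1 / 2) * ‖x‖ ^ 2) * Real.exp (-((t ^ 2 - 1) * ‖x‖ ^ 2 / 2)) := by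
      rw [← Real.exp_add, norm_smul, mul_pow, Real.norm_eq_abs, sq_abs]
      congr 1
      ring
    rw [he]
    ring
  calc ENNReal.ofReal (t ^ n) * (ρ (t • x) * H (t • x))
      = (ENNReal.ofReal (t ^ n) * ρ (t • x)) * H (t • x) := by ring
    _ = _ := by rw [hρt]; ring

/-- The exponential moment comes from the dilation formula for the constant function `1`, with
`1 - t² = 8 / n`: the weight there is at least `exp (-8) * exp (4 ‖x‖² / n)`. -/
theorem lintegral_exp_norm_sq_stdGaussian_le (hn : 16 ≤ Module.finrank ℝ V) :
    ∫⁻ x, ENNReal.ofReal (Real.exp (4 * (‖x‖ ^ 2 / Module.finrank ℝ V))) ∂(stdGaussian V)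
      ≤ ENNReal.ofReal (Real.exp 8) := by
  set n := Module.finrank ℝ V
  have hn' : (16 : ℝ) ≤ n := by exact_mod_cast hn
  have hn0 : (0 : ℝ) < n := by linarith
  set u : ℝ := 8 / n with hu
  have hu0 : 0 < u := by positivity
  have hu1 : u ≤ 1 / 2 := by rw [hu, div_le_iff₀ hn0]; linarith
  set t : ℝ := √(1 - u) with ht
  have ht0 : 0 < t := Real.sqrt_pos.2 (by linarith)
  have htsq : t ^ 2 = 1 - u := Real.sq_sqrt (by linarith)
  have h := lintegral_stdGaussian_eq_lintegral_smul (V := V) (H := fun _ => 1) measurable_const ht0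
  simp only [lintegral_const, measure_univ, mul_one, one_mul] at h
  have hexp : Real.exp (-u) ≤ t := by
    refine (pow_le_pow_iff_left₀ (Real.exp_pos _).le ht0.le two_ne_zero).1 ?_
    rw [htsq, ← Real.exp_nat_mul]
    have h1 : (1 + 2 * u) ≤ Real.exp (2 * u) := by
      have := Real.add_one_le_exp (2 * u); linarith
    have h2 : Real.exp (((2 : ℕ) : ℝ) * -u) = (Real.exp (2 * u))⁻¹ := by
      rw [← Real.exp_neg]; congr 1; push_cast; ring
    rw [h2]
    refine (inv_anti₀ (by linarith) h1).trans ?_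
    rw [inv_le_iff_one_le_mul₀ (by linarith)]
    nlinarith
  have htn : Real.exp (-8) ≤ t ^ n := by
    calc Real.exp (-8) = Real.exp (-u) ^ n := by
          rw [← Real.exp_nat_mul]; congr 1; rw [hu]; field_simp
      _ ≤ t ^ n := pow_le_pow_left₀ (Real.exp_pos _).le hexp n
  calc ∫⁻ x, ENNReal.ofReal (Real.exp (4 * (‖x‖ ^ 2 / n))) ∂(stdGaussian V)
      ≤ ∫⁻ x, ENNReal.ofReal (Real.exp 8) * ENNReal.ofReal
          (t ^ n * Real.exp (-((t ^ 2 - 1) * ‖x‖ ^ 2 / 2))) ∂(stdGaussian V) := by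
        refine lintegral_mono fun x => ?_
        rw [← ENNReal.ofReal_mul (Real.exp_pos _).le]
        apply ENNReal.ofReal_le_ofReal
        have he : -((t ^ 2 - 1) * ‖x‖ ^ 2 / 2) = 4 * (‖x‖ ^ 2 / n) := by
          rw [htsq, hu]; field_simp; ring
        rw [he, ← mul_assoc]
        have h1 : 1 ≤ Real.exp 8 * t ^ n := by
          calc (1 : ℝ) = Real.exp 8 * Real.exp (-8) := by rw [← Real.exp_add]; simp
            _ ≤ _ := mul_le_mul_of_nonneg_left htn (Real.exp_pos _).le
        exact le_mul_of_one_le_left (Real.exp_pos _).le h1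
    _ = ENNReal.ofReal (Real.exp 8) := by
        rw [lintegral_const_mul' _ _ ENNReal.ofReal_ne_top, ← h, mul_one]

theorem lintegral_comp_mul_left_real {f : ℝ → ℝ≥0∞} (hf : Measurable f) {r : ℝ} (hr : 0 < r) :
    ∫⁻ t, f (r * t) = ENNReal.ofReal r⁻¹ * ∫⁻ s, f s := by
  have h := lintegral_map (μ := (volume : Measure ℝ)) hf (measurable_const_mul r)
  rw [← h, Real.map_volume_mul_left hr.ne', lintegral_smul_measure, abs_of_pos (inv_pos.2 hr),
    smul_eq_mul]

variable {I : Type*} [Fintype I] {lam : V → I → ℝ}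

/-- If the statistic `∑ h(λ_i)` of a family that is homogeneous of degree two has a finite Gaussian
mean, then `s ↦ h(s²)` is integrable away from zero against some Gaussian weight. Averaging the
dilation formula over `t` shows that `t ↦ h(t² λ_i(x))` is integrable against such a weight for
almost every `x`, and one `x` with some `λ_i(x) > 0` is enough. -/
theorem exists_lintegral_weight_ne_top {h : ℝ → ℝ≥0∞} (hh : Measurable h)
    (hlam : ∀ i, Measurable fun x => lam x i)
    (hhom : ∀ (t : ℝ), 0 < t → ∀ (x : V) (f : ℝ → ℝ≥0∞),
      ∑ i, f (lam (t • x) i) = ∑ i, f (t ^ 2 * lam x i))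
    (hfin : ∫⁻ x, ∑ i, h (lam x i) ∂(stdGaussian V) ≠ ∞)
    (hpos : stdGaussian V {x | ∃ i, 0 < lam x i} ≠ 0) :
    ∃ C : ℝ, 0 ≤ C ∧ ∀ a : ℝ, 0 < a →
      ∫⁻ s in Set.Ioi a, h (s ^ 2) * ENNReal.ofReal (Real.exp (-(C * s ^ 2))) ≠ ∞ := by
  set γ := stdGaussian V
  set n := Module.finrank ℝ V
  set w : V → ℝ → ℝ≥0∞ := fun x t => ENNReal.ofReal (Real.exp (-t)) *
    ENNReal.ofReal (t ^ n * Real.exp (-((t ^ 2 - 1) * ‖x‖ ^ 2 / 2))) with hw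
  have hwm : Measurable (Function.uncurry w) := by
    simp only [hw, Function.uncurry_def]; fun_prop
  set G : V → ℝ → ℝ≥0∞ := fun x t => (∑ i, h (t ^ 2 * lam x i)) * w x t with hG
  have hGm : Measurable (Function.uncurry G) := by
    refine Measurable.mul (Finset.measurable_fun_sum _ fun i _ => hh.comp ?_) hwm
    exact (measurable_snd.pow_const 2).mul ((hlam i).comp measurable_fst)
  have hslice : ∀ t ∈ Set.Ioi (0 : ℝ), ∫⁻ x, G x t ∂γ
      = ENNReal.ofReal (Real.exp (-t)) * ∫⁻ x, ∑ i, h (lam x i) ∂γ := by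
    intro t ht
    rw [lintegral_stdGaussian_eq_lintegral_smul (H := fun x => ∑ i, h (lam x i))
      (Finset.measurable_fun_sum _ fun i _ => hh.comp (hlam i)) ht, ← lintegral_const_mul' _ _ ENNReal.ofReal_ne_top]
    refine lintegral_congr fun x => ?_
    simp only [hG, hw]
    rw [hhom t ht x h]
    ring
  have htot : ∫⁻ x, (∫⁻ t in Set.Ioi (0 : ℝ), G x t) ∂γ ≠ ∞ := by
    rw [lintegral_lintegral_swap hGm.aemeasurable]
    rw [setLIntegral_congr_fun measurableSet_Ioi hslice,
      lintegral_mul_const _ (by fun_prop)]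
    refine ENNReal.mul_ne_top ?_ hfin
    rw [← ofReal_integral_eq_lintegral_ofReal (integrableOn_exp_neg_Ioi 0)
      (ae_of_all _ fun _ => (Real.exp_pos _).le)]
    exact ENNReal.ofReal_ne_top
  have hae : ∀ᵐ x ∂γ, ∫⁻ t in Set.Ioi (0 : ℝ), G x t < ∞ :=
    ae_lt_top (hGm.lintegral_prod_right') htot
  obtain ⟨x, ⟨i, hi⟩, hx⟩ : ∃ x, (∃ i, 0 < lam x i) ∧ ∫⁻ t in Set.Ioi (0 : ℝ), G x t < ∞ := by
    by_contra hcon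
    push Not at hcon
    apply hpos
    refine measure_mono_null (fun x hx => ?_) (ae_iff.1 hae)
    simpa using not_lt.2 (hcon x hx)
  set r := √(lam x i) with hr
  have hr0 : 0 < r := Real.sqrt_pos.2 hi
  have hrsq : r ^ 2 = lam x i := Real.sq_sqrt hi.le
  -- after the substitution `s = r t`, the weight `exp (-t - t² ‖x‖² / 2)` dominates `exp (-C s²)`
  refine ⟨(1 + ‖x‖ ^ 2 / 2) / r ^ 2, by positivity, fun a ha => ?_⟩
  set C := (1 + ‖x‖ ^ 2 / 2) / r ^ 2 with hC
  set κ : ℝ := Real.exp (-1) * (a / r) ^ n with hκ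
  have hκ0 : 0 < κ := by positivity
  set f : ℝ → ℝ≥0∞ := (Set.Ioi a).indicator
    (fun s => h (s ^ 2) * ENNReal.ofReal (Real.exp (-(C * s ^ 2)))) with hf
  have hfm : Measurable f := by
    refine Measurable.indicator ?_ measurableSet_Ioi
    exact (hh.comp (by fun_prop)).mul (by fun_prop)
  rw [← lintegral_indicator measurableSet_Ioi]
  have hle : ∫⁻ t, ENNReal.ofReal κ * f (r * t) ≤ ∫⁻ t in Set.Ioi (0 : ℝ), G x t := by
    rw [← lintegral_indicator measurableSet_Ioi]
    refine lintegral_mono fun t => ?_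
    simp only [hf]
    by_cases hat : a < r * t
    · have ht : 0 < t := by
        by_contra hneg
        have := mul_nonpos_of_nonneg_of_nonpos hr0.le (not_lt.1 hneg)
        linarith
      rw [Set.indicator_of_mem (by exact hat), Set.indicator_of_mem (by exact ht)]
      have hterm : h (t ^ 2 * lam x i) ≤ ∑ i, h (t ^ 2 * lam x i) :=
        Finset.single_le_sum (f := fun i => h (t ^ 2 * lam x i)) (fun _ _ => zero_le)
          (Finset.mem_univ i)
      rw [show (r * t) ^ 2 = t ^ 2 * lam x i by rw [mul_pow, hrsq, mul_comm]]
      rw [mul_left_comm]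
      refine mul_le_mul' hterm ?_
      simp only [hw]
      rw [← ENNReal.ofReal_mul hκ0.le, ← ENNReal.ofReal_mul (Real.exp_pos _).le]
      apply ENNReal.ofReal_le_ofReal
      have hat' : a / r ≤ t := by rw [div_le_iff₀ hr0]; linarith
      have hpow : (a / r) ^ n ≤ t ^ n := pow_le_pow_left₀ (by positivity) hat' n
      have hCt : C * (t ^ 2 * lam x i) = (1 + ‖x‖ ^ 2 / 2) * t ^ 2 := by
        rw [hC, ← hrsq]; field_simp
      rw [hκ, hCt, mul_comm (Real.exp (-1)), mul_assoc, ← Real.exp_add, mul_left_comm,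
        ← Real.exp_add]
      refine mul_le_mul hpow (Real.exp_le_exp.2 ?_) (Real.exp_pos _).le (by positivity)
      nlinarith [sq_nonneg (t - 1), sq_nonneg ‖x‖, sq_nonneg t]
    · rw [Set.indicator_of_notMem (by exact hat)]; simp
  rw [lintegral_const_mul' _ _ ENNReal.ofReal_ne_top, lintegral_comp_mul_left_real hfm hr0,
    ← mul_assoc, ← ENNReal.ofReal_mul hκ0.le] at hle
  have hlt := hle.trans_lt hx
  intro htop
  rw [htop, ENNReal.mul_top (by simpa using (by positivity : 0 < κ * r⁻¹))] at hlt
  exact absurd hlt (by simp)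

/-- Substitution `s = t √l`: the range of `s` is at most `√l`, so that the weight `exp (-C s²)` may be
inserted at the price of `exp (C l)`. -/
theorem lintegral_Ioc_comp_sq_mul_le {h : ℝ → ℝ≥0∞} (hh : Measurable h) {a C l : ℝ}
    (ha : 0 < a) (hC : 0 ≤ C) :
    ∫⁻ t in Set.Ioc (0 : ℝ) 1, (Set.Ioi (a ^ 2)).indicator h (t ^ 2 * l)
      ≤ ENNReal.ofReal a⁻¹ *
        (∫⁻ s in Set.Ioi a, h (s ^ 2) * ENNReal.ofReal (Real.exp (-(C * s ^ 2)))) *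
        (Set.Ioi (a ^ 2)).indicator (fun l => ENNReal.ofReal (Real.exp (C * l))) l := by
  by_cases hl : a ^ 2 < l
  swap
  · rw [setLIntegral_congr_fun (g := fun _ => 0) measurableSet_Ioc]
    · simp
    · intro t ht
      refine Set.indicator_of_notMem ?_ _
      simp only [Set.mem_Ioi, not_lt]
      push Not at hl
      have h1 : t ^ 2 ≤ 1 := pow_le_one₀ ht.1.le ht.2
      nlinarith [sq_nonneg t, sq_nonneg a]
  have hl0 : 0 < l := lt_trans (by positivity) hl
  rw [Set.indicator_of_mem (by exact hl)]
  set r := √l with hr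
  have hrsq : r ^ 2 = l := Real.sq_sqrt hl0.le
  have hr0 : 0 < r := Real.sqrt_pos.2 hl0
  have har : a < r := Real.lt_sqrt_of_sq_lt hl
  set f : ℝ → ℝ≥0∞ := (Set.Ioi a).indicator
    (fun s => h (s ^ 2) * ENNReal.ofReal (Real.exp (-(C * s ^ 2)))) with hf
  have hfm : Measurable f := by
    refine Measurable.indicator ?_ measurableSet_Ioi
    exact (hh.comp (by fun_prop)).mul (by fun_prop)
  rw [← lintegral_indicator measurableSet_Ioc, ← lintegral_indicator measurableSet_Ioi]
  calc _ ≤ ∫⁻ t, ENNReal.ofReal (Real.exp (C * l)) * f (r * t) := by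
        refine lintegral_mono fun t => ?_
        by_cases ht : t ∈ Set.Ioc (0 : ℝ) 1
        swap
        · rw [Set.indicator_of_notMem ht]; exact zero_le
        rw [Set.indicator_of_mem ht]
        have htl : t ^ 2 * l = (r * t) ^ 2 := by rw [mul_pow, hrsq, mul_comm]
        by_cases hat : a < r * t
        · have hm : a ^ 2 < t ^ 2 * l := by rw [htl]; exact pow_lt_pow_left₀ hat ha.le two_ne_zero
          rw [Set.indicator_of_mem (by exact hm)]
          simp only [hf]
          rw [Set.indicator_of_mem (by exact hat), ← htl, mul_left_comm,
            ← ENNReal.ofReal_mul (Real.exp_pos _).le, ← Real.exp_add]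
          refine le_mul_of_one_le_right zero_le ?_
          rw [← ENNReal.ofReal_one]
          apply ENNReal.ofReal_le_ofReal
          rw [Real.one_le_exp_iff]
          have h1 : t ^ 2 ≤ 1 := pow_le_one₀ ht.1.le ht.2
          nlinarith [mul_nonneg hC hl0.le]
        · have hm : ¬ a ^ 2 < t ^ 2 * l := by
            rw [htl, not_lt]
            exact pow_le_pow_left₀ (mul_nonneg hr0.le ht.1.le) (not_lt.1 hat) 2
          rw [Set.indicator_of_notMem (by exact hm)]; exact zero_le
    _ = ENNReal.ofReal (Real.exp (C * l)) * (ENNReal.ofReal r⁻¹ * ∫⁻ s, f s) := by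
        rw [lintegral_const_mul' _ _ ENNReal.ofReal_ne_top, lintegral_comp_mul_left_real hfm hr0]
    _ ≤ _ := by
        rw [mul_comm]
        gcongr

/-- Mean of a linear statistic supported away from `[0, a²]`. The dilation formula, averaged over
`t ∈ [1 - 1/n, 1]`, replaces the possibly irregular function `h` by its weighted integral; what
remains is small when the event `{a² < X}` is, by `u ≤ s⁻¹ + s u²`. -/
theorem lintegral_sum_indicator_le {h : ℝ → ℝ≥0∞} (hh : Measurable h)
    (hlam : ∀ i, Measurable fun x => lam x i)
    (hhom : ∀ (t : ℝ), 0 < t → ∀ (x : V) (f : ℝ → ℝ≥0∞),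
      ∑ i, f (lam (t • x) i) = ∑ i, f (t ^ 2 * lam x i))
    {X : V → ℝ} (hX : Measurable X) (hlamX : ∀ x i, lam x i ≤ X x)
    {a C s : ℝ} (ha : 0 < a) (hC : 0 ≤ C) (hs : 0 < s) (hn : 0 < Module.finrank ℝ V) :
    ∫⁻ x, ∑ i, (Set.Ioi (a ^ 2)).indicator h (lam x i) ∂(stdGaussian V)
      ≤ ENNReal.ofReal (Module.finrank ℝ V * Fintype.card I * a⁻¹) *
        (∫⁻ s in Set.Ioi a, h (s ^ 2) * ENNReal.ofReal (Real.exp (-(C * s ^ 2)))) *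
        (ENNReal.ofReal s⁻¹ * stdGaussian V {x | a ^ 2 < X x} + ENNReal.ofReal s *
          (∫⁻ x, ENNReal.ofReal (Real.exp (4 * (‖x‖ ^ 2 / Module.finrank ℝ V))) ∂(stdGaussian V)
            + ∫⁻ x, ENNReal.ofReal (Real.exp (4 * (C * X x))) ∂(stdGaussian V))) := by
  set γ := stdGaussian V
  set n := Module.finrank ℝ V
  have hn' : (0 : ℝ) < n := by exact_mod_cast hn
  set Φ := (Set.Ioi (a ^ 2)).indicator h with hΦ
  have hΦm : Measurable Φ := hh.indicator measurableSet_Ioi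
  set J := ∫⁻ s in Set.Ioi a, h (s ^ 2) * ENNReal.ofReal (Real.exp (-(C * s ^ 2)))
  set A := {x | a ^ 2 < X x} with hA
  have hAm : MeasurableSet A := measurableSet_lt measurable_const hX
  set G : V → ℝ → ℝ≥0∞ := fun x t => ENNReal.ofReal (Real.exp (‖x‖ ^ 2 / n)) *
    ∑ i, Φ (t ^ 2 * lam x i) with hG
  have hGm : Measurable (Function.uncurry G) := by
    refine Measurable.mul (by fun_prop) (Finset.measurable_fun_sum _ fun i _ => hΦm.comp ?_)
    exact (measurable_snd.pow_const 2).mul ((hlam i).comp measurable_fst)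
  set T := Set.Ioc (1 - 1 / (n : ℝ)) 1 with hT
  have h1n : 0 ≤ 1 - 1 / (n : ℝ) := by
    have : (1 : ℝ) ≤ n := by exact_mod_cast hn
    rw [sub_nonneg, div_le_one hn']; exact this
  have hslice : ∀ t ∈ T, ∫⁻ x, ∑ i, Φ (lam x i) ∂γ ≤ ∫⁻ x, G x t ∂γ := by
    intro t ht
    have ht0 : 0 < t := h1n.trans_lt ht.1
    rw [lintegral_stdGaussian_eq_lintegral_smul (H := fun x => ∑ i, Φ (lam x i))
      (Finset.measurable_fun_sum _ fun i _ => hΦm.comp (hlam i)) ht0]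
    refine lintegral_mono fun x => ?_
    simp only [hG]
    rw [hhom t ht0 x Φ, mul_comm]
    refine mul_le_mul' (ENNReal.ofReal_le_ofReal ?_) le_rfl
    have h1 : t ^ n ≤ 1 := pow_le_one₀ ht0.le ht.2
    have h2 : Real.exp (-((t ^ 2 - 1) * ‖x‖ ^ 2 / 2)) ≤ Real.exp (‖x‖ ^ 2 / n) := by
      apply Real.exp_le_exp.2
      have h3 : 1 - t ^ 2 ≤ 2 * (1 / (n : ℝ)) := by nlinarith [ht.1, ht.2]
      have := mul_le_mul_of_nonneg_right h3 (sq_nonneg ‖x‖)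
      have h4 : 2 * (1 / (n : ℝ)) * ‖x‖ ^ 2 = 2 * (‖x‖ ^ 2 / n) := by ring
      linarith
    calc t ^ n * Real.exp (-((t ^ 2 - 1) * ‖x‖ ^ 2 / 2)) ≤ 1 * Real.exp (‖x‖ ^ 2 / n) :=
          mul_le_mul h1 h2 (Real.exp_pos _).le zero_le_one
      _ = _ := one_mul _
  have hinner : ∀ x, ∫⁻ t in T, G x t ≤ ENNReal.ofReal (Fintype.card I * a⁻¹) * J *
      (A.indicator (fun x => ENNReal.ofReal (Real.exp (‖x‖ ^ 2 / n) * Real.exp (C * X x))) x) := by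
    intro x
    calc ∫⁻ t in T, G x t ≤ ∫⁻ t in Set.Ioc (0 : ℝ) 1, G x t :=
          lintegral_mono_set (Set.Ioc_subset_Ioc_left h1n)
      _ = ENNReal.ofReal (Real.exp (‖x‖ ^ 2 / n)) *
          ∑ i, ∫⁻ t in Set.Ioc (0 : ℝ) 1, Φ (t ^ 2 * lam x i) := by
          simp only [hG]
          rw [lintegral_const_mul' _ _ ENNReal.ofReal_ne_top, lintegral_finsetSum]
          intro i _
          exact hΦm.comp (by fun_prop)
      _ ≤ ENNReal.ofReal (Real.exp (‖x‖ ^ 2 / n)) *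
          ∑ _i : I, (ENNReal.ofReal a⁻¹ * J *
            A.indicator (fun x => ENNReal.ofReal (Real.exp (C * X x))) x) := by
          gcongr with i _
          refine (lintegral_Ioc_comp_sq_mul_le hh ha hC).trans ?_
          refine mul_le_mul' le_rfl ?_
          by_cases hi : a ^ 2 < lam x i
          · have hxA : x ∈ A := lt_of_lt_of_le hi (hlamX x i)
            rw [Set.indicator_of_mem (by exact hi), Set.indicator_of_mem hxA]
            apply ENNReal.ofReal_le_ofReal
            exact Real.exp_le_exp.2 (mul_le_mul_of_nonneg_left (hlamX x i) hC)
          · rw [Set.indicator_of_notMem (by exact hi)]; exact zero_le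
      _ = _ := by
          rw [Finset.sum_const, Finset.card_univ, nsmul_eq_mul,
            ENNReal.ofReal_mul (Nat.cast_nonneg _), ENNReal.ofReal_natCast]
          by_cases hx : x ∈ A
          · rw [Set.indicator_of_mem hx, Set.indicator_of_mem hx,
              ENNReal.ofReal_mul (Real.exp_pos _).le]
            ring
          · rw [Set.indicator_of_notMem hx, Set.indicator_of_notMem hx]; simp
  have hyoung : ∀ x, A.indicator
      (fun x => ENNReal.ofReal (Real.exp (‖x‖ ^ 2 / n) * Real.exp (C * X x))) x ≤
      ENNReal.ofReal s⁻¹ * A.indicator 1 x + ENNReal.ofReal s *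
        (ENNReal.ofReal (Real.exp (4 * (‖x‖ ^ 2 / n)))
          + ENNReal.ofReal (Real.exp (4 * (C * X x)))) := by
    intro x
    by_cases hx : x ∈ A
    swap
    · rw [Set.indicator_of_notMem hx]; exact zero_le
    rw [Set.indicator_of_mem hx, Set.indicator_of_mem hx, Pi.one_apply, mul_one,
      ← ENNReal.ofReal_add (Real.exp_pos _).le (Real.exp_pos _).le,
      ← ENNReal.ofReal_mul hs.le, ← ENNReal.ofReal_add (by positivity) (by positivity)]
    apply ENNReal.ofReal_le_ofReal
    have e1 : ∀ y : ℝ, Real.exp (4 * y) = (Real.exp y) ^ 4 := fun y => by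
      rw [← Real.exp_nat_mul]; norm_num
    rw [e1, e1]
    set p := Real.exp (‖x‖ ^ 2 / n)
    set q := Real.exp (C * X x)
    have h1 : p * q ≤ s⁻¹ + s * (p * q) ^ 2 := by
      have h2 : 0 ≤ s * (p * q - s⁻¹) ^ 2 := by positivity
      have h3 : s * (p * q - s⁻¹) ^ 2 = s * (p * q) ^ 2 - 2 * (p * q) + s⁻¹ := by
        field_simp
        ring
      have h4 : 0 ≤ p * q := by positivity
      linarith
    have h5 : (p * q) ^ 2 ≤ p ^ 4 + q ^ 4 := by nlinarith [sq_nonneg (p ^ 2 - q ^ 2)]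
    have := mul_le_mul_of_nonneg_left h5 hs.le
    linarith
  calc ∫⁻ x, ∑ i, Φ (lam x i) ∂γ
      = ENNReal.ofReal n * ∫⁻ _t in T, ∫⁻ x, ∑ i, Φ (lam x i) ∂γ := by
        rw [setLIntegral_const, hT, Real.volume_Ioc, mul_left_comm,
          ← ENNReal.ofReal_mul hn'.le]
        have : (n : ℝ) * (1 - (1 - 1 / n)) = 1 := by field_simp; ring
        rw [this]; simp
    _ ≤ ENNReal.ofReal n * ∫⁻ t in T, ∫⁻ x, G x t ∂γ := by
        gcongr 1
        exact setLIntegral_mono' measurableSet_Ioc hslice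
    _ = ENNReal.ofReal n * ∫⁻ x, (∫⁻ t in T, G x t) ∂γ := by
        rw [lintegral_lintegral_swap hGm.aemeasurable]
    _ ≤ ENNReal.ofReal n * ∫⁻ x, ENNReal.ofReal (Fintype.card I * a⁻¹) * J *
          (ENNReal.ofReal s⁻¹ * A.indicator 1 x + ENNReal.ofReal s *
            (ENNReal.ofReal (Real.exp (4 * (‖x‖ ^ 2 / n)))
              + ENNReal.ofReal (Real.exp (4 * (C * X x))))) ∂γ := by
        gcongr with x
        exact (hinner x).trans (mul_le_mul' le_rfl (hyoung x))
    _ = _ := by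
        have hm1 : Measurable fun x => A.indicator (1 : V → ℝ≥0∞) x :=
          measurable_one.indicator hAm
        rw [lintegral_const_mul _ (by fun_prop), lintegral_add_left (by fun_prop),
          lintegral_const_mul _ (by fun_prop), lintegral_const_mul _ (by fun_prop),
          lintegral_add_left (by fun_prop), lintegral_indicator_one hAm, ← mul_assoc, ← mul_assoc,
          ← ENNReal.ofReal_mul hn'.le, mul_assoc (n : ℝ)]

end Dilation

end BlockCorr

/-! ### Linear combinations of the series -/

namespace BlockCorr

section Series

open scoped ENNReal

variable {Ω : Type*} [MeasurableSpace Ω] {P : Measure Ω}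

theorem integral_sq_gaussianReal (v : ℝ≥0) : ∫ x, x ^ 2 ∂(gaussianReal 0 v) = v := by
  have h := variance_id_gaussianReal (μ := 0) (v := v)
  rw [variance_eq_integral (by fun_prop)] at h
  simpa using h

theorem memLp_two_of_map_eq_gaussianReal {X : Ω → ℝ} (hX : Measurable X) {v : ℝ≥0}
    (h : P.map X = gaussianReal 0 v) : MemLp X 2 P := by
  have h1 : MemLp id 2 (P.map X) := by
    rw [h]; exact memLp_id_gaussianReal' 2 (by simp)
  exact h1.comp_of_map hX.aemeasurable

theorem integral_sq_of_map_eq_gaussianReal {X : Ω → ℝ} (hX : Measurable X) {v : ℝ≥0}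
    (h : P.map X = gaussianReal 0 v) : ∫ ω, X ω ^ 2 ∂P = v := by
  rw [← integral_sq_gaussianReal v, ← h, integral_map hX.aemeasurable (by fun_prop)]

theorem IsCircularGaussian.memLp_two {z : Ω → ℂ} (hz : Measurable z)
    (h : IsCircularGaussian P z) : MemLp z 2 P := by
  obtain ⟨v, -, hre, him⟩ := h
  exact memLp_re_im_iff.1 ⟨memLp_two_of_map_eq_gaussianReal (by fun_prop) hre,
    memLp_two_of_map_eq_gaussianReal (by fun_prop) him⟩

/-- The real part of a circularly symmetric Gaussian variable `z` is `N(0, E|z|² / 2)`. -/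
theorem IsCircularGaussian.map_re {z : Ω → ℂ} (hz : Measurable z) (h : IsCircularGaussian P z) :
    P.map (fun ω => (z ω).re) = gaussianReal 0 ((∫ ω, ‖z ω‖ ^ 2 ∂P) / 2).toNNReal := by
  obtain ⟨v, -, hre, him⟩ := h
  have h1 := integral_sq_of_map_eq_gaussianReal (by fun_prop) hre
  have h2 := integral_sq_of_map_eq_gaussianReal (by fun_prop) him
  have i1 := (memLp_two_of_map_eq_gaussianReal (by fun_prop) hre).integrable_sq
  have i2 := (memLp_two_of_map_eq_gaussianReal (by fun_prop) him).integrable_sq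
  have h3 : ∫ ω, ‖z ω‖ ^ 2 ∂P = 2 * v := by
    have : ∀ ω, ‖z ω‖ ^ 2 = (z ω).re ^ 2 + (z ω).im ^ 2 := fun ω => by
      rw [Complex.sq_norm, Complex.normSq_apply]; ring
    simp only [this]
    rw [integral_add i1 i2, h1, h2]; ring
  rw [hre, h3]
  congr 1
  rw [mul_div_cancel_left₀ _ two_ne_zero, Real.toNNReal_coe]

variable {y : ℕ → ℤ → Ω → ℂ} {κ : Type*} [Fintype κ]

theorem IsIndepGaussianSeries.isCircularGaussian_sum (hy : IsIndepGaussianSeries P y) (m : ℕ)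
    {τ : κ → ℤ} (hτ : Function.Injective τ) (a : κ → ℂ) :
    IsCircularGaussian P (fun ω => ∑ k, a k * y m (τ k) ω) := by
  have h := hy.gaussian m (Finset.univ.map ⟨τ, hτ⟩) (Function.extend τ a 0)
  simpa [hτ.extend_apply] using h

theorem IsIndepGaussianSeries.memLp_two (hy : IsIndepGaussianSeries P y) (m : ℕ) (n : ℤ) :
    MemLp (y m n) 2 P := by
  have h := hy.isCircularGaussian_sum m (κ := Unit) (τ := fun _ => n)
    (Function.injective_of_subsingleton _) (fun _ => 1)
  simp only [Finset.univ_unique, Finset.sum_singleton, one_mul] at h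
  exact h.memLp_two (hy.measurable m n)

theorem integrable_mul_conj {u w : Ω → ℂ} (hu : MemLp u 2 P) (hw : MemLp w 2 P) :
    Integrable (fun ω => u ω * conj (w ω)) P := by
  have := hu.integrable_mul hw.star
  exact this

theorem IsIndepGaussianSeries.integral_mul_conj (hy : IsIndepGaussianSeries P y) (m : ℕ)
    (n n' : ℤ) : ∫ ω, y m n ω * conj (y m n' ω) ∂P = autocov P y m (n - n') := by
  rw [← hy.stationary m n' (n - n')]
  simp

/-- The trigonometric polynomial `∑ a_k exp(2πi ν τ_k)`. -/
noncomputable def trigPoly (τ : κ → ℤ) (a : κ → ℂ) (ν : ℝ) : ℂ :=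
  ∑ k, a k * Complex.exp (2 * Real.pi * Complex.I * ν * τ k)

theorem continuous_trigPoly (τ : κ → ℤ) (a : κ → ℂ) : Continuous (trigPoly τ a) := by
  unfold trigPoly; fun_prop

theorem norm_sq_sum_mul (a z : κ → ℂ) : ((‖∑ k, a k * z k‖ ^ 2 : ℝ) : ℂ)
    = ∑ k, ∑ k', a k * conj (a k') * (z k * conj (z k')) := by
  push_cast
  rw [← Complex.mul_conj', map_sum, Finset.sum_mul_sum]
  refine Finset.sum_congr rfl fun k _ => Finset.sum_congr rfl fun k' _ => ?_
  rw [map_mul]; ring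

theorem exp_mul_conj_exp (ν : ℝ) (n n' : ℤ) :
    Complex.exp (2 * Real.pi * Complex.I * ν * n) *
      conj (Complex.exp (2 * Real.pi * Complex.I * ν * n'))
      = Complex.exp (2 * Real.pi * Complex.I * ν * ((n - n' : ℤ) : ℂ)) := by
  rw [← Complex.exp_conj, ← Complex.exp_add]
  congr 1
  simp only [map_mul, Complex.conj_I, Complex.conj_ofReal, map_ofNat, map_intCast]
  push_cast
  ring

/-- Second moments of linear combinations, in terms of the spectral density. -/
theorem IsIndepGaussianSeries.integral_norm_sq_sum (hy : IsIndepGaussianSeries P y)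
    {S : ℕ → ℝ → ℝ} (hS : IsSpectralDensity P y S) (m : ℕ) (τ : κ → ℤ) (a : κ → ℂ) :
    ∫ ω, ‖∑ k, a k * y m (τ k) ω‖ ^ 2 ∂P
      = ∫ ν in (0 : ℝ)..1, S m ν * ‖trigPoly τ a ν‖ ^ 2 := by
  have hSi := (hS m).1
  have hint : ∀ k k', Integrable (fun ω => a k * conj (a k') *
      (y m (τ k) ω * conj (y m (τ k') ω))) P := fun k k' =>
    (integrable_mul_conj (hy.memLp_two m _) (hy.memLp_two m _)).const_mul _
  have hSc : IntervalIntegrable (fun ν => (S m ν : ℂ)) volume 0 1 :=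
    ⟨hSi.1.ofReal, hSi.2.ofReal⟩
  have hint2 : ∀ k k', IntervalIntegrable (fun ν : ℝ => a k * conj (a k') *
      ((S m ν : ℂ) * Complex.exp (2 * Real.pi * Complex.I * ν * ((τ k - τ k' : ℤ) : ℂ))))
      volume 0 1 := fun k k' =>
    (hSc.mul_continuousOn (by fun_prop)).const_mul _
  have hC : ((∫ ω, ‖∑ k, a k * y m (τ k) ω‖ ^ 2 ∂P : ℝ) : ℂ)
      = ((∫ ν in (0 : ℝ)..1, S m ν * ‖trigPoly τ a ν‖ ^ 2 : ℝ) : ℂ) := by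
    rw [← integral_complex_ofReal, ← intervalIntegral.integral_ofReal]
    simp only [Complex.ofReal_mul, norm_sq_sum_mul, trigPoly]
    rw [integral_finsetSum _ fun k _ => integrable_finsetSum _ fun k' _ => hint k k']
    have hswap : ∀ ν : ℝ, (S m ν : ℂ) * ∑ k, ∑ k', a k * conj (a k') *
        (Complex.exp (2 * Real.pi * Complex.I * ν * τ k) *
          conj (Complex.exp (2 * Real.pi * Complex.I * ν * τ k')))
        = ∑ k, ∑ k', a k * conj (a k') *
      ((S m ν : ℂ) * Complex.exp (2 * Real.pi * Complex.I * ν * ((τ k - τ k' : ℤ) : ℂ))) := by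
      intro ν
      simp only [exp_mul_conj_exp, Finset.mul_sum]
      refine Finset.sum_congr rfl fun k _ => Finset.sum_congr rfl fun k' _ => by ring
    simp only [hswap]
    rw [intervalIntegral.integral_finsetSum]
    · refine Finset.sum_congr rfl fun k _ => ?_
      rw [integral_finsetSum _ fun k' _ => hint k k', intervalIntegral.integral_finsetSum]
      · refine Finset.sum_congr rfl fun k' _ => ?_
        rw [integral_const_mul, intervalIntegral.integral_const_mul, hy.integral_mul_conj,
          (hS m).2]
      · exact fun k' _ => hint2 k k'
    · intro k _
      have := IntervalIntegrable.sum Finset.univ fun k' (_ : k' ∈ Finset.univ) => hint2 k k'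
      simpa only [Finset.sum_fn] using this
  exact_mod_cast hC

/-- Parseval's identity for trigonometric polynomials. -/
theorem integral_norm_sq_trigPoly {τ : κ → ℤ} (hτ : Function.Injective τ) (a : κ → ℂ) :
    ∫ ν in (0 : ℝ)..1, ‖trigPoly τ a ν‖ ^ 2 = ∑ k, ‖a k‖ ^ 2 := by
  classical
  have hexp : ∀ k k', ∫ ν in (0 : ℝ)..1,
      Complex.exp (2 * Real.pi * Complex.I * ν * ((τ k - τ k' : ℤ) : ℂ))
      = if k = k' then 1 else 0 := by
    intro k k'
    split_ifs with h
    · subst h; simp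
    · have hn : (τ k - τ k') ≠ 0 := sub_ne_zero.2 fun h' => h (hτ h')
      set n := τ k - τ k'
      have hc : (2 * Real.pi * Complex.I * n : ℂ) ≠ 0 := by
        have : (n : ℂ) ≠ 0 := by exact_mod_cast hn
        simp [Real.pi_ne_zero, this]
      have h1 : ∀ ν : ℝ, Complex.exp (2 * Real.pi * Complex.I * ν * (n : ℂ))
          = Complex.exp ((2 * Real.pi * Complex.I * n : ℂ) * ν) := fun ν => by
        congr 1; ring
      simp only [h1]
      rw [integral_exp_mul_complex hc]
      have h2 : Complex.exp (2 * Real.pi * Complex.I * n * ((1 : ℝ) : ℂ)) = 1 := by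
        rw [← Complex.exp_int_mul_two_pi_mul_I n]; congr 1; push_cast; ring
      rw [h2]; simp
  have hint : ∀ k k', IntervalIntegrable (fun ν : ℝ => a k * conj (a k') *
      Complex.exp (2 * Real.pi * Complex.I * ν * ((τ k - τ k' : ℤ) : ℂ))) volume 0 1 :=
    fun k k' => Continuous.intervalIntegrable (by fun_prop) _ _
  have hC : ((∫ ν in (0 : ℝ)..1, ‖trigPoly τ a ν‖ ^ 2 : ℝ) : ℂ) = ((∑ k, ‖a k‖ ^ 2 : ℝ) : ℂ) := by
    rw [← intervalIntegral.integral_ofReal]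
    simp only [norm_sq_sum_mul, trigPoly, exp_mul_conj_exp]
    rw [intervalIntegral.integral_finsetSum fun k _ => by
      have := IntervalIntegrable.sum Finset.univ fun k' (_ : k' ∈ Finset.univ) => hint k k'
      simpa only [Finset.sum_fn] using this]
    rw [Complex.ofReal_sum]
    refine Finset.sum_congr rfl fun k _ => ?_
    rw [intervalIntegral.integral_finsetSum fun k' _ => hint k k']
    simp only [intervalIntegral.integral_const_mul, hexp]
    simp [Complex.mul_conj']
  exact_mod_cast hC

theorem IsIndepGaussianSeries.integral_norm_sq_sum_mem_Icc (hy : IsIndepGaussianSeries P y)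
    {S : ℕ → ℝ → ℝ} (hS : IsSpectralDensity P y S) {smin smax : ℝ}
    (hmin : ∀ m, ∀ ν ∈ Set.Icc (0 : ℝ) 1, smin ≤ S m ν)
    (hmax : ∀ m, ∀ ν ∈ Set.Icc (0 : ℝ) 1, S m ν ≤ smax)
    (m : ℕ) {τ : κ → ℤ} (hτ : Function.Injective τ) (a : κ → ℂ) :
    ∫ ω, ‖∑ k, a k * y m (τ k) ω‖ ^ 2 ∂P
      ∈ Set.Icc (smin * ∑ k, ‖a k‖ ^ 2) (smax * ∑ k, ‖a k‖ ^ 2) := by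
  rw [hy.integral_norm_sq_sum hS, ← integral_norm_sq_trigPoly hτ a,
    ← intervalIntegral.integral_const_mul, ← intervalIntegral.integral_const_mul]
  have hc := continuous_trigPoly τ a
  have i1 : ∀ c : ℝ, IntervalIntegrable (fun ν => c * ‖trigPoly τ a ν‖ ^ 2) volume 0 1 :=
    fun c => Continuous.intervalIntegrable (by fun_prop) _ _
  have i2 : IntervalIntegrable (fun ν => S m ν * ‖trigPoly τ a ν‖ ^ 2) volume 0 1 :=
    (hS m).1.mul_continuousOn (by fun_prop)
  exact ⟨intervalIntegral.integral_mono_on zero_le_one (i1 _) i2 fun ν hν =>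
      mul_le_mul_of_nonneg_right (hmin m ν hν) (sq_nonneg _),
    intervalIntegral.integral_mono_on zero_le_one i2 (i1 _) fun ν hν =>
      mul_le_mul_of_nonneg_right (hmax m ν hν) (sq_nonneg _)⟩

/-- Real parts of linear combinations across the first `M` series are centred Gaussian, with a
variance controlled by the bounds on the spectral densities. -/
theorem IsIndepGaussianSeries.exists_map_re_sum [IsProbabilityMeasure P]
    (hy : IsIndepGaussianSeries P y)
    {S : ℕ → ℝ → ℝ} (hS : IsSpectralDensity P y S) {smin smax : ℝ}
    (hmin : ∀ m, ∀ ν ∈ Set.Icc (0 : ℝ) 1, smin ≤ S m ν)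
    (hmax : ∀ m, ∀ ν ∈ Set.Icc (0 : ℝ) 1, S m ν ≤ smax)
    {M : ℕ} {τ : κ → ℤ} (hτ : Function.Injective τ) (a : Fin M → κ → ℂ) :
    ∃ v : ℝ≥0, (v : ℝ) ∈ Set.Icc (smin / 2 * ∑ m, ∑ k, ‖a m k‖ ^ 2)
        (smax / 2 * ∑ m, ∑ k, ‖a m k‖ ^ 2) ∧
      P.map (fun ω => (∑ m : Fin M, ∑ k, a m k * y m (τ k) ω).re) = gaussianReal 0 v := by
  set X : Fin M → Ω → ℝ := fun m ω => (∑ k, a m k * y m (τ k) ω).re with hX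
  have hmeas : ∀ m : Fin M, Measurable fun ω => ∑ k, a m k * y m (τ k) ω := fun m =>
    Finset.measurable_fun_sum _ fun k _ => (hy.measurable m (τ k)).const_mul _
  have hXm : ∀ m, Measurable (X m) := fun m => Complex.measurable_re.comp (hmeas m)
  set w : Fin M → ℝ := fun m => (∫ ω, ‖∑ k, a m k * y m (τ k) ω‖ ^ 2 ∂P) / 2 with hw
  have hw0 : ∀ m, 0 ≤ w m := fun m => div_nonneg (integral_nonneg fun _ => sq_nonneg _) two_pos.le
  have hlaw : ∀ m, P.map (X m) = gaussianReal 0 (w m).toNNReal := fun m =>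
    (hy.isCircularGaussian_sum m hτ (a m)).map_re (hmeas m)
  have hind : iIndepFun X P := by
    have h1 := hy.indep.precomp (g := fun m : Fin M => (m : ℕ)) Fin.val_injective
    have h2 := h1.comp (fun (m : Fin M) (z : ℤ → ℂ) => (∑ k, a m k * z (τ k)).re) fun m => by
      fun_prop
    exact h2
  have hsum : ∀ s : Finset (Fin M), P.map (fun ω => ∑ m ∈ s, X m ω)
      = gaussianReal 0 (∑ m ∈ s, (w m).toNNReal) := by
    classical
    intro s
    induction s using Finset.induction_on with
    | empty => simp
    | insert i s his ih =>
      have hi : IndepFun (X i) (fun ω => ∑ m ∈ s, X m ω) P := by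
        have := (hind.indepFun_finsetSum_of_notMem hXm his).symm
        convert this using 1
        ext ω; simp
      have h := gaussianReal_add_gaussianReal_of_indepFun hi (hlaw i) ih
      simp only [Finset.sum_insert his]
      rw [add_zero] at h
      exact h
  refine ⟨∑ m, (w m).toNNReal, ?_, ?_⟩
  · push_cast
    simp only [Real.coe_toNNReal _ (hw0 _), Finset.mul_sum (s := (Finset.univ : Finset (Fin M)))]
    have hb := fun m : Fin M => hy.integral_norm_sq_sum_mem_Icc hS hmin hmax m hτ (a m)
    constructor
    · refine Finset.sum_le_sum fun m _ => ?_
      have := (hb m).1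
      simp only [hw]; linarith
    · refine Finset.sum_le_sum fun m _ => ?_
      have := (hb m).2
      simp only [hw]; linarith
  · rw [← hsum Finset.univ]
    congr 1
    ext ω
    simp [hX]

end Series

section GaussianVector

open scoped ENNReal RealInnerProductSpace MatrixOrder

/-- A centred Gaussian measure whose covariance is at most `σ` is the image of the standard one
under a linear map of norm at most `√σ`. -/
theorem exists_map_stdGaussian_eq {ι : Type*} [Fintype ι] (μ : Measure (EuclideanSpace ℝ ι))
    [IsGaussian μ] (hμ : μ[id] = 0) {σ : ℝ}
    (hσ : ∀ x : EuclideanSpace ℝ ι, Var[fun u => ⟪x, u⟫; μ] ≤ σ * ‖x‖ ^ 2) :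
    ∃ A : EuclideanSpace ℝ ι →L[ℝ] EuclideanSpace ℝ ι,
      μ = (stdGaussian (EuclideanSpace ℝ ι)).map A ∧ ∀ x, ‖A x‖ ^ 2 ≤ σ * ‖x‖ ^ 2 := by
  classical
  set b := EuclideanSpace.basisFun ι ℝ
  set S : Matrix ι ι ℝ := Matrix.of fun i j => covarianceBilin μ (b i) (b j) with hSdef
  have hquad : ∀ x y : EuclideanSpace ℝ ι, covarianceBilin μ x y = x ⬝ᵥ S.mulVec y := by
    intro x y
    conv_lhs => rw [← b.sum_repr x, ← b.sum_repr y]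
    simp only [map_sum, map_smul, smul_apply, sum_apply, smul_eq_mul,
      dotProduct, Matrix.mulVec, hSdef, Matrix.of_apply, Finset.mul_sum, b,
      EuclideanSpace.basisFun_repr]
    rw [Finset.sum_comm]
    refine Finset.sum_congr rfl fun i _ => Finset.sum_congr rfl fun j _ => by ring
  have hS : S.PosSemidef := by
    refine Matrix.PosSemidef.of_dotProduct_mulVec_nonneg ?_ fun x => ?_
    · ext i j
      simp only [hSdef, Matrix.conjTranspose_apply, Matrix.of_apply, star_trivial]
      exact covarianceBilin_comm _ _
    · have := hquad (WithLp.toLp 2 x) (WithLp.toLp 2 x)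
      simp only [star_trivial]
      rw [← this]
      exact covarianceBilin_self_nonneg _
  have heq : μ = multivariateGaussian 0 S := by
    apply IsGaussian.ext
    · rw [hμ]; simp
    · ext x y
      rw [covarianceBilin_multivariateGaussian hS, hquad]
  set A := Matrix.toEuclideanCLM (𝕜 := ℝ) (CFC.sqrt S) with hA
  have hmap : μ = (stdGaussian (EuclideanSpace ℝ ι)).map A := by
    conv_lhs => rw [heq, multivariateGaussian]
    simp only [zero_add]
    rfl
  refine ⟨A, hmap, fun x => ?_⟩
  have hAadj : ContinuousLinearMap.adjoint A = A := by
    have : IsSelfAdjoint A := (CFC.sqrt_nonneg S).isSelfAdjoint.map _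
    exact this.adjoint_eq
  have h1 : covarianceBilin μ x x = ‖A x‖ ^ 2 := by
    rw [hmap, covarianceBilin_map IsGaussian.memLp_two_id, covarianceBilin_stdGaussian,
      hAadj, innerSL_apply_apply, real_inner_self_eq_norm_sq]
  rw [← h1, covarianceBilin_self IsGaussian.memLp_two_id]
  exact hσ x

end GaussianVector

end BlockCorr

/-! ### Linear statistics of matrices that are linear in a Gaussian vector -/

namespace BlockCorr

section LinearStatistic

open scoped Matrix Matrix.Norms.L2Operator ENNReal ComplexOrder

variable {I J : Type*} [Fintype I] [Fintype J]

theorem frobSq_add_le (A B : Matrix I J ℂ) : frobSq (A + B) ≤ 2 * frobSq A + 2 * frobSq B := by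
  simp only [frobSq, Finset.mul_sum, ← Finset.sum_add_distrib]
  refine Finset.sum_le_sum fun i _ => Finset.sum_le_sum fun j _ => ?_
  have h := norm_add_le (A i j) (B i j)
  rw [Matrix.add_apply]
  have h2 := pow_le_pow_left₀ (norm_nonneg _) h 2
  nlinarith [sq_nonneg (‖A i j‖ - ‖B i j‖)]

theorem frobSq_smul (c : ℂ) (A : Matrix I J ℂ) : frobSq (c • A) = ‖c‖ ^ 2 * frobSq A := by
  simp only [frobSq, Finset.mul_sum, Matrix.smul_apply, norm_smul, mul_pow]

theorem isHermitian_mul_conjTranspose {I : Type*} (W : Matrix I J ℂ) : (W * Wᴴ).IsHermitian :=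
  Matrix.isHermitian_mul_conjTranspose_self W

variable [DecidableEq I]

/-- The normalized linear statistic `(1/n) ∑ φ(λ_i)` of the eigenvalues of `W Wᴴ`. -/
noncomputable def linStat (φ : ℝ → ℝ) (W : Matrix I J ℂ) : ℝ :=
  (Fintype.card I : ℝ)⁻¹ * ∑ i, φ ((isHermitian_mul_conjTranspose W).eigenvalues i)

theorem measurable_linStat {Z : Type*} [MeasurableSpace Z] {W : Z → Matrix I J ℂ}
    (hW : ∀ i j, Measurable fun z => W z i j) {φ : ℝ → ℝ} (hφ : Measurable φ) :
    Measurable fun z => linStat φ (W z) := by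
  unfold linStat
  refine Measurable.const_mul (Finset.measurable_fun_sum _ fun i _ => hφ.comp ?_) _
  refine measurable_eigenvalues _ (fun i j => ?_) i
  simp only [Matrix.mul_apply, Matrix.conjTranspose_apply]
  refine Finset.measurable_fun_sum _ fun k _ => (hW i k).mul ?_
  exact continuous_star.measurable.comp (hW j k)

variable [DecidableEq J]

theorem norm_mul_conjTranspose (W : Matrix I J ℂ) : ‖W * Wᴴ‖ = ‖W‖ ^ 2 := by
  have h := Matrix.l2_opNorm_conjTranspose_mul_self Wᴴ
  rw [Matrix.conjTranspose_conjTranspose, Matrix.l2_opNorm_conjTranspose] at h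
  rw [h, sq]

theorem frobSq_mul_conjTranspose_sub_le (A B : Matrix I J ℂ) {α : ℝ}
    (hA : ‖A * Aᴴ‖ ≤ α) (hB : ‖B * Bᴴ‖ ≤ α) :
    frobSq (A * Aᴴ - B * Bᴴ) ≤ 4 * α * frobSq (A - B) := by
  rw [norm_mul_conjTranspose] at hA hB
  have h : A * Aᴴ - B * Bᴴ = (A - B) * Aᴴ + B * (A - B)ᴴ := by
    rw [Matrix.conjTranspose_sub, Matrix.sub_mul, Matrix.mul_sub]; abel
  have h1 : frobSq ((A - B) * Aᴴ) ≤ α * frobSq (A - B) := by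
    rw [← frobSq_conjTranspose, Matrix.conjTranspose_mul, Matrix.conjTranspose_conjTranspose]
    refine (frobSq_mul_le A (A - B)ᴴ).trans ?_
    rw [frobSq_conjTranspose]
    exact mul_le_mul_of_nonneg_right hA (frobSq_nonneg _)
  have h2 : frobSq (B * (A - B)ᴴ) ≤ α * frobSq (A - B) := by
    refine (frobSq_mul_le B (A - B)ᴴ).trans ?_
    rw [frobSq_conjTranspose]
    exact mul_le_mul_of_nonneg_right hB (frobSq_nonneg _)
  rw [h]
  have := frobSq_add_le ((A - B) * Aᴴ) (B * (A - B)ᴴ)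
  linarith

variable {V : Type*} [NormedAddCommGroup V] [InnerProductSpace ℝ V] [FiniteDimensional ℝ V]
  [MeasurableSpace V] [BorelSpace V]

/-- For a matrix depending linearly on a standard Gaussian vector, a linear statistic coincides on
`{‖W Wᴴ‖ ≤ α}` with a bounded function that is Lipschitz on the whole space, hence concentrated. -/
theorem exists_concentrated_eq_linStat [Nonempty I] (W : V →ₗ[ℝ] Matrix I J ℂ) {l : ℝ} (hl : 0 < l)
    (hW : ∀ g, frobSq (W g) ≤ l ^ 2 * ‖g‖ ^ 2) {φ : ℝ → ℝ} {α C C₀ : ℝ} (hα : 0 < α) (hC : 0 < C)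
    (hC₀ : 0 ≤ C₀) (hφ : ∀ x ∈ Set.Icc 0 α, ∀ y ∈ Set.Icc 0 α, |φ x - φ y| ≤ C * |x - y|)
    (hφ₀ : ∀ x ∈ Set.Icc 0 α, |φ x| ≤ C₀) :
    ∃ F : V → ℝ, Continuous F ∧ (∀ g, |F g| ≤ C₀) ∧
      (∀ g, ‖W g * (W g)ᴴ‖ ≤ α → F g = linStat φ (W g)) ∧
      ∀ t, 4 * (2 * C * √α * l / √(Fintype.card I)) ≤ t →
        (stdGaussian V).real {g | t < |F g - ∫ g, F g ∂(stdGaussian V)|} ≤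
          2 * Real.exp (-(t ^ 2 / (2 * Real.pi ^ 2 *
            (2 * C * √α * l / √(Fintype.card I)) ^ 2))) := by
  set n : ℝ := ((Fintype.card I : ℕ) : ℝ) with hn
  have hn0 : 0 < n := by rw [hn]; exact_mod_cast Fintype.card_pos
  have hsn : 0 < √n := Real.sqrt_pos.2 hn0
  have hK0 : 0 < 2 * C * √α * l / √n := by
    have := Real.sqrt_pos.2 hα
    positivity
  set K : ℝ≥0 := ⟨2 * C * √α * l / √n, hK0.le⟩ with hK
  set D : Set V := {g | ‖W g * (W g)ᴴ‖ ≤ α} with hD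
  have hmem : ∀ g ∈ D, ∀ i, (isHermitian_mul_conjTranspose (W g)).eigenvalues i ∈ Set.Icc 0 α :=
    fun g hg i => ⟨eigenvalues_mul_conjTranspose_nonneg _ i,
      (le_abs_self _).trans ((abs_eigenvalues_le_norm _ i).trans hg)⟩
  have hlip : LipschitzOnWith K (fun g => linStat φ (W g)) D := by
    refine LipschitzOnWith.of_dist_le_mul fun g hg g' hg' => ?_
    have h1 := abs_sum_eigenvalues_sub_le (isHermitian_mul_conjTranspose (W g))
      (isHermitian_mul_conjTranspose (W g')) hC.le hφ (hmem g hg) (hmem g' hg')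
    have h2 := frobSq_mul_conjTranspose_sub_le (W g) (W g') hg hg'
    have h3 := hW (g - g')
    rw [map_sub] at h3
    have h4 : √(frobSq (W g * (W g)ᴴ - W g' * (W g')ᴴ)) ≤ 2 * √α * l * ‖g - g'‖ := by
      refine Real.sqrt_le_iff.2 ⟨by positivity, ?_⟩
      calc _ ≤ 4 * α * (l ^ 2 * ‖g - g'‖ ^ 2) :=
            h2.trans (mul_le_mul_of_nonneg_left h3 (by positivity))
        _ = _ := by
            rw [mul_pow, mul_pow, mul_pow, Real.sq_sqrt hα.le]; ring
    rw [Real.dist_eq, linStat, linStat, ← mul_sub, abs_mul, abs_of_pos (inv_pos.2 hn0),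
      dist_eq_norm]
    calc n⁻¹ * |_| ≤ n⁻¹ * (C * √n * (2 * √α * l * ‖g - g'‖)) := by
          refine mul_le_mul_of_nonneg_left (h1.trans ?_) (inv_pos.2 hn0).le
          exact mul_le_mul_of_nonneg_left h4 (by positivity)
      _ = 2 * C * √α * l / √n * ‖g - g'‖ := by
          have : n⁻¹ = (√n)⁻¹ * (√n)⁻¹ := by rw [← mul_inv, Real.mul_self_sqrt hn0.le]
          rw [this]
          field_simp
      _ = _ := rfl
  -- McShane extension of the statistic from `D`, then truncation at `± C₀`
  obtain ⟨G, hG, hGeq⟩ := hlip.extend_real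
  have hF : LipschitzWith K (fun g => max (-C₀) (min C₀ (G g))) := (hG.const_min C₀).const_max (-C₀)
  refine ⟨fun g => max (-C₀) (min C₀ (G g)), hF.continuous, fun g => ?_, fun g hg => ?_,
    fun t ht => ?_⟩
  · rw [abs_le]
    exact ⟨le_max_left _ _, max_le (by linarith) (min_le_left _ _)⟩
  · have hb : |linStat φ (W g)| ≤ C₀ := by
      rw [linStat, abs_mul, abs_of_pos (inv_pos.2 hn0)]
      rw [inv_mul_le_iff₀ hn0]
      refine (Finset.abs_sum_le_sum_abs _ _).trans ?_
      refine (Finset.sum_le_sum fun i _ => hφ₀ _ (hmem g hg i)).trans ?_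
      simp [hn]
    have e : linStat φ (W g) = G g := hGeq hg
    have := abs_le.1 hb
    simp only [← e]
    rw [min_eq_right this.2, max_eq_right this.1]
  · exact measure_abs_sub_integral_gt_le (K := K) hK0 hF ht

end LinearStatistic

end BlockCorr

/-! ### The correlation matrix as a function of a Gaussian vector -/

namespace BlockCorr

section Model

open scoped Matrix Matrix.Norms.L2Operator ENNReal ComplexOrder RealInnerProductSpace

variable {Ω : Type*} [MeasurableSpace Ω] {P : Measure Ω} {y : ℕ → ℤ → Ω → ℂ}

/-- The space of the real and imaginary parts of the variables `y_{m,t}`, `m < M`, `t < T`. -/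
abbrev SeriesSpace (M T : ℕ) : Type := EuclideanSpace ℝ ((Fin M × Fin T) × Bool)

/-- The random vector of the real and imaginary parts of `y_{m,t}`, `m < M`, `0 ≤ t < T`. -/
noncomputable def seriesVector (y : ℕ → ℤ → Ω → ℂ) (M T : ℕ) (ω : Ω) : SeriesSpace M T :=
  WithLp.toLp 2 fun p => if p.2 then (y p.1.1 ((p.1.2 : ℕ) : ℤ) ω).im
    else (y p.1.1 ((p.1.2 : ℕ) : ℤ) ω).re

theorem measurable_seriesVector (hy : IsIndepGaussianSeries P y) (M T : ℕ) :
    Measurable (seriesVector y M T) := by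
  refine (PiLp.continuous_toLp 2 _).measurable.comp (measurable_pi_lambda _ fun p => ?_)
  have := hy.measurable p.1.1 ((p.1.2 : ℕ) : ℤ)
  by_cases h : p.2
  · simp only [h, if_true]; fun_prop
  · simp only [h, Bool.false_eq_true, if_false]; fun_prop

theorem inner_seriesVector {Ω' : Type*} (y : ℕ → ℤ → Ω' → ℂ) (M T : ℕ) (x : SeriesSpace M T) (ω : Ω') :
    ⟪x, seriesVector y M T ω⟫ = (∑ m : Fin M, ∑ t : Fin T,
      (⟨x ((m, t), false), -x ((m, t), true)⟩ : ℂ) * y m ((t : ℕ) : ℤ) ω).re := by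
  rw [PiLp.inner_apply, Fintype.sum_prod_type, Fintype.sum_prod_type]
  simp only [Complex.re_sum, Fintype.sum_bool, seriesVector, Complex.mul_re, if_true,
    RCLike.inner_apply, conj_trivial]
  refine Finset.sum_congr rfl fun m _ => Finset.sum_congr rfl fun t _ => ?_
  simp
  ring

theorem norm_sq_seriesSpace {M T : ℕ} (x : SeriesSpace M T) :
    ‖x‖ ^ 2 = ∑ m : Fin M, ∑ t : Fin T, (x ((m, t), false) ^ 2 + x ((m, t), true) ^ 2) := by
  rw [EuclideanSpace.norm_sq_eq, Fintype.sum_prod_type, Fintype.sum_prod_type]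
  refine Finset.sum_congr rfl fun m _ => Finset.sum_congr rfl fun t _ => ?_
  rw [Fintype.sum_bool, Real.norm_eq_abs, Real.norm_eq_abs, sq_abs, sq_abs, add_comm]

/-- The observed vector is a linear image of a standard Gaussian vector. The factor `1/2` is the
share of the real part in the variance of a circularly symmetric variable. -/
theorem exists_map_seriesVector_eq [IsProbabilityMeasure P]
    (hy : IsIndepGaussianSeries P y)
    {S : ℕ → ℝ → ℝ} (hS : IsSpectralDensity P y S) {smin smax : ℝ}
    (hmin : ∀ m, ∀ ν ∈ Set.Icc (0 : ℝ) 1, smin ≤ S m ν)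
    (hmax : ∀ m, ∀ ν ∈ Set.Icc (0 : ℝ) 1, S m ν ≤ smax) (M T : ℕ) :
    ∃ A : SeriesSpace M T →L[ℝ] SeriesSpace M T,
      P.map (seriesVector y M T) = (stdGaussian (SeriesSpace M T)).map A ∧
        ∀ x, ‖A x‖ ^ 2 ≤ smax / 2 * ‖x‖ ^ 2 := by
  have hYm := measurable_seriesVector hy M T
  have hτ : Function.Injective fun t : Fin T => ((t : ℕ) : ℤ) := fun a b h => by
    simpa [Fin.ext_iff] using h
  have hlaw : ∀ x : SeriesSpace M T, ∃ v : ℝ≥0, (v : ℝ) ≤ smax / 2 * ‖x‖ ^ 2 ∧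
      (P.map (seriesVector y M T)).map (fun u => ⟪x, u⟫) = gaussianReal 0 v := by
    intro x
    obtain ⟨v, hv, h⟩ := hy.exists_map_re_sum hS hmin hmax hτ
      fun (m : Fin M) (t : Fin T) => (⟨x ((m, t), false), -x ((m, t), true)⟩ : ℂ)
    refine ⟨v, ?_, ?_⟩
    · rw [norm_sq_seriesSpace]
      refine hv.2.trans (le_of_eq ?_)
      congr 1
      refine Finset.sum_congr rfl fun m _ => Finset.sum_congr rfl fun t _ => ?_
      rw [Complex.sq_norm, Complex.normSq_apply]
      ring
    · rw [Measure.map_map (by fun_prop) hYm, ← h]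
      congr 1
      ext ω
      exact inner_seriesVector y M T x ω
  have hG : IsGaussian (P.map (seriesVector y M T)) := by
    refine isGaussian_of_map_eq_gaussianReal fun L => ?_
    obtain ⟨v, -, hv⟩ := hlaw ((InnerProductSpace.toDual ℝ _).symm L)
    refine ⟨0, v, ?_⟩
    rw [← hv]
    congr 1
    ext u
    simp
  refine exists_map_stdGaussian_eq _ ?_ fun x => ?_
  · refine ext_inner_left ℝ fun x => ?_
    obtain ⟨v, -, hv⟩ := hlaw x
    rw [inner_zero_right, ← integral_inner IsGaussian.integrable_id]
    have h1 : ∫ u, u ∂((P.map (seriesVector y M T)).map (fun u => ⟪x, u⟫)) = 0 := by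
      rw [hv]; simp
    rwa [integral_map (by fun_prop) (by fun_prop)] at h1
  · obtain ⟨v, hvle, hv⟩ := hlaw x
    have h1 : Var[fun u => u; (P.map (seriesVector y M T)).map (fun u => ⟪x, u⟫)] = v := by
      rw [hv]; exact variance_fun_id_gaussianReal
    rw [variance_map (by fun_prop) (by fun_prop)] at h1
    calc _ = (v : ℝ) := h1
      _ ≤ _ := hvle

/-- The block Hankel matrix with entries `z_{m, n + 1 + l}` in row `(m, l)` and column `n < N`,
where the real and imaginary parts of `z` are the coordinates of `g`. -/
noncomputable def hankel (M L N : ℕ) :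
    SeriesSpace M (N + L) →ₗ[ℝ] Matrix (Fin M × Fin L) (Fin N) ℂ where
  toFun g := Matrix.of fun p n =>
    ⟨g ((p.1, ⟨n + 1 + p.2, by omega⟩), false), g ((p.1, ⟨n + 1 + p.2, by omega⟩), true)⟩
  map_add' g g' := by
    ext p n
    apply Complex.ext <;> simp
  map_smul' t g := by
    ext p n
    apply Complex.ext <;> simp

theorem hankel_apply (M L N : ℕ) (g : SeriesSpace M (N + L)) (p : Fin M × Fin L) (n : Fin N) :
    hankel M L N g p n = ⟨g ((p.1, ⟨n + 1 + p.2, by omega⟩), false),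
      g ((p.1, ⟨n + 1 + p.2, by omega⟩), true)⟩ := rfl

/-- Every variable occurs at most `L` times in the block Hankel matrix. -/
theorem frobSq_hankel_le (M L N : ℕ) (g : SeriesSpace M (N + L)) :
    frobSq (hankel M L N g) ≤ L * ‖g‖ ^ 2 := by
  rw [norm_sq_seriesSpace, frobSq, Fintype.sum_prod_type, Finset.mul_sum]
  refine Finset.sum_le_sum fun m _ => ?_
  set q : Fin (N + L) → ℝ := fun t => g ((m, t), false) ^ 2 + g ((m, t), true) ^ 2 with hq
  have hq0 : ∀ t, 0 ≤ q t := fun t => by positivity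
  have hle : ∀ l : Fin L, ∑ n : Fin N, ‖hankel M L N g (m, l) n‖ ^ 2 ≤ ∑ t, q t := by
    intro l
    let e : Fin N ↪ Fin (N + L) := ⟨fun n => ⟨n + 1 + l, by omega⟩, fun a b h => by
      simp only [Fin.mk.injEq] at h
      ext; omega⟩
    have h1 : ∑ n : Fin N, ‖hankel M L N g (m, l) n‖ ^ 2 = ∑ t ∈ Finset.univ.map e, q t := by
      rw [Finset.sum_map]
      refine Finset.sum_congr rfl fun n _ => ?_
      rw [hankel_apply, Complex.sq_norm, Complex.normSq_apply, ← sq, ← sq]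
      rfl
    rw [h1]
    exact Finset.sum_le_sum_of_subset_of_nonneg (Finset.subset_univ _) fun t _ _ => hq0 t
  refine (Finset.sum_le_sum fun l _ => hle l).trans (le_of_eq ?_)
  simp

theorem hankel_seriesVector_apply {Ω' : Type*} (y : ℕ → ℤ → Ω' → ℂ) (M L N : ℕ) (ω : Ω')
    (p : Fin M × Fin L) (n : Fin N) :
    hankel M L N (seriesVector y M (N + L) ω) p n
      = lagVector y M L ((n : ℕ) + 1 : ℕ) ω p := by
  rw [hankel_apply]
  simp only [seriesVector, lagVector]
  apply Complex.ext <;> simp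

theorem sampleCov_eq {Ω' : Type*} (y : ℕ → ℤ → Ω' → ℂ) (M L N : ℕ) (ω : Ω') : sampleCov y M L N ω = (N : ℂ)⁻¹ •
    (hankel M L N (seriesVector y M (N + L) ω) *
      (hankel M L N (seriesVector y M (N + L) ω))ᴴ) := by
  unfold sampleCov
  congr 1
  ext p q
  rw [Matrix.sum_apply, Matrix.mul_apply]
  have h1 : ∀ n : Fin N, hankel M L N (seriesVector y M (N + L) ω) p n *
      (hankel M L N (seriesVector y M (N + L) ω))ᴴ n q
      = Matrix.vecMulVec (lagVector y M L ((n : ℕ) + 1 : ℕ) ω)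
        (star (lagVector y M L ((n : ℕ) + 1 : ℕ) ω)) p q := by
    intro n
    rw [Matrix.conjTranspose_apply, hankel_seriesVector_apply, hankel_seriesVector_apply]
    rfl
  simp only [h1]
  rw [Fin.sum_univ_eq_sum_range (fun n => Matrix.vecMulVec (lagVector y M L (n + 1 : ℕ) ω)
        (star (lagVector y M L (n + 1 : ℕ) ω)) p q) N, Finset.range_eq_Ico,
    Finset.sum_Ico_add' (fun n : ℕ => Matrix.vecMulVec (lagVector y M L (n : ℤ) ω)
        (star (lagVector y M L (n : ℤ) ω)) p q) 0 N 1]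
  rfl

theorem isHermitian_bdiag_covMatrix (M L : ℕ) :
    (bdiag (covMatrix P y M L)).IsHermitian := by
  ext p q
  simp only [Matrix.conjTranspose_apply, bdiag, Matrix.of_apply, covMatrix]
  by_cases h : p.1 = q.1
  · rw [if_pos h, if_pos h.symm, RCLike.star_def, ← integral_conj]
    simp only [map_mul, Complex.conj_conj, mul_comm]
  · rw [if_neg h, if_neg fun h' => h h'.symm, star_zero]

/-- The quadratic form of the block-diagonal part of the covariance matrix does not mix the series,
so that it is a sum of variances of linear combinations within a series. -/
theorem re_dotProduct_bdiag_covMatrix (hy : IsIndepGaussianSeries P y) (M L : ℕ)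
    (x : Fin M × Fin L → ℂ) :
    (star x ⬝ᵥ (bdiag (covMatrix P y M L)) *ᵥ x).re
      = ∑ m : Fin M, ∫ ω, ‖∑ l : Fin L, conj (x (m, l)) * y m (1 + ((l : ℕ) : ℤ)) ω‖ ^ 2 ∂P := by
  have hint : ∀ (m : ℕ) (a : ℂ) (n n' : ℤ), Integrable (fun ω => a *
      (y m n ω * conj (y m n' ω))) P := fun m a n n' =>
    (integrable_mul_conj (hy.memLp_two m _) (hy.memLp_two m _)).const_mul _
  have hC : star x ⬝ᵥ (bdiag (covMatrix P y M L)) *ᵥ x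
      = ((∑ m : Fin M, ∫ ω, ‖∑ l : Fin L, conj (x (m, l)) * y m (1 + ((l : ℕ) : ℤ)) ω‖ ^ 2 ∂P : ℝ)
        : ℂ) := by
    rw [Complex.ofReal_sum]
    simp only [dotProduct, Matrix.mulVec, Pi.star_apply, Finset.mul_sum]
    rw [Fintype.sum_prod_type]
    refine Finset.sum_congr rfl fun m _ => ?_
    rw [← integral_complex_ofReal]
    simp only [norm_sq_sum_mul]
    rw [integral_finsetSum _ fun k _ => integrable_finsetSum _ fun k' _ => hint m _ _ _]
    refine Finset.sum_congr rfl fun l _ => ?_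
    rw [integral_finsetSum _ fun k' _ => hint m _ _ _, Fintype.sum_prod_type]
    rw [Finset.sum_eq_single m]
    · refine Finset.sum_congr rfl fun l' _ => ?_
      rw [integral_const_mul]
      simp only [bdiag, Matrix.of_apply, covMatrix, lagVector, if_true, Complex.conj_conj,
        RCLike.star_def]
      ring
    · intro m' _ hm'
      refine Finset.sum_eq_zero fun l' _ => ?_
      simp [bdiag, hm'.symm]
    · simp
  rw [hC, Complex.ofReal_re]

theorem le_eigenvalues_bdiag_covMatrix (hy : IsIndepGaussianSeries P y)
    {S : ℕ → ℝ → ℝ} (hS : IsSpectralDensity P y S) {smin smax : ℝ}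
    (hmin : ∀ m, ∀ ν ∈ Set.Icc (0 : ℝ) 1, smin ≤ S m ν)
    (hmax : ∀ m, ∀ ν ∈ Set.Icc (0 : ℝ) 1, S m ν ≤ smax) (M L : ℕ) (i : Fin M × Fin L) :
    smin ≤ (isHermitian_bdiag_covMatrix (P := P) (y := y) M L).eigenvalues i := by
  set h := isHermitian_bdiag_covMatrix (P := P) (y := y) M L
  have hτ : Function.Injective fun l : Fin L => 1 + ((l : ℕ) : ℤ) := fun a b h => by
    simpa [Fin.ext_iff] using h
  set x := h.eigenvectorBasis i with hx
  have hnorm : ∑ m : Fin M, ∑ l : Fin L, ‖x (m, l)‖ ^ 2 = 1 := by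
    have := EuclideanSpace.norm_sq_eq x
    rw [h.eigenvectorBasis.orthonormal.1 i, one_pow, Fintype.sum_prod_type] at this
    exact this.symm
  rw [h.eigenvalues_eq i]
  change smin ≤ (star ⇑x ⬝ᵥ (bdiag (covMatrix P y M L)) *ᵥ ⇑x).re
  rw [re_dotProduct_bdiag_covMatrix hy, ← mul_one smin, ← hnorm, Finset.mul_sum]
  refine Finset.sum_le_sum fun m _ => ?_
  have := (hy.integral_norm_sq_sum_mem_Icc hS hmin hmax m hτ fun l => conj (x (m, l))).1
  simpa using this

theorem norm_invSqrt_le {I : Type*} [Fintype I] [DecidableEq I] {B : Matrix I I ℂ}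
    (hB : B.IsHermitian) {s : ℝ} (hs : 0 < s) (h : ∀ i, s ≤ hB.eigenvalues i) :
    ‖invSqrt B‖ ≤ (√s)⁻¹ := by
  rw [invSqrt, hB.cfc_eq, Matrix.IsHermitian.cfc, Unitary.conjStarAlgAut_apply]
  have hd : ‖Matrix.diagonal (RCLike.ofReal ∘ (fun t : ℝ => (√t)⁻¹) ∘ hB.eigenvalues : I → ℂ)‖
      ≤ (√s)⁻¹ := by
    rw [Matrix.l2_opNorm_diagonal, pi_norm_le_iff_of_nonneg (by positivity)]
    intro i
    have h1 : 0 < √s := Real.sqrt_pos.2 hs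
    simp only [Function.comp_apply]
    rw [RCLike.norm_ofReal, abs_of_nonneg (by positivity)]
    exact inv_anti₀ h1 (Real.sqrt_le_sqrt (h i))
  refine (CStarRing.norm_mul_coe_unitary _ (star hB.eigenvectorUnitary)).trans_le ?_
  exact (CStarRing.norm_coe_unitary_mul _ _).trans_le hd

theorem isUnit_invSqrt {I : Type*} [Fintype I] [DecidableEq I] {B : Matrix I I ℂ}
    (hB : B.IsHermitian) {s : ℝ} (hs : 0 < s) (h : ∀ i, s ≤ hB.eigenvalues i) :
    IsUnit (invSqrt B) := by
  have hspec : ∀ t ∈ spectrum ℝ B, s ≤ t := by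
    intro t ht
    rw [hB.spectrum_real_eq_range_eigenvalues] at ht
    obtain ⟨i, rfl⟩ := ht
    exact h i
  have hcont : ContinuousOn (fun t : ℝ => (√t)⁻¹) (spectrum ℝ B) :=
    ContinuousOn.inv₀ (by fun_prop) fun t ht =>
      (Real.sqrt_pos.2 (hs.trans_le (hspec t ht))).ne'
  refine (isUnit_cfc_iff (fun t : ℝ => (√t)⁻¹) B hcont hB.isSelfAdjoint).2 fun t ht => ?_
  exact inv_ne_zero (Real.sqrt_pos.2 (hs.trans_le (hspec t ht))).ne'

/-- The whitened block Hankel matrix `W`, for which `W Wᴴ` is the correlation matrix. -/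
noncomputable def whitened (P : Measure Ω) (y : ℕ → ℤ → Ω → ℂ) (M L N : ℕ) :
    SeriesSpace M (N + L) →ₗ[ℝ] Matrix (Fin M × Fin L) (Fin N) ℂ where
  toFun g := ((√(N : ℝ))⁻¹ : ℂ) • (invSqrt (bdiag (covMatrix P y M L)) * hankel M L N g)
  map_add' g g' := by rw [map_add, Matrix.mul_add, smul_add]
  map_smul' t g := by
    rw [map_smul, Matrix.mul_smul, smul_comm]; rfl

theorem barCorr_eq (M L N : ℕ) (ω : Ω) : barCorr P y M L N ω =
    whitened P y M L N (seriesVector y M (N + L) ω) *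
      (whitened P y M L N (seriesVector y M (N + L) ω))ᴴ := by
  have h1 := isHermitian_invSqrt (bdiag (covMatrix P y M L))
  simp only [whitened, LinearMap.coe_mk, AddHom.coe_mk]
  rw [Matrix.conjTranspose_smul, Matrix.conjTranspose_mul, h1.eq, Matrix.smul_mul,
    Matrix.mul_smul, smul_smul, barCorr, sampleCov_eq, Matrix.mul_smul, Matrix.smul_mul]
  have h2 : ((√(N : ℝ))⁻¹ : ℂ) * star ((√(N : ℝ))⁻¹ : ℂ) = (N : ℂ)⁻¹ := by
    rw [RCLike.star_def, map_inv₀, Complex.conj_ofReal, ← mul_inv, ← Complex.ofReal_mul,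
      Real.mul_self_sqrt (Nat.cast_nonneg _)]
    simp
  rw [h2]
  simp only [Matrix.mul_assoc]

theorem frobSq_whitened_le {s : ℝ} {M L N : ℕ}
    (h : ‖invSqrt (bdiag (covMatrix P y M L))‖ ≤ s) (g : SeriesSpace M (N + L)) :
    frobSq (whitened P y M L N g) ≤ s ^ 2 * (L / N) * ‖g‖ ^ 2 := by
  simp only [whitened, LinearMap.coe_mk, AddHom.coe_mk]
  rw [frobSq_smul]
  have h1 : ‖((√(N : ℝ))⁻¹ : ℂ)‖ ^ 2 = (N : ℝ)⁻¹ := by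
    rw [norm_inv, Complex.norm_real, Real.norm_eq_abs, inv_pow, sq_abs,
      Real.sq_sqrt (Nat.cast_nonneg _)]
  rw [h1]
  have h2 := frobSq_mul_le (invSqrt (bdiag (covMatrix P y M L))) (hankel M L N g)
  have h3 : frobSq (invSqrt (bdiag (covMatrix P y M L)) * hankel M L N g)
      ≤ s ^ 2 * (L * ‖g‖ ^ 2) :=
    h2.trans (mul_le_mul (pow_le_pow_left₀ (norm_nonneg _) h 2) (frobSq_hankel_le M L N g)
      (frobSq_nonneg _) (by positivity))
  calc _ ≤ (N : ℝ)⁻¹ * (s ^ 2 * (L * ‖g‖ ^ 2)) := mul_le_mul_of_nonneg_left h3 (by positivity)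
    _ = _ := by ring

theorem eigenvalues_congr {I : Type*} [Fintype I] [DecidableEq I] {A B : Matrix I I ℂ}
    (hA : A.IsHermitian) (hB : B.IsHermitian) (h : A = B) : hA.eigenvalues = hB.eigenvalues := by
  subst h; rfl

theorem barPhi_eq (M L N : ℕ) (φ : ℝ → ℝ) (ω : Ω) : barPhi P y M L N φ ω =
    linStat φ (whitened P y M L N (seriesVector y M (N + L) ω)) := by
  rw [barPhi, linStat, eigenvalues_congr _ (isHermitian_mul_conjTranspose _) (barCorr_eq (P := P) (y := y) M L N ω)]
  simp

theorem specNorm_barCorr_eq (M L N : ℕ) (ω : Ω) : specNorm (barCorr P y M L N ω) =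
    ‖whitened P y M L N (seriesVector y M (N + L) ω) *
      (whitened P y M L N (seriesVector y M (N + L) ω))ᴴ‖ := by
  rw [barCorr_eq]; rfl

end Model

end BlockCorr

/-! ### Nets, Gaussian tails and the discrete Fourier transform -/

namespace BlockCorr

section Nets

open scoped Matrix

/-- A maximal `1`-separated subset of the ball of radius `2` is a net of the sphere of radius `2`, and
has at most `5 ^ d` elements. -/
theorem exists_finset_net_sphere (E : Type*) [NormedAddCommGroup E]
    [InnerProductSpace ℂ E] [FiniteDimensional ℝ E] :
    ∃ s : Finset E, s.card ≤ 5 ^ Module.finrank ℝ E ∧ (∀ x ∈ s, ‖x‖ ≤ 2) ∧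
      ∀ x : E, ‖x‖ = 2 → ∃ z ∈ s, ‖x - z‖ ≤ 1 := by
  classical
  let p : ℕ → Prop := fun n => ∃ s : Finset E, s.card = n ∧ (∀ x ∈ s, ‖x‖ ≤ 2) ∧
    ∀ c ∈ s, ∀ d ∈ s, c ≠ d → 1 ≤ ‖c - d‖
  have hp0 : p 0 := ⟨∅, by simp⟩
  have hbd : ∀ s : Finset E, (∀ x ∈ s, ‖x‖ ≤ 2) → (∀ c ∈ s, ∀ d ∈ s, c ≠ d → 1 ≤ ‖c - d‖) →
      s.card ≤ 5 ^ Module.finrank ℝ E := fun s h1 h2 =>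
    Besicovitch.card_le_of_separated s h1 h2
  obtain ⟨s, hcard, hs1, hs2⟩ := Nat.findGreatest_spec (P := p) (Nat.zero_le
    (5 ^ Module.finrank ℝ E)) hp0
  refine ⟨s, hbd s hs1 hs2, hs1, fun x hx => ?_⟩
  by_contra! hcon
  have hxs : x ∉ s := fun h => by
    have := hcon x h
    simp at this
    linarith
  have hins1 : ∀ z ∈ insert x s, ‖z‖ ≤ 2 := by
    intro z hz
    rcases Finset.mem_insert.1 hz with rfl | hz
    · exact hx.le
    · exact hs1 z hz
  have hins2 : ∀ c ∈ insert x s, ∀ d ∈ insert x s, c ≠ d → 1 ≤ ‖c - d‖ := by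
    intro c hc d hd hcd
    rcases Finset.mem_insert.1 hc with rfl | hc' <;> rcases Finset.mem_insert.1 hd with rfl | hd'
    · exact absurd rfl hcd
    · exact (hcon d hd').le
    · rw [norm_sub_rev]; exact (hcon c hc').le
    · exact hs2 c hc' d hd' hcd
  have hle := Nat.le_findGreatest (P := p) (hbd _ hins1 hins2) ⟨_, rfl, hins1, hins2⟩
  rw [Finset.card_insert_of_notMem hxs, hcard] at hle
  omega

theorem norm_two_div_norm_smul {G : Type*} [NormedAddCommGroup G] [NormedSpace ℂ G] {x : G}
    (hx : x ≠ 0) : ‖((2 / ‖x‖ : ℝ) : ℂ) • x‖ = 2 := by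
  have : 0 < ‖x‖ := norm_pos_iff.2 hx
  rw [norm_smul, Complex.norm_real, Real.norm_eq_abs, abs_of_pos (by positivity)]
  field_simp

/-- On nets of the spheres of radius `2` the bilinear form detects the operator norm without loss:
moving a unit distance from a vector of norm `2` loses at most half of what it gives. -/
theorem opNorm_le_of_forall_re_inner_le {E F : Type*} [NormedAddCommGroup E]
    [InnerProductSpace ℂ E] [NormedAddCommGroup F] [InnerProductSpace ℂ F]
    {s : Finset E} {s' : Finset F} (hs : ∀ x : E, ‖x‖ = 2 → ∃ z ∈ s, ‖x - z‖ ≤ 1)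
    (hs' : ∀ x : F, ‖x‖ = 2 → ∃ z ∈ s', ‖x - z‖ ≤ 1) (T : E →L[ℂ] F) {t : ℝ} (ht : 0 ≤ t)
    (h : ∀ u ∈ s', ∀ v ∈ s, (inner ℂ u (T v)).re ≤ t) : ‖T‖ ≤ t := by
  have h1 : ∀ v ∈ s, ‖T v‖ ≤ t := by
    intro v hv
    by_cases hw : T v = 0
    · rwa [hw, norm_zero]
    set w := T v with hwdef
    have hwpos : 0 < ‖w‖ := norm_pos_iff.2 hw
    obtain ⟨z, hz, hxz⟩ := hs' _ (norm_two_div_norm_smul hw)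
    have h2 : (inner ℂ (((2 / ‖w‖ : ℝ) : ℂ) • w) w).re = 2 * ‖w‖ := by
      rw [inner_smul_left, Complex.conj_ofReal, inner_self_eq_norm_sq_to_K, Complex.re_ofReal_mul]
      have : (((‖w‖ : ℂ)) ^ 2).re = ‖w‖ ^ 2 := by rw [← Complex.ofReal_pow, Complex.ofReal_re]
      simp only [Complex.coe_algebraMap, this]
      field_simp
    have h3 : (inner ℂ (((2 / ‖w‖ : ℝ) : ℂ) • w - z) w).re ≤ ‖w‖ :=
      (Complex.re_le_norm _).trans ((norm_inner_le_norm _ _).trans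
        (mul_le_of_le_one_left (norm_nonneg _) hxz))
    rw [inner_sub_left, Complex.sub_re, h2] at h3
    linarith [h z hz v hv]
  have h2 : ‖T‖ ≤ (t + ‖T‖) / 2 := by
    refine T.opNorm_le_bound (by positivity) fun x => ?_
    by_cases hx : x = 0
    · simp [hx]
    have hxpos : 0 < ‖x‖ := norm_pos_iff.2 hx
    obtain ⟨z, hz, hxz⟩ := hs _ (norm_two_div_norm_smul hx)
    have h3 : ‖T (((2 / ‖x‖ : ℝ) : ℂ) • x)‖ ≤ t + ‖T‖ := by
      calc _ = ‖T z + T (((2 / ‖x‖ : ℝ) : ℂ) • x - z)‖ := by rw [← map_add]; congr 2; abel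
        _ ≤ ‖T z‖ + ‖T (((2 / ‖x‖ : ℝ) : ℂ) • x - z)‖ := norm_add_le _ _
        _ ≤ t + ‖T‖ * 1 := add_le_add (h1 z hz) ((T.le_opNorm _).trans
            (mul_le_mul_of_nonneg_left hxz (norm_nonneg _)))
        _ = _ := by rw [mul_one]
    rw [map_smul, norm_smul, Complex.norm_real, Real.norm_eq_abs, abs_of_pos (by positivity)] at h3
    rw [div_mul_eq_mul_div, le_div_iff₀ two_pos]
    rw [div_mul_eq_mul_div, div_le_iff₀ hxpos] at h3
    linarith
  linarith

variable {I J : Type*} [Fintype I] [Fintype J] [DecidableEq J]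

theorem inner_toEuclideanLin (G : Matrix I J ℂ) (u : EuclideanSpace ℂ I) (v : EuclideanSpace ℂ J) :
    inner ℂ u (Matrix.toEuclideanLin G v) = ∑ i, ∑ j, conj (u i) * v j * G i j := by
  rw [PiLp.inner_apply]
  refine Finset.sum_congr rfl fun i _ => ?_
  rw [RCLike.inner_apply, Matrix.ofLp_toLpLin, Matrix.toLin'_apply, Matrix.mulVec, dotProduct,
    Finset.sum_mul]
  exact Finset.sum_congr rfl fun j _ => by ring

theorem norm_sum_mul_le_of_forall_re_le (G : Matrix I J ℂ) {s : Finset (EuclideanSpace ℂ J)}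
    {s' : Finset (EuclideanSpace ℂ I)} (hs : ∀ x, ‖x‖ = 2 → ∃ z ∈ s, ‖x - z‖ ≤ 1)
    (hs' : ∀ x, ‖x‖ = 2 → ∃ z ∈ s', ‖x - z‖ ≤ 1) {t : ℝ} (ht : 0 ≤ t)
    (h : ∀ u ∈ s', ∀ v ∈ s, (∑ i, ∑ j, conj (u i) * v j * G i j).re ≤ t)
    (u : I → ℂ) (v : J → ℂ) :
    ‖∑ i, ∑ j, u i * v j * G i j‖ ≤ t * (√(∑ i, ‖u i‖ ^ 2) * √(∑ j, ‖v j‖ ^ 2)) := by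
  set T : EuclideanSpace ℂ J →L[ℂ] EuclideanSpace ℂ I :=
    LinearMap.toContinuousLinearMap (Matrix.toEuclideanLin G) with hT
  have hTn : ‖T‖ ≤ t := opNorm_le_of_forall_re_inner_le hs hs' T ht fun u hu v hv => by
    have := h u hu v hv
    rwa [← inner_toEuclideanLin] at this
  have h1 := inner_toEuclideanLin G (WithLp.toLp 2 fun i => conj (u i)) (WithLp.toLp 2 v)
  simp only [Complex.conj_conj] at h1
  rw [← h1]
  refine (norm_inner_le_norm _ _).trans ?_
  have h2 := T.le_opNorm (WithLp.toLp 2 v)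
  rw [EuclideanSpace.norm_eq] 
  have h3 : ‖(WithLp.toLp 2 v : EuclideanSpace ℂ J)‖ = √(∑ j, ‖v j‖ ^ 2) :=
    EuclideanSpace.norm_eq _
  rw [h3] at h2
  simp only [RCLike.norm_conj]
  calc _ ≤ √(∑ i, ‖u i‖ ^ 2) * (‖T‖ * √(∑ j, ‖v j‖ ^ 2)) :=
        mul_le_mul_of_nonneg_left h2 (Real.sqrt_nonneg _)
    _ ≤ √(∑ i, ‖u i‖ ^ 2) * (t * √(∑ j, ‖v j‖ ^ 2)) := by gcongr
    _ = _ := by ring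

open scoped Matrix.Norms.L2Operator in
theorem l2_opNorm_le_of_forall_norm_sum_le [DecidableEq I] (G : Matrix I J ℂ) {c : ℝ} (hc : 0 ≤ c)
    (h : ∀ (u : I → ℂ) (v : J → ℂ), ‖∑ i, ∑ j, u i * v j * G i j‖
      ≤ c * (√(∑ i, ‖u i‖ ^ 2) * √(∑ j, ‖v j‖ ^ 2))) : ‖G‖ ≤ c := by
  rw [Matrix.l2_opNorm_def]
  refine ContinuousLinearMap.opNorm_le_bound _ hc fun v => ?_
  set w := Matrix.toEuclideanLin G v with hw
  change ‖w‖ ≤ c * ‖v‖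
  have h1 := h (fun i => conj (w i)) v
  rw [← inner_toEuclideanLin, ← hw, inner_self_eq_norm_sq_to_K] at h1
  simp only [RCLike.norm_conj, ← EuclideanSpace.norm_eq] at h1
  rw [norm_pow, RCLike.norm_ofReal, abs_norm] at h1
  by_cases h0 : ‖w‖ = 0
  · rw [h0]; positivity
  · have h0' : 0 < ‖w‖ := lt_of_le_of_ne (norm_nonneg _) (Ne.symm h0)
    nlinarith

end Nets

section Tail

variable {Ω : Type*} [MeasurableSpace Ω] {P : Measure Ω}

theorem measure_gt_le_of_map_eq_gaussianReal [IsProbabilityMeasure P] {X : Ω → ℝ}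
    (hX : Measurable X) {v : ℝ≥0} (h : P.map X = gaussianReal 0 v) {σ : ℝ} (hσ : 0 < σ)
    (hv : (v : ℝ) ≤ σ) {t : ℝ} (ht : 0 ≤ t) :
    P.real {ω | t < X ω} ≤ Real.exp (-(t ^ 2 / (2 * σ))) := by
  have h1 : P.real {ω | t < X ω} ≤ (gaussianReal 0 v).real (Set.Ici t) := by
    rw [← h, map_measureReal_apply hX measurableSet_Ici]
    exact measureReal_mono fun ω (hω : t < X ω) => hω.le
  refine h1.trans ((measure_ge_le_exp_mul_mgf (X := id) t (t := t / σ) (by positivity)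
    (integrable_exp_mul_gaussianReal _)).trans ?_)
  rw [mgf_id_gaussianReal, ← Real.exp_add]
  refine Real.exp_le_exp.2 ?_
  have : (v : ℝ) * (t / σ) ^ 2 / 2 ≤ σ * (t / σ) ^ 2 / 2 := by gcongr
  have e : -(t / σ) * t + σ * (t / σ) ^ 2 / 2 = -(t ^ 2 / (2 * σ)) := by field_simp; ring
  simp only [zero_mul, zero_add]
  linarith

end Tail

section Fourier

variable {K : ℕ} [NeZero K]

/-- Orthogonality of the characters of `ℤ / K`. -/
theorem sum_stdAddChar_mul (a b : ℕ) (ha : a < K) (hb : b < K) :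
    ∑ ν : ZMod K, ZMod.stdAddChar (ν * (a : ZMod K)) * ZMod.stdAddChar (-(ν * (b : ZMod K)))
      = if a = b then (K : ℂ) else 0 := by
  have h1 : ∀ ν : ZMod K, ZMod.stdAddChar (ν * (a : ZMod K)) * ZMod.stdAddChar (-(ν * (b : ZMod K)))
      = ZMod.stdAddChar (ν * ((a : ZMod K) - (b : ZMod K))) := fun ν => by
    rw [← AddChar.map_add_eq_mul, mul_sub, sub_eq_add_neg]
  simp only [h1]
  rw [AddChar.sum_mulShift _ (ZMod.isPrimitive_stdAddChar K)]
  have h2 : ((a : ZMod K) - (b : ZMod K) = 0) ↔ a = b := by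
    rw [sub_eq_zero, ZMod.natCast_eq_natCast_iff', Nat.mod_eq_of_lt ha, Nat.mod_eq_of_lt hb]
  simp only [h2, ZMod.card]
  split_ifs <;> simp

/-- Parseval's identity for the discrete Fourier transform. -/
theorem sum_norm_sq_stdAddChar {L : ℕ} (hL : L ≤ K) (u : Fin L → ℂ) :
    ∑ ν : ZMod K, ‖∑ l : Fin L, u l * ZMod.stdAddChar (ν * ((l : ℕ) : ZMod K))‖ ^ 2
      = K * ∑ l, ‖u l‖ ^ 2 := by
  have h : ((∑ ν : ZMod K, ‖∑ l : Fin L, u l * ZMod.stdAddChar (ν * ((l : ℕ) : ZMod K))‖ ^ 2 : ℝ)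
      : ℂ) = ((K * ∑ l, ‖u l‖ ^ 2 : ℝ) : ℂ) := by
    rw [Complex.ofReal_sum]
    simp only [norm_sq_sum_mul, ← AddChar.map_neg_eq_conj]
    rw [Finset.sum_comm, Complex.ofReal_mul, Complex.ofReal_sum, Complex.ofReal_natCast,
      Finset.mul_sum]
    refine Finset.sum_congr rfl fun l _ => ?_
    rw [Finset.sum_comm, Finset.sum_eq_single l]
    · rw [← Finset.mul_sum, sum_stdAddChar_mul _ _ (by omega) (by omega), if_pos rfl,
        Complex.mul_conj, Complex.normSq_eq_norm_sq]
      ring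
    · intro l' _ hl'
      rw [← Finset.mul_sum, sum_stdAddChar_mul _ _ (by omega) (by omega), if_neg, mul_zero]
      intro h
      exact hl' (Fin.ext h.symm)
    · simp
  exact_mod_cast h

/-- The correlation of `u`, `v` and `z` through the discrete Fourier transform. The indices `j + l`
stay below `K = 2 L`, so that there is no wrap-around. -/
theorem sum_stdAddChar_mul_mul {L : ℕ} (hK : K = 2 * L) (u v : Fin L → ℂ) (z : ℕ → ℂ) :
    ∑ ν : ZMod K, (∑ l : Fin L, u l * ZMod.stdAddChar (ν * ((l : ℕ) : ZMod K))) *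
        (∑ j : Fin L, v j * ZMod.stdAddChar (ν * ((j : ℕ) : ZMod K))) *
        (∑ k ∈ Finset.range K, z k * ZMod.stdAddChar (-(ν * (k : ZMod K))))
      = K * ∑ l : Fin L, ∑ j : Fin L, u l * v j * z (j + l) := by
  have h1 : ∀ ν : ZMod K, (∑ l : Fin L, u l * ZMod.stdAddChar (ν * ((l : ℕ) : ZMod K))) *
        (∑ j : Fin L, v j * ZMod.stdAddChar (ν * ((j : ℕ) : ZMod K))) *
        (∑ k ∈ Finset.range K, z k * ZMod.stdAddChar (-(ν * (k : ZMod K))))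
      = ∑ l : Fin L, ∑ j : Fin L, ∑ k ∈ Finset.range K, u l * v j * z k *
        (ZMod.stdAddChar (ν * ((j + l : ℕ) : ZMod K)) *
          ZMod.stdAddChar (-(ν * (k : ZMod K)))) := by
    intro ν
    rw [Finset.sum_mul_sum, Finset.sum_mul]
    refine Finset.sum_congr rfl fun l _ => ?_
    rw [Finset.sum_mul]
    refine Finset.sum_congr rfl fun j _ => ?_
    rw [Finset.mul_sum]
    refine Finset.sum_congr rfl fun k _ => ?_
    rw [Nat.cast_add, mul_add, AddChar.map_add_eq_mul]
    ring
  simp only [h1]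
  rw [Finset.sum_comm, Finset.mul_sum]
  refine Finset.sum_congr rfl fun l _ => ?_
  rw [Finset.sum_comm, Finset.mul_sum]
  refine Finset.sum_congr rfl fun j _ => ?_
  rw [Finset.sum_comm, Finset.sum_eq_single (j + l : ℕ)]
  · rw [← Finset.mul_sum, sum_stdAddChar_mul _ _ (by omega) (by omega), if_pos rfl]
    ring
  · intro k hk hne
    rw [← Finset.mul_sum, sum_stdAddChar_mul _ _ (by omega) (Finset.mem_range.1 hk),
      if_neg hne.symm, mul_zero]
  · intro h
    exact absurd (Finset.mem_range.2 (by omega)) h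

end Fourier

end BlockCorr

/-! ### The norm of the sample covariance matrix -/

namespace BlockCorr

section BlockTransform

/-- The Fourier transforms at frequency `ν`, over the non-overlapping windows
`[(b + o) L, (b + o + 1) L)` of length `L`, of the rows of `z`. -/
noncomputable def windowDFT {M K : ℕ} (z : Fin M → ℕ → ℂ) (L Q o : ℕ) (ν : ZMod K) [NeZero K] :
    Matrix (Fin M) (Fin Q) ℂ :=
  Matrix.of fun m b => ∑ k : Fin L, z m (k + L * (b + o)) *
    ZMod.stdAddChar (-(ν * ((k : ℕ) : ZMod K)))

/-- A window of length `2 L` is the union of two adjacent windows of length `L`. -/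
theorem sum_range_eq_windowDFT {M K L Q : ℕ} [NeZero K] (hK : K = 2 * L) (z : Fin M → ℕ → ℂ)
    (ν : ZMod K) (m : Fin M) (b : Fin Q) :
    ∑ k ∈ Finset.range K, z m (k + L * b) * ZMod.stdAddChar (-(ν * (k : ZMod K)))
      = windowDFT z L Q 0 ν m b
        + ZMod.stdAddChar (-(ν * (L : ZMod K))) * windowDFT z L Q 1 ν m b := by
  have hK' : Finset.range K = Finset.range (L + L) := by rw [hK, two_mul]
  rw [hK', Finset.sum_range_add, windowDFT, windowDFT, Matrix.of_apply, Matrix.of_apply,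
    ← Fin.sum_univ_eq_sum_range (fun k => z m (k + L * b) * ZMod.stdAddChar (-(ν * (k : ZMod K)))),
    ← Fin.sum_univ_eq_sum_range (fun k => z m (L + k + L * b) *
      ZMod.stdAddChar (-(ν * ((L + k : ℕ) : ZMod K)))), Finset.mul_sum]
  congr 1
  refine Finset.sum_congr rfl fun k _ => ?_
  have e : L + (k : ℕ) + L * b = k + L * (b + 1) := by ring
  rw [e, Nat.cast_add, mul_add ν, neg_add, AddChar.map_add_eq_mul]
  ring

/-- The bilinear form of a block Hankel matrix is an average over the frequencies of bilinear forms
of `M × Q` matrices, `M` being the number of series and `Q` the number of windows. The columns are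
indexed by the windows `b` and the positions `j` in the window. -/
theorem norm_sum_hankel_le {M L Q K : ℕ} [NeZero K] (hK : K = 2 * L) (z : Fin M → ℕ → ℂ) {B : ℝ}
    (hB : 0 ≤ B)
    (h : ∀ (o : Fin 2) (ν : ZMod K) (u : Fin M → ℂ) (v : Fin Q → ℂ),
      ‖∑ m, ∑ b, u m * v b * windowDFT z L Q o ν m b‖
        ≤ B * (√(∑ m, ‖u m‖ ^ 2) * √(∑ b, ‖v b‖ ^ 2)))
    (u : Fin M × Fin L → ℂ) (v : Fin Q × Fin L → ℂ) :
    ‖∑ p, ∑ q, u p * v q * z p.1 (q.2 + L * q.1 + p.2)‖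
      ≤ 2 * B * (√(∑ p, ‖u p‖ ^ 2) * √(∑ q, ‖v q‖ ^ 2)) := by
  set U : ZMod K → Fin M → ℂ := fun ν m =>
    ∑ l : Fin L, u (m, l) * ZMod.stdAddChar (ν * ((l : ℕ) : ZMod K)) with hU
  set V : ZMod K → Fin Q → ℂ := fun ν b =>
    ∑ j : Fin L, v (b, j) * ZMod.stdAddChar (ν * ((j : ℕ) : ZMod K)) with hV
  have hKpos : (0 : ℝ) < K := Nat.cast_pos.2 (NeZero.pos K)
  have hLK : L ≤ K := by omega
  have hUsum : ∑ ν, ∑ m, ‖U ν m‖ ^ 2 = K * ∑ p, ‖u p‖ ^ 2 := by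
    rw [Finset.sum_comm, Fintype.sum_prod_type, Finset.mul_sum]
    exact Finset.sum_congr rfl fun m _ => sum_norm_sq_stdAddChar hLK fun l => u (m, l)
  have hVsum : ∑ ν, ∑ b, ‖V ν b‖ ^ 2 = K * ∑ q, ‖v q‖ ^ 2 := by
    rw [Finset.sum_comm, Fintype.sum_prod_type, Finset.mul_sum]
    exact Finset.sum_congr rfl fun b _ => sum_norm_sq_stdAddChar hLK fun j => v (b, j)
  have hid : (K : ℂ) * ∑ p, ∑ q, u p * v q * z p.1 (q.2 + L * q.1 + p.2)
      = ∑ ν, (∑ m, ∑ b, U ν m * V ν b * windowDFT z L Q 0 ν m b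
        + ZMod.stdAddChar (-(ν * (L : ZMod K))) *
          ∑ m, ∑ b, U ν m * V ν b * windowDFT z L Q 1 ν m b) := by
    have h1 : ∀ ν, (∑ m, ∑ b, U ν m * V ν b * windowDFT z L Q 0 ν m b
        + ZMod.stdAddChar (-(ν * (L : ZMod K))) *
          ∑ m, ∑ b, U ν m * V ν b * windowDFT z L Q 1 ν m b)
        = ∑ m, ∑ b : Fin Q, U ν m * V ν b * ∑ k ∈ Finset.range K, z m (k + L * b) *
          ZMod.stdAddChar (-(ν * (k : ZMod K))) := by
      intro ν
      simp only [sum_range_eq_windowDFT hK]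
      simp only [mul_add, Finset.sum_add_distrib, Finset.mul_sum]
      congr 1
      refine Finset.sum_congr rfl fun m _ => Finset.sum_congr rfl fun b _ => ?_
      ring
    simp only [h1]
    rw [Fintype.sum_prod_type, Finset.mul_sum]
    symm
    rw [Finset.sum_comm]
    refine Finset.sum_congr rfl fun m _ => ?_
    rw [Finset.sum_comm]
    simp only [hU, hV]
    have h2 : ∀ b : Fin Q, _ := fun b => sum_stdAddChar_mul_mul hK (fun l => u (m, l))
      (fun j => v (b, j)) (fun k => z m (k + L * b))
    simp only [h2]
    rw [← Finset.mul_sum]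
    congr 1
    rw [Finset.sum_comm]
    refine Finset.sum_congr rfl fun l _ => ?_
    rw [Fintype.sum_prod_type]
    refine Finset.sum_congr rfl fun b _ => Finset.sum_congr rfl fun j _ => ?_
    congr 2
    ring
  have hbound : ‖(K : ℂ) * ∑ p, ∑ q, u p * v q * z p.1 (q.2 + L * q.1 + p.2)‖
      ≤ 2 * B * (√(K * ∑ p, ‖u p‖ ^ 2) * √(K * ∑ q, ‖v q‖ ^ 2)) := by
    rw [hid, ← hUsum, ← hVsum]
    calc _ ≤ ∑ ν, 2 * B * (√(∑ m, ‖U ν m‖ ^ 2) * √(∑ b, ‖V ν b‖ ^ 2)) := by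
          refine norm_sum_le_of_le _ fun ν _ => (norm_add_le _ _).trans ?_
          rw [norm_mul, AddChar.norm_apply, one_mul]
          have h0 := h 0 ν (U ν) (V ν)
          have h1 := h 1 ν (U ν) (V ν)
          simp only [Fin.val_zero, Fin.val_one] at h0 h1
          linarith
      _ = 2 * B * ∑ ν, (√(∑ m, ‖U ν m‖ ^ 2) * √(∑ b, ‖V ν b‖ ^ 2)) := by rw [Finset.mul_sum]
      _ ≤ _ := by
          refine mul_le_mul_of_nonneg_left ?_ (by positivity)
          exact Real.sum_sqrt_mul_sqrt_le _ (fun _ => by positivity) (fun _ => by positivity)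
  rw [norm_mul, Complex.norm_natCast, Real.sqrt_mul hKpos.le, Real.sqrt_mul hKpos.le] at hbound
  have h3 : √(K : ℝ) * √(K : ℝ) = K := Real.mul_self_sqrt hKpos.le
  refine le_of_mul_le_mul_left (hbound.trans (le_of_eq ?_)) hKpos
  linear_combination (2 * B * √(∑ p, ‖u p‖ ^ 2) * √(∑ q, ‖v q‖ ^ 2)) * h3

/-- Sums over the windows and the positions in the window, of terms that vanish from `N` on. -/
theorem sum_fin_prod_eq_sum_fin {R : Type*} [AddCommMonoid R] {Q L N : ℕ} (hN : N ≤ Q * L)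
    (F : ℕ → R) (hF : ∀ i, N ≤ i → F i = 0) :
    ∑ q : Fin Q × Fin L, F (q.2 + L * q.1) = ∑ n : Fin N, F n := by
  have h1 : ∑ q : Fin Q × Fin L, F (q.2 + L * q.1) = ∑ i : Fin (Q * L), F i :=
    Fintype.sum_equiv finProdFinEquiv _ _ fun q => by simp [finProdFinEquiv_apply_val]
  rw [h1, Fin.sum_univ_eq_sum_range F, Fin.sum_univ_eq_sum_range F]
  refine (Finset.sum_subset (Finset.range_mono hN) fun i _ hi => hF i ?_).symm
  simpa using hi

end BlockTransform

section NormTail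

open scoped Matrix Matrix.Norms.L2Operator

variable {Ω : Type*} [MeasurableSpace Ω] {P : Measure Ω} {y : ℕ → ℤ → Ω → ℂ}

theorem norm_hankel_le {Ω' : Type*} (y : ℕ → ℤ → Ω' → ℂ) {M L N Q K : ℕ} [NeZero K]
    (hK : K = 2 * L) (hQ : N ≤ Q * L) (ω : Ω') {B : ℝ} (hB : 0 ≤ B)
    (h : ∀ (o : Fin 2) (ν : ZMod K) (u : Fin M → ℂ) (v : Fin Q → ℂ),
      ‖∑ m, ∑ b, u m * v b *
        windowDFT (fun (m : Fin M) s => y m (1 + (s : ℤ)) ω) L Q o ν m b‖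
        ≤ B * (√(∑ m, ‖u m‖ ^ 2) * √(∑ b, ‖v b‖ ^ 2))) :
    ‖hankel M L N (seriesVector y M (N + L) ω)‖ ≤ 2 * B := by
  refine l2_opNorm_le_of_forall_norm_sum_le _ (by positivity) fun u v => ?_
  set v' : ℕ → ℂ := fun i => if hi : i < N then v ⟨i, hi⟩ else 0 with hv'
  have hv'0 : ∀ i, N ≤ i → v' i = 0 := fun i hi => dif_neg (not_lt.2 hi)
  have hv'1 : ∀ n : Fin N, v' n = v n := fun n => dif_pos n.2
  have h1 := norm_sum_hankel_le hK (fun (m : Fin M) s => y m (1 + (s : ℤ)) ω) hB h u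
    fun q : Fin Q × Fin L => v' (q.2 + L * q.1)
  rw [sum_fin_prod_eq_sum_fin hQ (fun i => ‖v' i‖ ^ 2) fun i hi => by simp [hv'0 i hi]] at h1
  have h2 : ∀ p : Fin M × Fin L, ∑ q : Fin Q × Fin L, u p * v' (q.2 + L * q.1) *
      y p.1 (1 + ((q.2 + L * q.1 + p.2 : ℕ) : ℤ)) ω
      = ∑ n : Fin N, u p * v' n * y p.1 (1 + ((n + p.2 : ℕ) : ℤ)) ω := fun p =>
    sum_fin_prod_eq_sum_fin hQ (fun i => u p * v' i * y p.1 (1 + ((i + p.2 : ℕ) : ℤ)) ω)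
      fun i hi => by simp [hv'0 i hi]
  simp only [h2, hv'1] at h1
  convert h1 using 6 with p _ n _
  rw [hankel_seriesVector_apply, lagVector]
  congr 1
  push_cast
  ring

/-- Exponential tail of the norm of the sample covariance matrix: a union bound over the `4 L`
matrices `windowDFT` and over nets of the spheres of `ℂ^M` and `ℂ^Q`. The windows being disjoint,
the bilinear forms there are Gaussian with variance at most `8 smax L`. -/
theorem measure_norm_sampleCov_gt_le [IsProbabilityMeasure P] (hy : IsIndepGaussianSeries P y)
    {S : ℕ → ℝ → ℝ} (hS : IsSpectralDensity P y S) {smin smax : ℝ}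
    (hmin : ∀ m, ∀ ν ∈ Set.Icc (0 : ℝ) 1, smin ≤ S m ν)
    (hmax : ∀ m, ∀ ν ∈ Set.Icc (0 : ℝ) 1, S m ν ≤ smax) (hpos : 0 < smax)
    {M L N : ℕ} (hL : 0 < L) (hN : 0 < N) {x : ℝ} (hx : 0 ≤ x) :
    P.real {ω | x < ‖sampleCov y M L N ω‖} ≤
      4 * L * 25 ^ (M + (N / L + 1)) * Real.exp (-(N * x / (64 * smax * L))) := by
  set Q := N / L + 1 with hQdef
  have hQ : N ≤ Q * L := by
    rw [hQdef]
    have := Nat.div_add_mod N L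
    have := Nat.mod_lt N hL
    nlinarith
  have : NeZero (2 * L) := ⟨by omega⟩
  obtain ⟨s', hs'card, hs'2, hs'⟩ := exists_finset_net_sphere (EuclideanSpace ℂ (Fin M))
  obtain ⟨s, hscard, hs2, hs⟩ := exists_finset_net_sphere (EuclideanSpace ℂ (Fin Q))
  set t := √(N * x) / 2 with ht
  let Z : Ω → Fin M → ℕ → ℂ := fun ω m r => y m (1 + (r : ℤ)) ω
  let X : ((Fin 2 × ZMod (2 * L)) × (EuclideanSpace ℂ (Fin M) × EuclideanSpace ℂ (Fin Q))) →
    Ω → ℝ := fun i ω => (∑ m, ∑ b, conj (i.2.1 m) * i.2.2 b *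
      windowDFT (Z ω) L Q i.1.1 i.1.2 m b).re
  have hsub : {ω | x < ‖sampleCov y M L N ω‖} ⊆
      ⋃ i ∈ (Finset.univ : Finset (Fin 2 × ZMod (2 * L))) ×ˢ (s' ×ˢ s), {ω | t < X i ω} := by
    intro ω hω
    by_contra hcon
    simp only [Set.mem_iUnion, not_exists] at hcon
    have hle := norm_hankel_le y (M := M) rfl hQ ω (B := t) (by positivity) fun o ν =>
      norm_sum_mul_le_of_forall_re_le _ hs hs' (by positivity) fun u hu v hv =>
        not_lt.1 (hcon ((o, ν), (u, v)) (by simp [hu, hv]))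
    have hω' : x < ‖sampleCov y M L N ω‖ := hω
    rw [sampleCov_eq, norm_smul, norm_mul_conjTranspose, norm_inv, Complex.norm_natCast] at hω'
    have h1 : ‖hankel M L N (seriesVector y M (N + L) ω)‖ ^ 2 ≤ N * x := by
      calc _ ≤ (2 * t) ^ 2 := pow_le_pow_left₀ (norm_nonneg _) hle 2
        _ = N * x := by
          rw [ht, mul_div_cancel₀ _ (two_ne_zero), Real.sq_sqrt (by positivity)]
    have hN' : (0 : ℝ) < N := Nat.cast_pos.2 hN
    rw [inv_mul_eq_div, lt_div_iff₀ hN'] at hω'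
    linarith
  have hX : ∀ i ∈ (Finset.univ : Finset (Fin 2 × ZMod (2 * L))) ×ˢ (s' ×ˢ s),
      P.real {ω | t < X i ω} ≤ Real.exp (-(N * x / (64 * smax * L))) := by
    rintro ⟨⟨o, ν⟩, ⟨u, v⟩⟩ hi
    have hu : ‖u‖ ≤ 2 := hs'2 _ (by simp at hi; exact hi.1)
    have hv : ‖v‖ ≤ 2 := hs2 _ (by simp at hi; exact hi.2)
    have hτ : Function.Injective fun q : Fin Q × Fin L =>
        1 + (((q.2 : ℕ) + L * ((q.1 : ℕ) + o) : ℕ) : ℤ) := by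
      intro q q' hqq
      have h1 : (q.2 : ℕ) + L * ((q.1 : ℕ) + o) = q'.2 + L * ((q'.1 : ℕ) + o) := by
        exact_mod_cast add_left_cancel hqq
      have h2 : finProdFinEquiv q = finProdFinEquiv q' := by
        ext
        simp only [finProdFinEquiv_apply_val]
        nlinarith
      exact finProdFinEquiv.injective h2
    obtain ⟨w, hw, hmap⟩ := hy.exists_map_re_sum hS hmin hmax hτ fun (m : Fin M) q =>
      conj (u m) * v q.1 * ZMod.stdAddChar (-(ν * (((q.2 : ℕ)) : ZMod (2 * L))))
    have hXeq : X ((o, ν), (u, v)) = fun ω => (∑ m : Fin M, ∑ q : Fin Q × Fin L,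
        conj (u m) * v q.1 * ZMod.stdAddChar (-(ν * (((q.2 : ℕ)) : ZMod (2 * L)))) *
          y m (1 + (((q.2 : ℕ) + L * ((q.1 : ℕ) + o) : ℕ) : ℤ)) ω).re := by
      ext ω
      simp only [X, windowDFT, Matrix.of_apply, Z]
      congr 1
      refine Finset.sum_congr rfl fun m _ => ?_
      rw [Fintype.sum_prod_type]
      refine Finset.sum_congr rfl fun b _ => ?_
      rw [Finset.mul_sum]
      refine Finset.sum_congr rfl fun k _ => ?_
      ring
    have hXm : Measurable (X ((o, ν), (u, v))) := by
      rw [hXeq]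
      refine Complex.measurable_re.comp (Finset.measurable_fun_sum _ fun m _ =>
        Finset.measurable_fun_sum _ fun q _ => (hy.measurable _ _).const_mul _)
    have hsum : ∑ m : Fin M, ∑ q : Fin Q × Fin L, ‖conj (u m) * v q.1 *
        ZMod.stdAddChar (-(ν * (((q.2 : ℕ)) : ZMod (2 * L))))‖ ^ 2 ≤ 16 * L := by
      have h1 : ∑ m : Fin M, ∑ q : Fin Q × Fin L, ‖conj (u m) * v q.1 *
          ZMod.stdAddChar (-(ν * (((q.2 : ℕ)) : ZMod (2 * L))))‖ ^ 2 = ‖u‖ ^ 2 * ‖v‖ ^ 2 * L := by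
        rw [EuclideanSpace.norm_sq_eq, EuclideanSpace.norm_sq_eq, Finset.sum_mul_sum,
          Finset.sum_mul]
        refine Finset.sum_congr rfl fun m _ => ?_
        rw [Fintype.sum_prod_type, Finset.sum_mul]
        refine Finset.sum_congr rfl fun b _ => ?_
        simp [AddChar.norm_apply, mul_pow, mul_comm]
      rw [h1]
      have h2 : ‖u‖ ^ 2 ≤ 4 := by nlinarith [norm_nonneg u]
      have h3 : ‖v‖ ^ 2 ≤ 4 := by nlinarith [norm_nonneg v]
      have h4 : ‖u‖ ^ 2 * ‖v‖ ^ 2 ≤ 4 * 4 := mul_le_mul h2 h3 (by positivity) (by norm_num)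
      nlinarith [(Nat.cast_nonneg L : (0 : ℝ) ≤ L)]
    have hL' : (0 : ℝ) < L := Nat.cast_pos.2 hL
    rw [← hXeq] at hmap
    refine (measure_gt_le_of_map_eq_gaussianReal hXm hmap (σ := 8 * smax * L) (by positivity)
      ?_ (by positivity)).trans (Real.exp_le_exp.2 (neg_le_neg (le_of_eq ?_)))
    · refine hw.2.trans ?_
      calc _ ≤ smax / 2 * (16 * L) := mul_le_mul_of_nonneg_left hsum (by positivity)
        _ = _ := by ring
    · rw [ht, div_pow, Real.sq_sqrt (by positivity)]
      field_simp
      ring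
  have hcard : (((Finset.univ : Finset (Fin 2 × ZMod (2 * L))) ×ˢ (s' ×ˢ s)).card : ℝ)
      ≤ 4 * L * 25 ^ (M + Q) := by
    have e1 : Module.finrank ℝ (EuclideanSpace ℂ (Fin M)) = 2 * M := by
      rw [finrank_real_of_complex, finrank_euclideanSpace, Fintype.card_fin]
    have e2 : Module.finrank ℝ (EuclideanSpace ℂ (Fin Q)) = 2 * Q := by
      rw [finrank_real_of_complex, finrank_euclideanSpace, Fintype.card_fin]
    rw [e1, pow_mul] at hs'card
    rw [e2, pow_mul] at hscard
    norm_num at hs'card hscard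
    have h3 : ((Finset.univ : Finset (Fin 2 × ZMod (2 * L))) ×ˢ (s' ×ˢ s)).card
        ≤ 4 * L * 25 ^ (M + Q) := by
      rw [Finset.card_product, Finset.card_product, Finset.card_univ, Fintype.card_prod,
        Fintype.card_fin, ZMod.card, pow_add]
      calc _ ≤ 2 * (2 * L) * (25 ^ M * 25 ^ Q) := by gcongr
        _ = _ := by ring
    exact_mod_cast h3
  calc _ ≤ P.real (⋃ i ∈ (Finset.univ : Finset (Fin 2 × ZMod (2 * L))) ×ˢ (s' ×ˢ s),
        {ω | t < X i ω}) := measureReal_mono hsub (measure_ne_top _ _)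
    _ ≤ _ := measureReal_biUnion_finset_le _ _
    _ ≤ _ := Finset.sum_le_card_nsmul _ _ _ hX
    _ ≤ _ := by
      rw [nsmul_eq_mul]
      exact mul_le_mul_of_nonneg_right hcard (Real.exp_nonneg _)

end NormTail

end BlockCorr

/-! ### Existence of concentration levels -/

namespace BlockCorr

section Growth

theorem eventually_rpow_add_le {γ δ a : ℝ} (hγ : 0 < γ) (hγδ : γ < δ) (ha : 0 < a) (b : ℝ) :
    ∀ᶠ N : ℕ in atTop, (N : ℝ) ^ γ + b ≤ a * (N : ℝ) ^ δ := by
  have h1 : Tendsto (fun N : ℕ => (N : ℝ) ^ (δ - γ)) atTop atTop :=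
    (tendsto_rpow_atTop (sub_pos.2 hγδ)).comp tendsto_natCast_atTop_atTop
  filter_upwards [h1.eventually_ge_atTop ((1 + |b|) / a), eventually_ge_atTop 1] with N hN hN1
  have hN1' : (1 : ℝ) ≤ N := Nat.one_le_cast.2 hN1
  have h2 : 1 ≤ (N : ℝ) ^ γ := Real.one_le_rpow hN1' hγ.le
  rw [div_le_iff₀ ha] at hN
  have h3 : (N : ℝ) ^ δ = (N : ℝ) ^ (δ - γ) * (N : ℝ) ^ γ := by
    rw [← Real.rpow_add (by linarith)]; congr 1; ring
  rw [h3]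
  have h4 : (1 + |b|) * (N : ℝ) ^ γ ≤ (N : ℝ) ^ (δ - γ) * a * (N : ℝ) ^ γ :=
    mul_le_mul_of_nonneg_right hN (by linarith)
  nlinarith [abs_nonneg b, le_abs_self b]

theorem eventually_pow_le_exp (k : ℕ) {a δ : ℝ} (ha : 0 < a) (hδ : 0 < δ) :
    ∀ᶠ N : ℕ in atTop, (N : ℝ) ^ k ≤ Real.exp (a * (N : ℝ) ^ δ) := by
  have h1 := ((isLittleO_log_rpow_atTop hδ).comp_tendsto tendsto_natCast_atTop_atTop).def
    (c := a / (k + 1)) (by positivity)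
  filter_upwards [h1, eventually_ge_atTop 1] with N hN hN1
  have hN1' : (1 : ℝ) ≤ N := Nat.one_le_cast.2 hN1
  simp only [Function.comp_apply, Real.norm_eq_abs] at hN
  rw [abs_of_nonneg (Real.log_nonneg hN1'), abs_of_nonneg (by positivity)] at hN
  rw [← Real.exp_log (by positivity : (0 : ℝ) < (N : ℝ) ^ k), Real.log_pow]
  refine Real.exp_le_exp.2 ?_
  have h2 : (k : ℝ) ≤ k + 1 := by linarith
  calc (k : ℝ) * Real.log N ≤ (k + 1) * (a / (k + 1) * (N : ℝ) ^ δ) :=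
        mul_le_mul h2 hN (Real.log_nonneg hN1') (by positivity)
    _ = a * (N : ℝ) ^ δ := by field_simp

variable {M L : ℕ → ℕ} {c β : ℝ}

theorem IsAsymptoticRegime.eventually_pos_and_le (hreg : IsAsymptoticRegime M L c β)
    (hc : 0 < c) : ∀ᶠ N : ℕ in atTop, 0 < N ∧ 0 < M N ∧ 0 < L N ∧
      (M N : ℝ) * L N ≤ 2 * c * N := by
  filter_upwards [hreg.tendsto_ratio.eventually (lt_mem_nhds hc),
    hreg.tendsto_ratio.eventually (gt_mem_nhds (by linarith : c < 2 * c)),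
    eventually_gt_atTop 0] with N h1 h2 hN
  have hN' : (0 : ℝ) < N := Nat.cast_pos.2 hN
  rw [div_lt_iff₀ hN'] at h2
  refine ⟨hN, Nat.pos_of_ne_zero fun h => ?_, Nat.pos_of_ne_zero fun h => ?_, h2.le⟩ <;>
  · rw [h] at h1; simp at h1

theorem IsAsymptoticRegime.exists_rpow_le_div (hreg : IsAsymptoticRegime M L c β)
    (hc : 0 < c) : ∃ c₀ : ℝ, 0 < c₀ ∧ ∀ᶠ N : ℕ in atTop, c₀ * (N : ℝ) ^ (1 - β) ≤ N / L N := by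
  obtain ⟨C, hC, h⟩ := hreg.isBigO_L.exists_pos
  refine ⟨C⁻¹, by positivity, ?_⟩
  filter_upwards [h.bound, hreg.eventually_pos_and_le hc] with N hN hpos
  obtain ⟨hN0, -, hL0, -⟩ := hpos
  have hN' : (0 : ℝ) < N := Nat.cast_pos.2 hN0
  have hL' : (0 : ℝ) < L N := Nat.cast_pos.2 hL0
  rw [Real.norm_eq_abs, Real.norm_eq_abs, abs_of_pos hL', abs_of_nonneg (by positivity)] at hN
  rw [le_div_iff₀ hL', Real.rpow_sub hN', Real.rpow_one]
  have h1 : (0 : ℝ) < (N : ℝ) ^ β := by positivity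
  calc C⁻¹ * (N / (N : ℝ) ^ β) * L N ≤ C⁻¹ * (N / (N : ℝ) ^ β) * (C * (N : ℝ) ^ β) := by gcongr
    _ = N := by field_simp

end Growth

section Level

open scoped Matrix.Norms.L2Operator

variable {Ω : Type*} [MeasurableSpace Ω] {P : Measure Ω} {y : ℕ → ℤ → Ω → ℂ}
  {S : ℕ → ℝ → ℝ} {smin smax : ℝ} {M L : ℕ → ℕ} {c β : ℝ}

theorem norm_invSqrt_bdiag_covMatrix_le (hy : IsIndepGaussianSeries P y)
    (hS : IsSpectralDensity P y S) (hsmin : 0 < smin)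
    (hmin : ∀ m, ∀ ν ∈ Set.Icc (0 : ℝ) 1, smin ≤ S m ν)
    (hmax : ∀ m, ∀ ν ∈ Set.Icc (0 : ℝ) 1, S m ν ≤ smax) (M L : ℕ) :
    ‖invSqrt (bdiag (covMatrix P y M L))‖ ≤ (√smin)⁻¹ :=
  norm_invSqrt_le (isHermitian_bdiag_covMatrix M L) hsmin
    (le_eigenvalues_bdiag_covMatrix hy hS hmin hmax M L)

theorem specNorm_barCorr_le (hy : IsIndepGaussianSeries P y)
    (hS : IsSpectralDensity P y S) (hsmin : 0 < smin)
    (hmin : ∀ m, ∀ ν ∈ Set.Icc (0 : ℝ) 1, smin ≤ S m ν)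
    (hmax : ∀ m, ∀ ν ∈ Set.Icc (0 : ℝ) 1, S m ν ≤ smax) (M L N : ℕ) (ω : Ω) :
    specNorm (barCorr P y M L N ω) ≤ smin⁻¹ * ‖sampleCov y M L N ω‖ := by
  have h := norm_invSqrt_bdiag_covMatrix_le hy hS hsmin hmin hmax M L
  have h0 : 0 < √smin := Real.sqrt_pos.2 hsmin
  calc ‖invSqrt (bdiag (covMatrix P y M L)) * sampleCov y M L N ω *
          invSqrt (bdiag (covMatrix P y M L))‖
      ≤ ‖invSqrt (bdiag (covMatrix P y M L))‖ * ‖sampleCov y M L N ω‖ *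
          ‖invSqrt (bdiag (covMatrix P y M L))‖ :=
        (norm_mul_le _ _).trans (mul_le_mul_of_nonneg_right (norm_mul_le _ _) (norm_nonneg _))
    _ ≤ (√smin)⁻¹ * ‖sampleCov y M L N ω‖ * (√smin)⁻¹ := by gcongr
    _ = (√smin * √smin)⁻¹ * ‖sampleCov y M L N ω‖ := by rw [mul_inv]; ring
    _ = _ := by rw [Real.mul_self_sqrt hsmin.le]

/-- In the asymptotic regime the numbers of series, of windows and of frequencies in the union bound
contribute a factor `exp (O(N / L))` only, absorbed by the Gaussian tail beyond a constant `B`. -/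
theorem exists_measure_specNorm_gt_le [IsProbabilityMeasure P] (hy : IsIndepGaussianSeries P y)
    (hS : IsSpectralDensity P y S) (hsmin : 0 < smin) (hsmax : 0 < smax)
    (hmin : ∀ m, ∀ ν ∈ Set.Icc (0 : ℝ) 1, smin ≤ S m ν)
    (hmax : ∀ m, ∀ ν ∈ Set.Icc (0 : ℝ) 1, S m ν ≤ smax)
    (hreg : IsAsymptoticRegime M L c β) (hc : 0 < c) (hβ : β < 1) :
    ∃ κ B : ℝ, 0 < κ ∧ 0 < B ∧ ∀ᶠ N : ℕ in atTop, ∀ x, B ≤ x →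
      P.real {ω | x < specNorm (barCorr P y (M N) (L N) N ω)} ≤
        Real.exp (-(κ * x * (N / L N))) := by
  obtain ⟨c₀, hc₀, hρ⟩ := hreg.exists_rpow_le_div hc
  set κ := smin / (64 * smax) with hκ
  have hκ0 : 0 < κ := by positivity
  have hβ' : 0 < 1 - β := by linarith
  refine ⟨κ / 2, 2 * (9 + 8 * c) / κ, by positivity, by positivity, ?_⟩
  filter_upwards [hρ, hreg.eventually_pos_and_le hc, eventually_pow_le_exp 2 hc₀ hβ',
    eventually_rpow_add_le (half_pos hβ') (half_lt_self hβ') hc₀ 1,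
    tendsto_natCast_atTop_atTop.eventually_ge_atTop (8 * c)] with N hρN hpos hexp hone h8 x hx
  obtain ⟨hN, hM, hL, hML⟩ := hpos
  have hN' : (0 : ℝ) < N := Nat.cast_pos.2 hN
  have hL' : (0 : ℝ) < L N := Nat.cast_pos.2 hL
  have hM' : (1 : ℝ) ≤ M N := Nat.one_le_cast.2 hM
  set ρ : ℝ := N / L N with hρdef
  have hx0 : 0 < x := lt_of_lt_of_le (by positivity) hx
  have hsub : {ω | x < specNorm (barCorr P y (M N) (L N) N ω)} ⊆
      {ω | smin * x < ‖sampleCov y (M N) (L N) N ω‖} := by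
    intro ω hω
    have h1 := lt_of_lt_of_le (show x < _ from hω)
      (specNorm_barCorr_le hy hS hsmin hmin hmax (M N) (L N) N ω)
    rwa [inv_mul_eq_div, lt_div_iff₀ hsmin, mul_comm] at h1
  refine (measureReal_mono hsub (measure_ne_top _ _)).trans
    ((measure_norm_sampleCov_gt_le hy hS hmin hmax hsmax hL hN (by positivity)).trans ?_)
  have h1 : 4 * (L N : ℝ) ≤ Real.exp ρ := by
    have h2 : (L N : ℝ) ≤ 2 * c * N := le_trans (le_mul_of_one_le_left hL'.le hM') hML
    calc 4 * (L N : ℝ) ≤ 8 * c * N := by linarith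
      _ ≤ (N : ℝ) ^ 2 := by rw [sq]; gcongr
      _ ≤ _ := hexp.trans (Real.exp_le_exp.2 hρN)
  have hρ1 : 1 ≤ ρ := by
    have : 0 ≤ (N : ℝ) ^ ((1 - β) / 2) := by positivity
    linarith
  have h2 : ((M N + (N / L N + 1) : ℕ) : ℝ) ≤ (2 * c + 2) * ρ := by
    have h3 : ((N / L N : ℕ) : ℝ) ≤ ρ := Nat.cast_div_le
    have h4 : (M N : ℝ) ≤ 2 * c * ρ := by
      rw [hρdef, ← mul_div_assoc, le_div_iff₀ hL']; exact hML
    push_cast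
    linarith
  have h3 : (25 : ℝ) ^ (M N + (N / L N + 1)) ≤ Real.exp (4 * ((2 * c + 2) * ρ)) := by
    have h25 : (25 : ℝ) ≤ Real.exp 4 := by
      have h5 : Real.exp 4 = Real.exp 1 ^ 4 := by rw [← Real.exp_nat_mul]; norm_num
      have h6 : (2.5 : ℝ) ≤ Real.exp 1 := by linarith [Real.exp_one_gt_d9]
      rw [h5]
      calc (25 : ℝ) ≤ 2.5 ^ 4 := by norm_num
        _ ≤ _ := pow_le_pow_left₀ (by norm_num) h6 4
    calc (25 : ℝ) ^ (M N + (N / L N + 1)) ≤ Real.exp 4 ^ (M N + (N / L N + 1)) := by gcongr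
      _ = Real.exp (((M N + (N / L N + 1) : ℕ) : ℝ) * 4) := by rw [Real.exp_nat_mul]
      _ ≤ _ := Real.exp_le_exp.2 (by linarith)
  calc _ ≤ Real.exp ρ * Real.exp (4 * ((2 * c + 2) * ρ)) *
        Real.exp (-(N * (smin * x) / (64 * smax * L N))) := by gcongr
    _ = Real.exp ((9 + 8 * c) * ρ - κ * x * ρ) := by
      rw [← Real.exp_add, ← Real.exp_add]
      congr 1
      rw [hρdef, hκ]
      field_simp
      ring
    _ ≤ _ := by
      refine Real.exp_le_exp.2 ?_
      rw [div_le_iff₀ hκ0] at hx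
      nlinarith

theorem exists_isConcentrationLevel [IsProbabilityMeasure P] (hy : IsIndepGaussianSeries P y)
    (hS : IsSpectralDensity P y S) (hsmin : 0 < smin) (hsmax : 0 < smax)
    (hmin : ∀ m, ∀ ν ∈ Set.Icc (0 : ℝ) 1, smin ≤ S m ν)
    (hmax : ∀ m, ∀ ν ∈ Set.Icc (0 : ℝ) 1, S m ν ≤ smax)
    (hreg : IsAsymptoticRegime M L c β) (hc : 0 < c) (hβ : β < 1) :
    ∃ α₀ : ℝ, 0 < α₀ ∧ IsConcentrationLevel P y M L α₀ := by
  obtain ⟨κ, B, hκ, hB, h⟩ := exists_measure_specNorm_gt_le hy hS hsmin hsmax hmin hmax hreg hc hβ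
  obtain ⟨c₀, hc₀, hρ⟩ := hreg.exists_rpow_le_div hc
  have hβ' : 0 < 1 - β := by linarith
  refine ⟨B, hB, fun α hα => ⟨(1 - β) / 2, by linarith, ?_⟩⟩
  have hα0 : 0 < α := hB.trans_le hα
  refine eventually_atTop.1 ?_
  filter_upwards [h, hρ, eventually_rpow_add_le (half_pos hβ') (half_lt_self hβ')
    (by positivity : 0 < κ * α * c₀) 0] with N h1 h2 h3
  refine (h1 α hα).trans (Real.exp_le_exp.2 (neg_le_neg ?_))
  rw [add_zero] at h3
  refine h3.trans ?_
  rw [mul_assoc]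
  gcongr

end Level

section ExpMoment

variable {Ω : Type*} [MeasurableSpace Ω] {P : Measure Ω}

open scoped ENNReal

/-- Exponential moment from an exponential tail beyond `b`, cutting the range into unit steps. -/
theorem lintegral_exp_mul_le_of_tail [IsProbabilityMeasure P] {X : Ω → ℝ} (hX : Measurable X)
    {a b : ℝ} (ha : 0 ≤ a)
    (h : ∀ x, b ≤ x → P {ω | x < X ω} ≤ ENNReal.ofReal (Real.exp (-((a + 1) * x)))) :
    ∫⁻ ω, ENNReal.ofReal (Real.exp (a * X ω)) ∂P ≤
      ENNReal.ofReal (Real.exp (a * b) + Real.exp (a - b) * ∑' j : ℕ, Real.exp (-(j : ℝ))) := by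
  have hpt : ∀ ω, ENNReal.ofReal (Real.exp (a * X ω)) ≤ ENNReal.ofReal (Real.exp (a * b)) +
      ∑' j : ℕ, {ω | b + j < X ω}.indicator
        (fun _ => ENNReal.ofReal (Real.exp (a * (b + j + 1)))) ω := by
    intro ω
    by_cases hb : X ω ≤ b
    · exact (ENNReal.ofReal_le_ofReal (Real.exp_le_exp.2 (by gcongr))).trans le_self_add
    · rw [not_le] at hb
      have h0 : 0 < X ω - b := by linarith
      set j := ⌈X ω - b⌉₊ - 1 with hj
      have hj1 : 1 ≤ ⌈X ω - b⌉₊ := Nat.one_le_ceil_iff.2 h0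
      have hj' : (j : ℝ) = ⌈X ω - b⌉₊ - 1 := by rw [hj, Nat.cast_sub hj1, Nat.cast_one]
      have h1 : b + j < X ω := by
        have := Nat.ceil_lt_add_one h0.le
        linarith
      have h2 : X ω ≤ b + j + 1 := by
        have := Nat.le_ceil (X ω - b)
        linarith
      refine le_trans ?_ le_add_self
      refine le_trans ?_ (ENNReal.le_tsum j)
      rw [Set.indicator_of_mem (show ω ∈ {ω | b + j < X ω} from h1)]
      exact ENNReal.ofReal_le_ofReal (Real.exp_le_exp.2 (by gcongr))
  have hms : ∀ j : ℕ, MeasurableSet {ω | b + j < X ω} := fun j =>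
    measurableSet_lt measurable_const hX
  refine (lintegral_mono hpt).trans ?_
  rw [lintegral_add_left measurable_const, lintegral_const, measure_univ, mul_one,
    lintegral_tsum fun j => (measurable_const.indicator (hms j)).aemeasurable,
    ENNReal.ofReal_add (Real.exp_nonneg _) (by positivity), ENNReal.ofReal_mul (Real.exp_nonneg _),
    ENNReal.ofReal_tsum_of_nonneg (fun _ => Real.exp_nonneg _) Real.summable_exp_neg_nat,
    ← ENNReal.tsum_mul_left]
  refine add_le_add_right (ENNReal.tsum_le_tsum fun j => ?_) _
  rw [lintegral_indicator_const (hms j)]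
  refine (mul_le_mul_right (h (b + j) (by simp)) _).trans (le_of_eq ?_)
  rw [← ENNReal.ofReal_mul (Real.exp_nonneg _), ← ENNReal.ofReal_mul (Real.exp_nonneg _),
    ← Real.exp_add, ← Real.exp_add]
  congr 2
  ring

end ExpMoment

end BlockCorr

/-! ### Deviations of linear statistics of irregular functions -/

namespace BlockCorr

section Smooth

theorem exists_lipschitz_bound_of_contDiffOn {φ : ℝ → ℝ} {V : Set ℝ} (hV : IsOpen V) {α₀ : ℝ}
    (hα₀ : 0 < α₀) (hsub : Set.Icc 0 α₀ ⊆ V) (hφ : ContDiffOn ℝ 1 φ V) :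
    ∃ α C C₀ : ℝ, α₀ < α ∧ 0 < C ∧ 0 ≤ C₀ ∧
      (∀ x ∈ Set.Icc 0 α, ∀ y ∈ Set.Icc 0 α, |φ x - φ y| ≤ C * |x - y|) ∧
      ∀ x ∈ Set.Icc 0 α, |φ x| ≤ C₀ := by
  obtain ⟨r, hr, hball⟩ := Metric.isOpen_iff.1 hV α₀ (hsub ⟨hα₀.le, le_rfl⟩)
  have hsub' : Set.Icc 0 (α₀ + r / 2) ⊆ V := by
    intro x hx
    by_cases h : x ≤ α₀
    · exact hsub ⟨hx.1, h⟩
    · refine hball ?_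
      rw [Metric.mem_ball, Real.dist_eq, abs_of_pos (by linarith)]
      linarith [hx.2]
  have hd : ContinuousOn (deriv φ) (Set.Icc 0 (α₀ + r / 2)) :=
    (hφ.continuousOn_deriv_of_isOpen hV le_rfl).mono hsub'
  obtain ⟨C, hC⟩ := isCompact_Icc.exists_bound_of_continuousOn hd
  obtain ⟨C₀, hC₀⟩ := isCompact_Icc.exists_bound_of_continuousOn (hφ.continuousOn.mono hsub')
  have h0 : (0 : ℝ) ∈ Set.Icc 0 (α₀ + r / 2) := ⟨le_rfl, by positivity⟩
  have hC0 : 0 ≤ C := (norm_nonneg _).trans (hC 0 h0)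
  refine ⟨α₀ + r / 2, C + 1, C₀, by linarith, by linarith, (norm_nonneg _).trans (hC₀ 0 h0),
    fun x hx y hy => ?_, hC₀⟩
  have h1 := (convex_Icc 0 (α₀ + r / 2)).norm_image_sub_le_of_norm_deriv_le (𝕜 := ℝ) (f := φ)
    (fun z hz => ((hφ.differentiableOn one_ne_zero).differentiableAt
      (hV.mem_nhds (hsub' hz)))) hC hy hx
  rw [Real.norm_eq_abs, Real.norm_eq_abs] at h1
  nlinarith [abs_nonneg (x - y)]

end Smooth

section Core

open scoped Matrix Matrix.Norms.L2Operator ENNReal ComplexOrder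

variable {I J : Type*} [Fintype I] [Fintype J] [DecidableEq I]

theorem sum_eigenvalues_linear_smul {V : Type*} [AddCommGroup V] [Module ℝ V] (W : V →ₗ[ℝ] Matrix I J ℂ) {t : ℝ} (x : V)
    {R : Type*} [AddCommMonoid R] (f : ℝ → R) :
    ∑ i, f ((isHermitian_mul_conjTranspose (W (t • x))).eigenvalues i)
      = ∑ i, f (t ^ 2 * (isHermitian_mul_conjTranspose (W x)).eigenvalues i) := by
  refine sum_eigenvalues_smul _ _ ?_ f
  have h : W (t • x) = (t : ℂ) • W x := by rw [map_smul]; rfl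
  rw [h, Matrix.conjTranspose_smul, Matrix.smul_mul, Matrix.mul_smul, smul_smul, RCLike.star_def,
    Complex.conj_ofReal, ← Complex.ofReal_mul, sq]

theorem exists_eigenvalues_pos {W : Matrix I J ℂ} (hW : W ≠ 0) :
    ∃ i, 0 < (isHermitian_mul_conjTranspose W).eigenvalues i := by
  by_contra! hcon
  refine hW ?_
  have h1 : (isHermitian_mul_conjTranspose W).eigenvalues = 0 := by
    ext i
    exact le_antisymm (hcon i) (eigenvalues_mul_conjTranspose_nonneg _ i)
  have h2 := (isHermitian_mul_conjTranspose W).eigenvalues_eq_zero_iff.1 h1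
  exact Matrix.self_mul_conjTranspose_eq_zero.1 h2

theorem abs_linStat_le (φ : ℝ → ℝ) (W : Matrix I J ℂ) :
    |linStat φ W| ≤ linStat (fun t => |φ t|) W := by
  rw [linStat, linStat, abs_mul, abs_of_nonneg (by positivity)]
  exact mul_le_mul_of_nonneg_left (Finset.abs_sum_le_sum_abs _ _) (by positivity)

theorem integrable_linStat_of_abs {Z : Type*} [MeasurableSpace Z] {μ : Measure Z}
    {W : Z → Matrix I J ℂ} (hW : ∀ i j, Measurable fun z => W z i j) {φ : ℝ → ℝ}
    (hφ : Measurable φ) (h : Integrable (fun z => linStat (fun t => |φ t|) (W z)) μ) :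
    Integrable (fun z => linStat φ (W z)) μ :=
  h.mono' (measurable_linStat hW hφ).aestronglyMeasurable
    (Eventually.of_forall fun z => abs_linStat_le φ (W z))

/-- A linear statistic differs from a bounded function that coincides with it when the norm is at
most `α` by a bounded term on the exceptional event and the contribution of the large
eigenvalues. -/
theorem abs_linStat_sub_le [Nonempty I] {φ : ℝ → ℝ} {W : Matrix I J ℂ} {α C₀ f : ℝ}
    (hφ₀ : ∀ x ∈ Set.Icc 0 α, |φ x| ≤ C₀) (hf : |f| ≤ C₀)
    (heq : ‖W * Wᴴ‖ ≤ α → f = linStat φ W) :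
    ENNReal.ofReal |linStat φ W - f| ≤
      ENNReal.ofReal (2 * C₀) * (if α < ‖W * Wᴴ‖ then 1 else 0) +
        ENNReal.ofReal (Fintype.card I : ℝ)⁻¹ * ∑ i, (Set.Ioi α).indicator
          (fun t => ENNReal.ofReal |φ t|) ((isHermitian_mul_conjTranspose W).eigenvalues i) := by
  have hC₀ : 0 ≤ C₀ := (abs_nonneg _).trans hf
  by_cases hα : α < ‖W * Wᴴ‖
  · rw [if_pos hα, mul_one]
    set lam := (isHermitian_mul_conjTranspose W).eigenvalues with hlam
    have h1 : ∀ i, |φ (lam i)| ≤ C₀ + (Set.Ioi α).indicator (fun t => |φ t|) (lam i) := by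
      intro i
      by_cases hi : α < lam i
      · rw [Set.indicator_of_mem (show lam i ∈ Set.Ioi α from hi)]
        linarith
      · rw [Set.indicator_of_notMem (show lam i ∉ Set.Ioi α from hi), add_zero]
        exact hφ₀ _ ⟨eigenvalues_mul_conjTranspose_nonneg _ i, not_lt.1 hi⟩
    have hn : (0 : ℝ) < Fintype.card I := Nat.cast_pos.2 Fintype.card_pos
    have hnn : ∀ i, 0 ≤ (Set.Ioi α).indicator (fun t => |φ t|) (lam i) := fun i =>
      Set.indicator_nonneg (fun _ _ => abs_nonneg _) _
    have h2 : |linStat φ W - f| ≤ 2 * C₀ + (Fintype.card I : ℝ)⁻¹ *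
        ∑ i, (Set.Ioi α).indicator (fun t => |φ t|) (lam i) := by
      calc |linStat φ W - f| ≤ |linStat φ W| + |f| := abs_sub _ _
        _ ≤ (Fintype.card I : ℝ)⁻¹ * ∑ i, (C₀ + (Set.Ioi α).indicator (fun t => |φ t|) (lam i))
            + C₀ := by
          refine add_le_add ((abs_linStat_le φ W).trans ?_) hf
          exact mul_le_mul_of_nonneg_left (Finset.sum_le_sum fun i _ => h1 i) (by positivity)
        _ = _ := by
          rw [Finset.sum_add_distrib, Finset.sum_const, Finset.card_univ, nsmul_eq_mul]
          field_simp
          ring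
    refine (ENNReal.ofReal_le_ofReal h2).trans (le_of_eq ?_)
    rw [ENNReal.ofReal_add (by positivity)
      (mul_nonneg (by positivity) (Finset.sum_nonneg fun i _ => hnn i)),
      ENNReal.ofReal_mul (inv_nonneg.2 hn.le), ENNReal.ofReal_sum_of_nonneg fun i _ => hnn i]
    congr 2
    refine Finset.sum_congr rfl fun i _ => ?_
    by_cases hi : lam i ∈ Set.Ioi α
    · rw [Set.indicator_of_mem hi, Set.indicator_of_mem hi]
    · rw [Set.indicator_of_notMem hi, Set.indicator_of_notMem hi, ENNReal.ofReal_zero]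
  · rw [heq (not_lt.1 hα)]
    simp

variable [DecidableEq J] {V : Type*} [NormedAddCommGroup V] [InnerProductSpace ℝ V]
  [FiniteDimensional ℝ V] [MeasurableSpace V] [BorelSpace V]

theorem measurable_apply_of_linear {I J : Type*} (W : V →ₗ[ℝ] Matrix I J ℂ) (i : I) (j : J) :
    Measurable fun x => W x i j := by
  have h : Continuous fun x => W x i j :=
    ((LinearMap.proj (R := ℝ) (φ := fun _ : J => ℂ) j ∘ₗ
      LinearMap.proj (R := ℝ) (φ := fun _ : I => J → ℂ) i ∘ₗ
        (W : V →ₗ[ℝ] (I → J → ℂ)))).continuous_of_finiteDimensional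
  exact h.measurable

theorem measurable_mul_conjTranspose_apply {I J : Type*} [Fintype J] (W : V →ₗ[ℝ] Matrix I J ℂ) (i j : I) :
    Measurable fun x => (W x * (W x)ᴴ) i j := by
  simp only [Matrix.mul_apply, Matrix.conjTranspose_apply, RCLike.star_def]
  refine Finset.measurable_fun_sum _ fun k _ => (measurable_apply_of_linear W i k).mul ?_
  exact RCLike.continuous_conj.measurable.comp (measurable_apply_of_linear W j k)

theorem measurable_norm_mul_conjTranspose (W : V →ₗ[ℝ] Matrix I J ℂ) :
    Measurable fun x => ‖W x * (W x)ᴴ‖ := by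
  simp only [norm_mul_conjTranspose]
  exact (W.continuous_of_finiteDimensional.norm.pow 2).measurable

/-- The expectation of a linear statistic is close to that of a bounded function that coincides
with it when the norm is at most `α`. The contribution of the large eigenvalues is bounded by
`lintegral_sum_indicator_le`, with `s = √p`. -/
theorem abs_integral_linStat_sub_le [Nonempty I] (W : V →ₗ[ℝ] Matrix I J ℂ) {φ : ℝ → ℝ}
    (hφm : Measurable φ) {α C₀ : ℝ} (hα : 0 < α) (hφ₀ : ∀ x ∈ Set.Icc 0 α, |φ x| ≤ C₀)
    {F : V → ℝ} (hFc : Continuous F) (hF : ∀ g, |F g| ≤ C₀)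
    (heq : ∀ g, ‖W g * (W g)ᴴ‖ ≤ α → F g = linStat φ (W g))
    (hint : Integrable (fun g => linStat (fun t => |φ t|) (W g)) (stdGaussian V))
    {C j D p : ℝ} (hC : 0 ≤ C) (hj : 0 ≤ j) (hD : 0 ≤ D) (hp : 0 < p) (hp1 : p ≤ 1)
    (hJ : ∫⁻ s in Set.Ioi √α, ENNReal.ofReal |φ (s ^ 2)| * ENNReal.ofReal (Real.exp (-(C * s ^ 2)))
      ≤ ENNReal.ofReal j)
    (hexp : ∫⁻ x, ENNReal.ofReal (Real.exp (4 * (C * ‖W x * (W x)ᴴ‖))) ∂(stdGaussian V)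
      ≤ ENNReal.ofReal D)
    (hbad : stdGaussian V {x | α < ‖W x * (W x)ᴴ‖} ≤ ENNReal.ofReal p)
    (hn : 16 ≤ Module.finrank ℝ V) :
    |∫ g, linStat φ (W g) ∂(stdGaussian V) - ∫ g, F g ∂(stdGaussian V)| ≤
      √p * (2 * C₀ + Module.finrank ℝ V * (√α)⁻¹ * j * (1 + Real.exp 8 + D)) := by
  have hC₀ : 0 ≤ C₀ := (abs_nonneg _).trans (hF 0)
  have hWm := measurable_apply_of_linear W
  have hnI : (0 : ℝ) < Fintype.card I := Nat.cast_pos.2 Fintype.card_pos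
  have hFi : Integrable F (stdGaussian V) :=
    Integrable.of_bound hFc.aestronglyMeasurable C₀ (Eventually.of_forall hF)
  have hLi := integrable_linStat_of_abs hWm hφm hint
  set lam : V → I → ℝ := fun x => (isHermitian_mul_conjTranspose (W x)).eigenvalues with hlam
  have hlamm : ∀ i, Measurable fun x => lam x i := fun i =>
    measurable_eigenvalues (fun x => isHermitian_mul_conjTranspose (W x))
      (measurable_mul_conjTranspose_apply W) i
  have hXm := measurable_norm_mul_conjTranspose W
  have hh : Measurable fun t => ENNReal.ofReal |φ t| := by fun_prop
  have hbadm : MeasurableSet {x | α < ‖W x * (W x)ᴴ‖} := measurableSet_lt measurable_const hXm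
  have hsq : √α ^ 2 = α := Real.sq_sqrt hα.le
  have hsqp : √p * √p = p := Real.mul_self_sqrt hp.le
  have hsp : 0 < √p := Real.sqrt_pos.2 hp
  have hsp1 : √p ≤ 1 := Real.sqrt_le_one.2 hp1
  have hlarge := lintegral_sum_indicator_le (lam := lam) hh hlamm
    (fun t _ x f => sum_eigenvalues_linear_smul W x f) hXm
    (fun x i => (le_abs_self _).trans (abs_eigenvalues_le_norm _ i))
    (a := √α) (C := C) (s := √p) (Real.sqrt_pos.2 hα) hC hsp (by omega)
  rw [hsq] at hlarge
  have hA : ENNReal.ofReal (√p)⁻¹ * stdGaussian V {x | α < ‖W x * (W x)ᴴ‖} + ENNReal.ofReal √p *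
      (∫⁻ x, ENNReal.ofReal (Real.exp (4 * (‖x‖ ^ 2 / Module.finrank ℝ V))) ∂(stdGaussian V)
        + ∫⁻ x, ENNReal.ofReal (Real.exp (4 * (C * ‖W x * (W x)ᴴ‖))) ∂(stdGaussian V))
      ≤ ENNReal.ofReal (√p * (1 + Real.exp 8 + D)) := by
    calc _ ≤ ENNReal.ofReal (√p)⁻¹ * ENNReal.ofReal p + ENNReal.ofReal √p *
          (ENNReal.ofReal (Real.exp 8) + ENNReal.ofReal D) := by
          gcongr
          exact lintegral_exp_norm_sq_stdGaussian_le hn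
      _ = _ := by
          rw [← ENNReal.ofReal_add (Real.exp_nonneg _) hD, ← ENNReal.ofReal_mul (by positivity),
            ← ENNReal.ofReal_mul (by positivity), ← ENNReal.ofReal_add (by positivity)
              (by positivity)]
          congr 1
          have : (√p)⁻¹ * p = √p := by
            rw [inv_mul_eq_div, div_eq_iff hsp.ne', hsqp]
          rw [this]
          ring
  have hmain : ENNReal.ofReal
      |∫ g, linStat φ (W g) ∂(stdGaussian V) - ∫ g, F g ∂(stdGaussian V)| ≤
      ENNReal.ofReal
        (√p * (2 * C₀ + Module.finrank ℝ V * (√α)⁻¹ * j * (1 + Real.exp 8 + D))) := by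
    rw [← integral_sub hLi hFi]
    calc _ ≤ ∫⁻ g, ENNReal.ofReal |linStat φ (W g) - F g| ∂(stdGaussian V) := by
          have := enorm_integral_le_lintegral_enorm (μ := stdGaussian V)
            (fun g => linStat φ (W g) - F g)
          simpa only [← ofReal_norm, Real.norm_eq_abs] using this
      _ ≤ ∫⁻ g, (ENNReal.ofReal (2 * C₀) * (if α < ‖W g * (W g)ᴴ‖ then 1 else 0) +
            ENNReal.ofReal (Fintype.card I : ℝ)⁻¹ * ∑ i, (Set.Ioi α).indicator
              (fun t => ENNReal.ofReal |φ t|) (lam g i)) ∂(stdGaussian V) :=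
          lintegral_mono fun g => abs_linStat_sub_le hφ₀ (hF g) (heq g)
      _ = ENNReal.ofReal (2 * C₀) * stdGaussian V {x | α < ‖W x * (W x)ᴴ‖} +
            ENNReal.ofReal (Fintype.card I : ℝ)⁻¹ * ∫⁻ g, ∑ i, (Set.Ioi α).indicator
              (fun t => ENNReal.ofReal |φ t|) (lam g i) ∂(stdGaussian V) := by
          have e : ∀ g, (if α < ‖W g * (W g)ᴴ‖ then (1 : ℝ≥0∞) else 0)
              = {x | α < ‖W x * (W x)ᴴ‖}.indicator 1 g := fun g => by
            rw [Set.indicator_apply]; rfl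
          simp only [e]
          rw [lintegral_add_left ((measurable_one.indicator hbadm).const_mul _),
            lintegral_const_mul _ (measurable_one.indicator hbadm), lintegral_indicator_one hbadm,
            lintegral_const_mul]
          exact Finset.measurable_fun_sum _ fun i _ =>
            (hh.indicator measurableSet_Ioi).comp (hlamm i)
      _ ≤ ENNReal.ofReal (2 * C₀) * ENNReal.ofReal p + ENNReal.ofReal (Fintype.card I : ℝ)⁻¹ *
            (ENNReal.ofReal (Module.finrank ℝ V * Fintype.card I * (√α)⁻¹) * ENNReal.ofReal j *
              ENNReal.ofReal (√p * (1 + Real.exp 8 + D))) := by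
          gcongr
          refine hlarge.trans ?_
          gcongr
      _ = ENNReal.ofReal (2 * C₀ * p + (Fintype.card I : ℝ)⁻¹ *
            (Module.finrank ℝ V * Fintype.card I * (√α)⁻¹ * j *
              (√p * (1 + Real.exp 8 + D)))) := by
          rw [← ENNReal.ofReal_mul (by positivity), ← ENNReal.ofReal_mul (by positivity),
            ← ENNReal.ofReal_mul (by positivity), ← ENNReal.ofReal_mul (by positivity),
            ← ENNReal.ofReal_add (by positivity) (by positivity)]
      _ ≤ _ := by
          refine ENNReal.ofReal_le_ofReal ?_
          have h1 : 2 * C₀ * p ≤ 2 * C₀ * √p := by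
            refine mul_le_mul_of_nonneg_left ?_ (by positivity)
            calc p = √p * √p := hsqp.symm
              _ ≤ √p := mul_le_of_le_one_left hsp.le hsp1
          have h2 : (Fintype.card I : ℝ)⁻¹ * (Module.finrank ℝ V * Fintype.card I * (√α)⁻¹ * j *
              (√p * (1 + Real.exp 8 + D)))
              = √p * (Module.finrank ℝ V * (√α)⁻¹ * j * (1 + Real.exp 8 + D)) := by
            field_simp
          rw [h2]
          linarith
  exact (ENNReal.ofReal_le_ofReal_iff (by positivity)).1 hmain

/-- Deviations of a linear statistic from its mean. `K = 2 Cφ √α l / √n` is the Lipschitz constant of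
the regular part, and half of the threshold pays for the error made on the mean. -/
theorem measure_abs_linStat_sub_integral_gt_le [Nonempty I] (W : V →ₗ[ℝ] Matrix I J ℂ) {l : ℝ}
    (hl : 0 < l) (hW : ∀ g, frobSq (W g) ≤ l ^ 2 * ‖g‖ ^ 2) {φ : ℝ → ℝ}
    (hφm : Measurable φ) {α Cφ C₀ : ℝ} (hα : 0 < α) (hCφ : 0 < Cφ) (hC₀ : 0 ≤ C₀)
    (hφ : ∀ x ∈ Set.Icc 0 α, ∀ y ∈ Set.Icc 0 α, |φ x - φ y| ≤ Cφ * |x - y|)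
    (hφ₀ : ∀ x ∈ Set.Icc 0 α, |φ x| ≤ C₀)
    (hint : Integrable (fun g => linStat (fun t => |φ t|) (W g)) (stdGaussian V))
    {C j D p : ℝ} (hC : 0 ≤ C) (hj : 0 ≤ j) (hD : 0 ≤ D) (hp : 0 < p) (hp1 : p ≤ 1)
    (hJ : ∫⁻ s in Set.Ioi √α, ENNReal.ofReal |φ (s ^ 2)| * ENNReal.ofReal (Real.exp (-(C * s ^ 2)))
      ≤ ENNReal.ofReal j)
    (hexp : ∫⁻ x, ENNReal.ofReal (Real.exp (4 * (C * ‖W x * (W x)ᴴ‖))) ∂(stdGaussian V)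
      ≤ ENNReal.ofReal D)
    (hbad : stdGaussian V {x | α < ‖W x * (W x)ᴴ‖} ≤ ENNReal.ofReal p)
    (hn : 16 ≤ Module.finrank ℝ V) {t : ℝ}
    (ht : 8 * (2 * Cφ * √α * l / √(Fintype.card I)) ≤ t)
    (htp : √p * (2 * C₀ + Module.finrank ℝ V * (√α)⁻¹ * j * (1 + Real.exp 8 + D)) ≤ t / 2) :
    (stdGaussian V).real
        {g | t < |linStat φ (W g) - ∫ g, linStat φ (W g) ∂(stdGaussian V)|} ≤
      p + 2 * Real.exp (-(t ^ 2 / (8 * Real.pi ^ 2 *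
            (2 * Cφ * √α * l / √(Fintype.card I)) ^ 2))) := by
  obtain ⟨F, hFc, hF, heq, hconc⟩ :=
    exists_concentrated_eq_linStat W hl hW hα hCφ hC₀ hφ hφ₀
  have hE := (abs_integral_linStat_sub_le W hφm hα hφ₀ hFc hF heq hint hC hj hD hp hp1 hJ hexp
    hbad hn).trans htp
  have hsub : {g | t < |linStat φ (W g) - ∫ g, linStat φ (W g) ∂(stdGaussian V)|} ⊆
      {x | α < ‖W x * (W x)ᴴ‖} ∪ {g | t / 2 < |F g - ∫ g, F g ∂(stdGaussian V)|} := by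
    intro g hg
    by_cases hgα : α < ‖W g * (W g)ᴴ‖
    · exact Or.inl hgα
    · right
      have hg' : t < |linStat φ (W g) - ∫ g, linStat φ (W g) ∂(stdGaussian V)| := hg
      rw [← heq g (not_lt.1 hgα)] at hg'
      change t / 2 < |F g - ∫ g, F g ∂(stdGaussian V)|
      have h3 := abs_sub_le (F g) (∫ g, F g ∂(stdGaussian V))
        (∫ g, linStat φ (W g) ∂(stdGaussian V))
      rw [abs_sub_comm (∫ g, F g ∂(stdGaussian V))] at h3
      linarith
  refine (measureReal_mono hsub (measure_ne_top _ _)).trans ((measureReal_union_le _ _).trans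
    (add_le_add ?_ ((hconc (t / 2) (by linarith)).trans (le_of_eq ?_))))
  · exact ENNReal.toReal_le_of_le_ofReal hp.le hbad
  · congr 3
    rw [div_pow, div_div]
    congr 1
    ring

end Core

end BlockCorr

/-! ### Stochastic domination -/

namespace BlockCorr

section GaussianModel

open scoped Matrix Matrix.Norms.L2Operator ENNReal

variable {Ω : Type*} [MeasurableSpace Ω] {P : Measure Ω} {y : ℕ → ℤ → Ω → ℂ}
  {S : ℕ → ℝ → ℝ} {smin smax : ℝ}

/-- The spectrum of the correlation matrix has the law of that of `W Wᴴ`, for a matrix `W` that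
depends linearly on a standard Gaussian vector. -/
theorem exists_linear_gaussian_model [IsProbabilityMeasure P] (hy : IsIndepGaussianSeries P y)
    (hS : IsSpectralDensity P y S) (hsmin : 0 < smin)
    (hmin : ∀ m, ∀ ν ∈ Set.Icc (0 : ℝ) 1, smin ≤ S m ν)
    (hmax : ∀ m, ∀ ν ∈ Set.Icc (0 : ℝ) 1, S m ν ≤ smax) (M L N : ℕ) :
    ∃ W : SeriesSpace M (N + L) →ₗ[ℝ] Matrix (Fin M × Fin L) (Fin N) ℂ,
      (∀ g, frobSq (W g) ≤ smin⁻¹ * (L / N) * (smax / 2) * ‖g‖ ^ 2) ∧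
      (∀ φ : ℝ → ℝ, Measurable φ → IdentDistrib (barPhi P y M L N φ)
        (fun g => linStat φ (W g)) P (stdGaussian (SeriesSpace M (N + L)))) ∧
      IdentDistrib (fun ω => specNorm (barCorr P y M L N ω)) (fun g => ‖W g * (W g)ᴴ‖) P
        (stdGaussian (SeriesSpace M (N + L))) := by
  obtain ⟨A, hA, hAn⟩ := exists_map_seriesVector_eq hy hS hmin hmax M (N + L)
  have hid : IdentDistrib (seriesVector y M (N + L)) A P (stdGaussian (SeriesSpace M (N + L))) :=
    ⟨(measurable_seriesVector hy M (N + L)).aemeasurable, A.continuous.aemeasurable, hA⟩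
  refine ⟨whitened P y M L N ∘ₗ A.toLinearMap, fun g => ?_, fun φ hφ => ?_, ?_⟩
  · have h1 := frobSq_whitened_le
      (norm_invSqrt_bdiag_covMatrix_le hy hS hsmin hmin hmax M L) (N := N) (A g)
    rw [inv_pow, Real.sq_sqrt hsmin.le] at h1
    refine h1.trans ?_
    rw [mul_assoc (smin⁻¹ * (L / N : ℝ))]
    exact mul_le_mul_of_nonneg_left (hAn g) (by positivity)
  · have h1 := hid.comp (measurable_linStat (measurable_apply_of_linear (whitened P y M L N)) hφ)
    have e : barPhi P y M L N φ = fun ω => linStat φ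
        (whitened P y M L N (seriesVector y M (N + L) ω)) := funext fun ω => barPhi_eq M L N φ ω
    rw [e]
    exact h1
  · have h1 := hid.comp (measurable_norm_mul_conjTranspose (whitened P y M L N))
    simp only [specNorm_barCorr_eq]
    exact h1

/-- The correlation matrix does not vanish almost surely: the whitening is invertible and
`y 0 1`, whose variance is at least `smin`, is one of the observations. -/
theorem measure_specNorm_pos_ne_zero [IsProbabilityMeasure P] (hy : IsIndepGaussianSeries P y)
    (hS : IsSpectralDensity P y S) (hsmin : 0 < smin)
    (hmin : ∀ m, ∀ ν ∈ Set.Icc (0 : ℝ) 1, smin ≤ S m ν)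
    (hmax : ∀ m, ∀ ν ∈ Set.Icc (0 : ℝ) 1, S m ν ≤ smax) {M L N : ℕ} (hM : 0 < M) (hL : 0 < L)
    (hN : 0 < N) : P {ω | 0 < specNorm (barCorr P y M L N ω)} ≠ 0 := by
  intro h0
  have hsub : ∀ ω, ¬ 0 < specNorm (barCorr P y M L N ω) → y 0 1 ω = 0 := by
    intro ω hω
    rw [specNorm_barCorr_eq, norm_mul_conjTranspose] at hω
    have h1 : whitened P y M L N (seriesVector y M (N + L) ω) = 0 := by
      by_contra hne
      exact hω (by have := norm_pos_iff.2 hne; positivity)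
    have h2 : invSqrt (bdiag (covMatrix P y M L)) * hankel M L N (seriesVector y M (N + L) ω)
        = 0 := by
      have h3 : ((√(N : ℝ))⁻¹ : ℂ) ≠ 0 := by
        rw [Ne, inv_eq_zero, Complex.ofReal_eq_zero]
        exact (Real.sqrt_pos.2 (Nat.cast_pos.2 hN)).ne'
      exact (smul_eq_zero.1 h1).resolve_left h3
    have h4 : hankel M L N (seriesVector y M (N + L) ω) = 0 := by
      obtain ⟨u, hu⟩ := isUnit_invSqrt (isHermitian_bdiag_covMatrix (P := P) (y := y) M L) hsmin
        (le_eigenvalues_bdiag_covMatrix hy hS hmin hmax M L)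
      have h5 := congrArg (fun B => (↑u⁻¹ : Matrix (Fin M × Fin L) (Fin M × Fin L) ℂ) * B) h2
      rwa [← hu, ← Matrix.mul_assoc, Units.inv_mul, Matrix.one_mul, Matrix.mul_zero] at h5
    have h6 := hankel_seriesVector_apply y M L N ω (⟨0, hM⟩, ⟨0, hL⟩) ⟨0, hN⟩
    rw [h4] at h6
    simpa [lagVector] using h6.symm
  have hae : ∀ᵐ ω ∂P, y 0 1 ω = 0 := by
    rw [ae_iff]
    refine measure_mono_null (fun ω (hω : ¬ y 0 1 ω = 0) => ?_) h0
    exact not_not.1 fun h => hω (hsub ω h)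
  have h7 := (hy.integral_norm_sq_sum_mem_Icc hS hmin hmax 0
    (τ := fun _ : Fin 1 => (1 : ℤ)) (fun a b _ => Subsingleton.elim a b) fun _ => 1).1
  have h8 : ∫ ω, ‖∑ _k : Fin 1, (1 : ℂ) * y 0 1 ω‖ ^ 2 ∂P = 0 := by
    refine integral_eq_zero_of_ae (hae.mono fun ω hω => ?_)
    simp [hω]
  rw [h8] at h7
  simp at h7
  linarith

/-- If the linear statistic of `|φ|` is integrable for one choice of the dimensions, then
`φ(s²)` is integrable away from zero against a Gaussian weight. -/
theorem exists_lintegral_weight_ne_top_of_integrable_barPhi [IsProbabilityMeasure P]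
    (hy : IsIndepGaussianSeries P y) (hS : IsSpectralDensity P y S) (hsmin : 0 < smin)
    (hmin : ∀ m, ∀ ν ∈ Set.Icc (0 : ℝ) 1, smin ≤ S m ν)
    (hmax : ∀ m, ∀ ν ∈ Set.Icc (0 : ℝ) 1, S m ν ≤ smax) {M L N : ℕ} (hM : 0 < M) (hL : 0 < L)
    (hN : 0 < N) {φ : ℝ → ℝ} (hφ : Measurable φ)
    (hint : Integrable (barPhi P y M L N fun t => |φ t|) P) :
    ∃ C : ℝ, 0 ≤ C ∧ ∀ a : ℝ, 0 < a → ∫⁻ s in Set.Ioi a,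
      ENNReal.ofReal |φ (s ^ 2)| * ENNReal.ofReal (Real.exp (-(C * s ^ 2))) ≠ ∞ := by
  obtain ⟨W, -, hlin, hnorm⟩ := exists_linear_gaussian_model hy hS hsmin hmin hmax M L N
  have hid := hlin (fun t => |φ t|) hφ.abs
  refine exists_lintegral_weight_ne_top (V := SeriesSpace M (N + L))
    (lam := fun x => (isHermitian_mul_conjTranspose (W x)).eigenvalues)
    (h := fun t => ENNReal.ofReal |φ t|) (by fun_prop)
    (fun i => measurable_eigenvalues (fun x => isHermitian_mul_conjTranspose (W x))
      (measurable_mul_conjTranspose_apply W) i)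
    (fun t _ x f => sum_eigenvalues_linear_smul W x f) ?_ ?_
  · have h1 := (hid.integrable_iff.1 hint).const_mul ((Fintype.card (Fin M × Fin L) : ℝ))
    have h2 : ∀ x, ∑ i, ENNReal.ofReal |φ ((isHermitian_mul_conjTranspose (W x)).eigenvalues i)|
        = ENNReal.ofReal ((Fintype.card (Fin M × Fin L) : ℝ) * linStat (fun t => |φ t|) (W x)) := by
      intro x
      have hcard : (Fintype.card (Fin M × Fin L) : ℝ) ≠ 0 := by
        rw [Fintype.card_prod, Fintype.card_fin, Fintype.card_fin]
        positivity
      rw [linStat, ← mul_assoc, mul_inv_cancel₀ hcard, one_mul,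
        ENNReal.ofReal_sum_of_nonneg fun i _ => abs_nonneg _]
    simp only [h2]
    exact h1.lintegral_lt_top.ne
  · refine fun h0 => measure_specNorm_pos_ne_zero hy hS hsmin hmin hmax hM hL hN ?_
    have h1 := hnorm.measure_mem_eq (s := Set.Ioi 0) measurableSet_Ioi
    refine h1.trans (measure_mono_null (fun x hx => ?_) h0)
    refine exists_eigenvalues_pos fun hW => ?_
    have hx' : 0 < ‖W x * (W x)ᴴ‖ := hx
    rw [hW] at hx'
    simp at hx'

end GaussianModel

section Main

open scoped Matrix Matrix.Norms.L2Operator ENNReal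

theorem exp_neg_add_two_mul_exp_neg_le {p q z : ℝ} (hp : z + 2 ≤ p) (hq : z + 2 ≤ q) :
    Real.exp (-p) + 2 * Real.exp (-q) ≤ Real.exp (-z) := by
  have h1 : Real.exp (-p) ≤ Real.exp (-(z + 2)) := Real.exp_le_exp.2 (by linarith)
  have h2 : Real.exp (-q) ≤ Real.exp (-(z + 2)) := Real.exp_le_exp.2 (by linarith)
  have h3 : Real.exp (-z) = Real.exp (-(z + 2)) * Real.exp 2 := by
    rw [← Real.exp_add]; congr 1; ring
  have h4 : (3 : ℝ) ≤ Real.exp 2 := by linarith [Real.add_one_le_exp (2 : ℝ)]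
  rw [h3]
  nlinarith [Real.exp_pos (-(z + 2))]

/-- The threshold `n ^ ε / (m √l)` exceeds the Lipschitz constant `K` of the linear statistic by a
factor of order `n ^ ε`. -/
theorem sq_mul_rpow_le {K t k c m l n ε : ℝ} (hm : 0 < m) (hl : 0 < l) (hn : 0 < n) (hk : 0 ≤ k)
    (hml : m * l ≤ 2 * c * n) (hK : K ^ 2 = k / (m * n)) (ht : t = n ^ ε * (1 / (m * √l))) :
    K ^ 2 * n ^ (2 * ε) ≤ 2 * c * k * t ^ 2 := by
  have htsq : t ^ 2 = n ^ (2 * ε) / (m ^ 2 * l) := by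
    rw [ht, mul_pow, div_pow, mul_pow, Real.sq_sqrt hl.le, mul_comm 2 ε, Real.rpow_mul hn.le,
      Real.rpow_two]
    ring
  rw [hK, htsq, div_mul_eq_mul_div, ← mul_div_assoc, div_le_div_iff₀ (by positivity)
    (by positivity)]
  have h1 : 0 ≤ k * n ^ (2 * ε) * m := by positivity
  calc k * n ^ (2 * ε) * (m ^ 2 * l) = k * n ^ (2 * ε) * m * (m * l) := by ring
    _ ≤ k * n ^ (2 * ε) * m * (2 * c * n) := mul_le_mul_of_nonneg_left hml h1
    _ = _ := by ring

theorem eight_mul_le_of_sq_mul_le {K t r b : ℝ} (hK : 0 ≤ K) (ht : 0 ≤ t) (hb : 0 < b)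
    (h : K ^ 2 * r ≤ b * t ^ 2) (hr : 64 * b ≤ r) : 8 * K ≤ t := by
  have h2 : K ^ 2 * (64 * b) ≤ b * t ^ 2 :=
    (mul_le_mul_of_nonneg_left hr (by positivity)).trans h
  have h3 : (8 * K) ^ 2 ≤ t ^ 2 := by
    refine le_of_mul_le_mul_left ?_ hb
    calc b * (8 * K) ^ 2 = K ^ 2 * (64 * b) := by ring
      _ ≤ _ := h2
  exact (pow_le_pow_iff_left₀ (by positivity) ht two_ne_zero).1 h3

theorem inv_le_half_threshold {t c m l n ε : ℝ} (hm : 0 < m) (hl : 1 ≤ l) (hn : 1 ≤ n)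
    (hε : 0 ≤ ε) (hml : m * l ≤ 2 * c * n) (ht : t = n ^ ε * (1 / (m * √l))) :
    (4 * c * n)⁻¹ ≤ t / 2 := by
  have hl0 : 0 < √l := Real.sqrt_pos.2 (by linarith)
  have h1 : 1 ≤ n ^ ε := Real.one_le_rpow hn hε
  have h2 : √l ≤ l := Real.sqrt_le_self_iff.2 (Or.inr hl)
  have h3 : m * √l ≤ 2 * c * n := (mul_le_mul_of_nonneg_left h2 hm.le).trans hml
  have h4 : 1 / (2 * c * n) ≤ 1 / (m * √l) := one_div_le_one_div_of_le (by positivity) h3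
  have h5 : 1 / (m * √l) ≤ t := by rw [ht]; exact le_mul_of_one_le_left (by positivity) h1
  have h6 : (4 * c * n)⁻¹ = 1 / (2 * c * n) / 2 := by rw [div_div, one_div]; congr 1; ring
  rw [h6]
  linarith

/-- The truncation error is below any inverse power of `n`. -/
theorem sqrt_exp_mul_le {A b d c n δ : ℝ} (hA : 0 ≤ A) (hb : 0 ≤ b) (hc : 0 < c) (hn : 1 ≤ n)
    (hd : d ≤ 8 * c * n ^ 2) (hnE : 4 * c * (A + 8 * c * b) ≤ n)
    (hexp : n ^ 4 ≤ Real.exp (1 / 2 * n ^ δ)) :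
    √(Real.exp (-(n ^ δ))) * (A + d * b) ≤ (4 * c * n)⁻¹ := by
  have hn0 : 0 < n := by linarith
  have h1 : √(Real.exp (-(n ^ δ))) = (Real.exp (1 / 2 * n ^ δ))⁻¹ := by
    rw [← Real.exp_half, ← Real.exp_neg]
    congr 1
    ring
  have h2 : A + d * b ≤ (A + 8 * c * b) * n ^ 2 := by
    calc A + d * b ≤ A * n ^ 2 + 8 * c * n ^ 2 * b :=
          add_le_add (le_mul_of_one_le_right hA (one_le_pow₀ hn)) (by gcongr)
      _ = _ := by ring
  have h5 : 4 * c * n * ((A + 8 * c * b) * n ^ 2) ≤ Real.exp (1 / 2 * n ^ δ) := by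
    calc 4 * c * n * ((A + 8 * c * b) * n ^ 2) = 4 * c * (A + 8 * c * b) * n ^ 3 := by ring
      _ ≤ n * n ^ 3 := by gcongr
      _ = n ^ 4 := by ring
      _ ≤ _ := hexp
  rw [h1]
  calc _ ≤ (Real.exp (1 / 2 * n ^ δ))⁻¹ * ((A + 8 * c * b) * n ^ 2) := by gcongr
    _ ≤ _ := by
      rw [inv_mul_eq_div, div_le_iff₀ (Real.exp_pos _), inv_mul_eq_div,
        le_div_iff₀ (by positivity)]
      linarith

theorem finrank_seriesSpace (M T : ℕ) :
    Module.finrank ℝ (SeriesSpace M T) = 2 * (M * T) := by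
  rw [finrank_euclideanSpace, Fintype.card_prod, Fintype.card_prod, Fintype.card_fin,
    Fintype.card_fin, Fintype.card_bool, mul_comm]

theorem finrank_seriesSpace_le {M L N : ℕ} {c : ℝ} (hc : 0 < c) (hN : 0 < N) (hL : 0 < L)
    (hML : (M : ℝ) * L ≤ 2 * c * N) :
    (Module.finrank ℝ (SeriesSpace M (N + L)) : ℝ) ≤ 8 * c * (N : ℝ) ^ 2 := by
  have hN1 : (1 : ℝ) ≤ N := Nat.one_le_cast.2 hN
  have hL1 : (1 : ℝ) ≤ L := Nat.one_le_cast.2 hL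
  have hMle : (M : ℝ) ≤ 2 * c * N :=
    le_trans (le_mul_of_one_le_right (Nat.cast_nonneg _) hL1) hML
  rw [finrank_seriesSpace, Nat.cast_mul, Nat.cast_mul, Nat.cast_add, Nat.cast_two]
  have h1 : (M : ℝ) * N ≤ 2 * c * N * N := by gcongr
  have h2 : 2 * c * (N : ℝ) ≤ 2 * c * N * N := le_mul_of_one_le_right (by positivity) hN1
  calc 2 * ((M : ℝ) * (N + L)) = 2 * (M * N) + 2 * (M * L) := by ring
    _ ≤ 2 * (2 * c * N * N) + 2 * (2 * c * N * N) :=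
        add_le_add (mul_le_mul_of_nonneg_left h1 zero_le_two)
          (mul_le_mul_of_nonneg_left (hML.trans h2) zero_le_two)
    _ = _ := by ring

variable {Ω : Type*} [MeasurableSpace Ω] {P : Measure Ω} {y : ℕ → ℤ → Ω → ℂ}
  {S : ℕ → ℝ → ℝ} {smin smax : ℝ} {M L : ℕ → ℕ} {c β : ℝ}

set_option maxHeartbeats 1000000 in
/-- Concentration at the scale `1 / (M √L)`, for a test function that is `C¹` near `[0, α₀]`. Beyond
`α₀` it is only known to have integrable linear statistics. -/
theorem stochDominated_barPhi [IsProbabilityMeasure P] (hy : IsIndepGaussianSeries P y)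
    (hS : IsSpectralDensity P y S) (hsmin : 0 < smin) (hsmax : 0 < smax)
    (hmin : ∀ m, ∀ ν ∈ Set.Icc (0 : ℝ) 1, smin ≤ S m ν)
    (hmax : ∀ m, ∀ ν ∈ Set.Icc (0 : ℝ) 1, S m ν ≤ smax)
    (hreg : IsAsymptoticRegime M L c β) (hc : 0 < c) (hβ : β < 1) {α₀ : ℝ} (hα₀ : 0 < α₀)
    (hlevel : IsConcentrationLevel P y M L α₀) {φ : ℝ → ℝ} (hφm : Measurable φ) {V : Set ℝ}
    (hV : IsOpen V) (hVsub : Set.Icc 0 α₀ ⊆ V) (hφV : ContDiffOn ℝ 1 φ V)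
    (hint : ∀ᶠ N : ℕ in atTop, Integrable (barPhi P y (M N) (L N) N (fun t => |φ t|)) P) :
    StochDominated P (U := fun _ => Unit)
      (fun N _ ω => |barPhi P y (M N) (L N) N φ ω - ∫ ω', barPhi P y (M N) (L N) N φ ω' ∂P|)
      (fun N _ _ => 1 / ((M N : ℝ) * Real.sqrt (L N : ℝ))) := by
  intro ε hε
  obtain ⟨α, Cφ, C₀, hαα₀, hCφ, hC₀, hLip, hbd⟩ :=
    exists_lipschitz_bound_of_contDiffOn hV hα₀ hVsub hφV
  have hα : 0 < α := hα₀.trans hαα₀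
  have hsα : 0 < √α := Real.sqrt_pos.2 hα
  obtain ⟨ε₁, hε₁, N₀, hN₀⟩ := hlevel α hαα₀.le
  obtain ⟨κ, B, hκ, hB, htail⟩ :=
    exists_measure_specNorm_gt_le hy hS hsmin hsmax hmin hmax hreg hc hβ
  obtain ⟨c₀, hc₀, hρ⟩ := hreg.exists_rpow_le_div hc
  obtain ⟨C, hC, hJ⟩ : ∃ C : ℝ, 0 ≤ C ∧ ∀ a : ℝ, 0 < a → ∫⁻ s in Set.Ioi a,
      ENNReal.ofReal |φ (s ^ 2)| * ENNReal.ofReal (Real.exp (-(C * s ^ 2))) ≠ ∞ := by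
    obtain ⟨N, h1, h2⟩ := (hint.and (hreg.eventually_pos_and_le hc)).exists
    exact exists_lintegral_weight_ne_top_of_integrable_barPhi hy hS hsmin hmin hmax h2.2.1
      h2.2.2.1 h2.1 hφm h1
  set j : ℝ := (∫⁻ s in Set.Ioi √α,
      ENNReal.ofReal |φ (s ^ 2)| * ENNReal.ofReal (Real.exp (-(C * s ^ 2)))).toReal with hj
  have hj0 : 0 ≤ j := ENNReal.toReal_nonneg
  have hJj := (ENNReal.ofReal_toReal (hJ √α hsα)).ge
  set D : ℝ := Real.exp (4 * C * B) + Real.exp (4 * C - B) * ∑' j : ℕ, Real.exp (-(j : ℝ)) with hD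
  have hD0 : 0 ≤ D := by
    have : 0 ≤ ∑' j : ℕ, Real.exp (-(j : ℝ)) := tsum_nonneg fun _ => Real.exp_nonneg _
    positivity
  -- `k₂ / (M N)` is the square of the Lipschitz constant of the linear statistic
  set k₂ : ℝ := 2 * Cφ ^ 2 * α * smin⁻¹ * smax with hk₂
  have hk₂0 : 0 < k₂ := by positivity
  set E : ℝ := 2 * C₀ + 8 * c * (√α)⁻¹ * j * (1 + Real.exp 8 + D) with hE
  have hE0 : 0 ≤ E := by positivity
  set c' : ℝ := (16 * Real.pi ^ 2 * c * k₂)⁻¹ with hc'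
  have hc'0 : 0 < c' := by have := Real.pi_pos; positivity
  have hβ' : 0 < 1 - β := by linarith
  have hmin0 : 0 < min ε₁ (2 * ε) := lt_min hε₁ (by linarith)
  refine ⟨min ε₁ (2 * ε) / 2, half_pos hmin0, eventually_atTop.1 ?_⟩
  filter_upwards [htail, hρ, hint, hreg.eventually_pos_and_le hc, eventually_ge_atTop N₀,
    eventually_ge_atTop 8, tendsto_natCast_atTop_atTop.eventually_ge_atTop (4 * c * E),
    eventually_pow_le_exp 4 one_half_pos hε₁,
    eventually_rpow_add_le (half_pos hβ') (half_lt_self hβ') (mul_pos hκ hc₀) (4 * C + 1),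
    eventually_rpow_add_le (half_pos hmin0) ((half_lt_self hmin0).trans_le (min_le_left _ _))
      one_pos 2,
    eventually_rpow_add_le (half_pos hmin0) ((half_lt_self hmin0).trans_le (min_le_right _ _))
      hc'0 2,
    eventually_rpow_add_le hε (by linarith : ε < 2 * ε) one_pos (128 * c * k₂)]
    with N htailN hρN hintN hpos hNN₀ hN8 hNE hN4 hκN hp1 hp2 hN2ε u
  obtain ⟨hN, hM, hL, hML⟩ := hpos
  have hN' : (0 : ℝ) < N := Nat.cast_pos.2 hN
  have hN1 : (1 : ℝ) ≤ N := Nat.one_le_cast.2 hN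
  have hL' : (0 : ℝ) < L N := Nat.cast_pos.2 hL
  have hL1 : (1 : ℝ) ≤ L N := Nat.one_le_cast.2 hL
  have hM' : (0 : ℝ) < M N := Nat.cast_pos.2 hM
  have hM1 : (1 : ℝ) ≤ M N := Nat.one_le_cast.2 hM
  have : Nonempty (Fin (M N) × Fin (L N)) := ⟨(⟨0, hM⟩, ⟨0, hL⟩)⟩
  obtain ⟨W, hWl, hlin, hnorm⟩ :=
    exists_linear_gaussian_model hy hS hsmin hmin hmax (M N) (L N) N
  set G := stdGaussian (SeriesSpace (M N) (N + L N)) with hG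
  set lsq : ℝ := smin⁻¹ * (L N / N) * (smax / 2) with hlsq
  have hlsq0 : 0 < lsq := by positivity
  set p : ℝ := Real.exp (-((N : ℝ) ^ ε₁)) with hp
  have hp0 : 0 < p := Real.exp_pos _
  have hple : p ≤ 1 := Real.exp_le_one_iff.2 (neg_nonpos.2 (by positivity))
  have hlaw : ∀ x, G {g | x < ‖W g * (W g)ᴴ‖}
      = P {ω | x < specNorm (barCorr P y (M N) (L N) N ω)} := fun x =>
    (hnorm.measure_mem_eq (s := Set.Ioi x) measurableSet_Ioi).symm
  have hbad : G {g | α < ‖W g * (W g)ᴴ‖} ≤ ENNReal.ofReal p := by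
    rw [hlaw, ← ofReal_measureReal]
    exact ENNReal.ofReal_le_ofReal (hN₀ N hNN₀)
  have hexp : ∫⁻ g, ENNReal.ofReal (Real.exp (4 * (C * ‖W g * (W g)ᴴ‖))) ∂G
      ≤ ENNReal.ofReal D := by
    have h1 := lintegral_exp_mul_le_of_tail (P := G) (measurable_norm_mul_conjTranspose W)
      (a := 4 * C) (b := B) (by positivity) fun x hx => by
        rw [hlaw, ← ofReal_measureReal]
        refine ENNReal.ofReal_le_ofReal ((htailN x hx).trans (Real.exp_le_exp.2 (neg_le_neg ?_)))
        have h2 : 4 * C + 1 ≤ κ * (N / L N) := by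
          have h3 : 0 ≤ (N : ℝ) ^ ((1 - β) / 2) := by positivity
          have h4 : κ * c₀ * (N : ℝ) ^ (1 - β) ≤ κ * (N / L N) := by
            rw [mul_assoc]; gcongr
          linarith
        calc (4 * C + 1) * x ≤ κ * (N / L N) * x :=
              mul_le_mul_of_nonneg_right h2 (hB.le.trans hx)
          _ = _ := by ring
    simpa only [mul_assoc, hD] using h1
  have hcard : (Fintype.card (Fin (M N) × Fin (L N)) : ℝ) = M N * L N := by
    rw [Fintype.card_prod, Fintype.card_fin, Fintype.card_fin, Nat.cast_mul]
  have hfin16 : 16 ≤ Module.finrank ℝ (SeriesSpace (M N) (N + L N)) := by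
    rw [finrank_seriesSpace]
    have : N ≤ M N * (N + L N) := (Nat.le_add_right N (L N)).trans (Nat.le_mul_of_pos_left _ hM)
    omega
  set t : ℝ := (N : ℝ) ^ ε * (1 / ((M N : ℝ) * √(L N : ℝ))) with ht
  have ht0 : 0 < t := by positivity
  set K : ℝ := 2 * Cφ * √α * √lsq / √(Fintype.card (Fin (M N) × Fin (L N))) with hK
  have hKsq : K ^ 2 = k₂ / (M N * N) := by
    rw [hK, hcard, div_pow, mul_pow, mul_pow, mul_pow, Real.sq_sqrt hα.le, Real.sq_sqrt hlsq0.le,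
      Real.sq_sqrt (by positivity), hlsq, hk₂]
    field_simp
  have hK0 : 0 < K := by
    have : 0 < (Fintype.card (Fin (M N) × Fin (L N)) : ℝ) := by rw [hcard]; positivity
    positivity
  have hKt : K ^ 2 * (N : ℝ) ^ (2 * ε) ≤ 2 * c * k₂ * t ^ 2 :=
    sq_mul_rpow_le hM' hL' hN' hk₂0.le hML hKsq ht
  have ht8 : 8 * K ≤ t := by
    refine eight_mul_le_of_sq_mul_le hK0.le ht0.le (by positivity) hKt ?_
    have : 0 ≤ (N : ℝ) ^ ε := by positivity
    linarith
  have htp : √p * (2 * C₀ + Module.finrank ℝ (SeriesSpace (M N) (N + L N)) * (√α)⁻¹ * j *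
      (1 + Real.exp 8 + D)) ≤ t / 2 := by
    refine le_trans ?_ (inv_le_half_threshold hM' hL1 hN1 hε.le hML ht)
    have h1 := sqrt_exp_mul_le (A := 2 * C₀) (b := (√α)⁻¹ * j * (1 + Real.exp 8 + D))
      (by positivity) (by positivity) hc hN1 (finrank_seriesSpace_le hc hN hL hML)
      (le_of_eq_of_le (by rw [hE]; ring) hNE) hN4
    simpa only [mul_assoc] using h1
  have hid := hlin φ hφm
  have hset : P.real {ω | t < |barPhi P y (M N) (L N) N φ ω
        - ∫ ω', barPhi P y (M N) (L N) N φ ω' ∂P|}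
      = G.real {g | t < |linStat φ (W g) - ∫ g, linStat φ (W g) ∂G|} := by
    rw [hid.integral_eq, measureReal_def, measureReal_def]
    congr 1
    exact hid.measure_mem_eq (s := {x | t < |x - ∫ g, linStat φ (W g) ∂G|})
      (measurableSet_lt measurable_const (by fun_prop))
  change P.real {ω | t < |barPhi P y (M N) (L N) N φ ω
        - ∫ ω', barPhi P y (M N) (L N) N φ ω' ∂P|} ≤ _
  rw [hset]
  refine (measure_abs_linStat_sub_integral_gt_le W (l := √lsq) (Real.sqrt_pos.2 hlsq0)
    (fun g => by rw [Real.sq_sqrt hlsq0.le]; exact hWl g) hφm hα hCφ hC₀ hLip hbd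
    ((hlin _ hφm.abs).integrable_iff.1 hintN) hC hj0 hD0 hp0 hple hJj hexp hbad hfin16 ht8
    htp).trans ?_
  rw [one_mul] at hp1
  refine exp_neg_add_two_mul_exp_neg_le hp1 (hp2.trans ?_)
  have hπ := Real.pi_pos
  rw [hc', inv_mul_eq_div, div_le_div_iff₀ (by positivity) (by positivity)]
  nlinarith [mul_le_mul_of_nonneg_left hKt (by positivity : 0 ≤ 8 * Real.pi ^ 2)]

end Main

end BlockCorr

theorem mainTheorem5 {Ω : Type*} [MeasurableSpace Ω] (P : Measure Ω) [IsProbabilityMeasure P]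
    (y : ℕ → ℤ → Ω → ℂ) (S : ℕ → ℝ → ℝ) (M L : ℕ → ℕ) (c β γ₀ : ℝ)
    (hc : 0 < c) (hβ : β ∈ Set.Ioo (0 : ℝ) 1) (hγ₀ : 0 < γ₀)
    (hy : BlockCorr.IsIndepGaussianSeries P y)
    (hreg : BlockCorr.IsAsymptoticRegime M L c β)
    (hS : BlockCorr.IsSpectralDensity P y S)
    (hbound : BlockCorr.UniformlyBoundedDensities S)
    (hweight : BlockCorr.UniformlyWeightedSummable P y γ₀) :
    (∃ α₀ : ℝ, 0 < α₀ ∧ BlockCorr.IsConcentrationLevel P y M L α₀) ∧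
    ∀ α₀ : ℝ, 0 < α₀ → BlockCorr.IsConcentrationLevel P y M L α₀ →
      ∀ φ : ℝ → ℝ, Measurable φ →
        (∃ V : Set ℝ, IsOpen V ∧ Set.Icc 0 α₀ ⊆ V ∧ ContDiffOn ℝ ((⊤ : ℕ∞) : WithTop ℕ∞) φ V) →
        (∀ᶠ N : ℕ in atTop,
          Integrable (BlockCorr.barPhi P y (M N) (L N) N (fun t => |φ t|)) P) →
        BlockCorr.StochDominated P (U := fun _ => Unit)
          (fun N _ ω => |BlockCorr.barPhi P y (M N) (L N) N φ ω
            - ∫ ω', BlockCorr.barPhi P y (M N) (L N) N φ ω' ∂P|)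
          (fun N _ _ => 1 / ((M N : ℝ) * Real.sqrt (L N : ℝ))) := by
  obtain ⟨⟨smax, hmax⟩, smin, hsmin, hmin⟩ := hbound
  have h0 : (0 : ℝ) ∈ Set.Icc (0 : ℝ) 1 := ⟨le_rfl, zero_le_one⟩
  have hsmax : 0 < smax := hsmin.trans_le ((hmin 0 0 h0).trans (hmax 0 0 h0))
  refine ⟨BlockCorr.exists_isConcentrationLevel hy hS hsmin hsmax hmin hmax hreg hc hβ.2,
    fun α₀ hα₀ hlevel φ hφm hφ hint => ?_⟩
  obtain ⟨V, hV, hVsub, hφV⟩ := hφ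
  exact BlockCorr.stochDominated_barPhi hy hS hsmin hsmax hmin hmax hreg hc hβ.2 hα₀ hlevel hφm hV
    hVsub (hφV.of_le (by exact_mod_cast le_top)) hint
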